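/- Let $K$ be an arbitrary field, let $n \ge 3$ be an integer, and let $C \subset \mathbb{P}^n_K$ be a double line of arithmetic genus $g$; that is, $C$ is a closed, locally Cohen–Macaulay, one-dimensional subscheme of degree $2$ and arithmetic genus $g$ whose support is a line $L \subset \mathbb{P}^n_K$ and whose ideal sheaf satisfies $\mathcal{I}_L^2 \subseteq \mathcal{I}_C$. (Degree and arithmetic genus are defined by the Hilbert polynomial, which is $2t + 1 - g$.) Let $\mathcal{N}_C = \mathcal{H}om_{\mathcal{O}_C}(\mathcal{I}_C/\mathcal{I}_C^2, \mathcal{O}_C)$ be the normal sheaf of $C$ in $\mathbb{P}^n_K$, and let $h^0(C, \mathcal{N}_C) = \dim_K H^0(C, \mathcal{N}_C)$. Then $$ h^0(C, \mathcal{N}_C) = \begin{cases} 4(n-1) & \text{if } g = -1,\\ (n-1)(3-g) - 1 & \text{if } g \le -2 \text{ and } \operatorname{char} K \ne 2,\\ n(3-g) - 6 & \text{if } g \le -2 \text{ and } \operatorname{char} K = 2. \end{cases} $$ -/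

import Mathlib

open CategoryTheory AlgebraicGeometry TopologicalSpace

universe u

noncomputable section

namespace ProjCurve

/-- The standard grading of the polynomial ring `K[x₀, …, xₙ]`. -/
abbrev grading (n : ℕ) (K : Type u) [Field K] :
    ℕ → Submodule K (MvPolynomial (Fin (n + 1)) K) :=
  MvPolynomial.homogeneousSubmodule (Fin (n + 1)) K

instance gradedAlgebra (n : ℕ) (K : Type u) [Field K] : GradedAlgebra (grading n K) :=
  MvPolynomial.gradedAlgebra

/-- Projective space `ℙⁿ` over `K`, as a scheme. Closed subschemes `C` of it are given by their
ideal sheaves `C : (ProjSpace n K).IdealSheafData`. -/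
abbrev ProjSpace (n : ℕ) (K : Type u) [Field K] : Scheme.{u} := Proj (grading n K)

/-- The structure morphism `ℙⁿ ⟶ Spec K`. -/
def structureMorphism (n : ℕ) (K : Type u) [Field K] : ProjSpace n K ⟶ Spec (.of K) :=
  Proj.toSpecZero (grading n K) ≫
    Spec.map (CommRingCat.ofHom (algebraMap K (grading n K 0)))

/-- The ring homomorphism from `K` to the sections of `𝒪` over an open subset of `ℙⁿ`. -/
def scalars (n : ℕ) (K : Type u) [Field K] (U : (ProjSpace n K).Opens) :
    K →+* Γ(ProjSpace n K, U) :=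
  ((Scheme.ΓSpecIso (.of K)).inv ≫ (structureMorphism n K).appTop ≫
    (ProjSpace n K).presheaf.map (homOfLE (le_top : U ≤ ⊤)).op).hom

instance algebraSections (n : ℕ) (K : Type u) [Field K] (U : (ProjSpace n K).Opens) :
    Algebra K Γ(ProjSpace n K, U) :=
  (scalars n K U).toAlgebra

/-- A local ring is Cohen–Macaulay if it is noetherian and its maximal ideal contains a regular
sequence whose length is the Krull dimension of the ring. -/
def IsCohenMacaulayLocal (A : Type*) [CommRing A] [IsLocalRing A] : Prop :=
  IsNoetherianRing A ∧ ∃ rs : List A,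
    (∀ r ∈ rs, r ∈ IsLocalRing.maximalIdeal A) ∧ RingTheory.Sequence.IsRegular A rs ∧
      (rs.length : WithBot ℕ∞) = ringKrullDim A

/-- A curve: a one-dimensional, locally Cohen–Macaulay closed subscheme of `ℙⁿ`. -/
structure IsCurve {n : ℕ} {K : Type u} [Field K] (C : (ProjSpace n K).IdealSheafData) : Prop where
  dim_eq_one : topologicalKrullDim C.subscheme = 1
  cohenMacaulay : ∀ x : C.subscheme, IsCohenMacaulayLocal (C.subscheme.presheaf.stalk x)

/-- A line in `ℙⁿ`: the common zero locus of `n - 1` linearly independent linear forms. -/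
def IsLine {n : ℕ} {K : Type u} [Field K] (L : Closeds (ProjSpace n K)) : Prop :=
  ∃ W : Submodule K (MvPolynomial (Fin (n + 1)) K),
    W ≤ grading n K 1 ∧ Module.finrank K W + 1 = n ∧
      (L : Set (ProjSpace n K)) = ProjectiveSpectrum.zeroLocus (grading n K) W

/-- A rope supported on a line: a curve `C` whose support is a line `L` and whose ideal sheaf
contains the square of the ideal sheaf of (the reduced scheme) `L`. -/
structure IsRope {n : ℕ} {K : Type u} [Field K] (C : (ProjSpace n K).IdealSheafData) : Prop where
  isCurve : IsCurve C
  exists_line : ∃ L : Closeds (ProjSpace n K), IsLine L ∧ C.support = L ∧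
    Scheme.IdealSheafData.vanishingIdeal L ^ 2 ≤ C

/-- The standard affine chart `D₊(xᵢ)` of `ℙⁿ`. -/
def chart (n : ℕ) (K : Type u) [Field K] (i : Fin (n + 1)) : (ProjSpace n K).affineOpens :=
  ⟨Proj.basicOpen (grading n K) (MvPolynomial.X i),
    Proj.isAffineOpen_basicOpen (grading n K) (MvPolynomial.X i)
      (MvPolynomial.isHomogeneous_X K i) Nat.one_pos⟩

/-- The fraction `F / xᵢᵈ`, for a form `F` of degree `d`. -/
def formFraction {n : ℕ} {K : Type u} [Field K] (i : Fin (n + 1)) {d : ℕ} (F : grading n K d) :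
    HomogeneousLocalization.Away (grading n K) (MvPolynomial.X i) :=
  HomogeneousLocalization.Away.mk (grading n K) (d := 1) (MvPolynomial.isHomogeneous_X K i) d F.1
    (by rw [smul_eq_mul, mul_one]; exact F.2)

/-- The section of `𝒪` over `D₊(xᵢ)` given by the fraction `F / xᵢᵈ`, for a form `F` of
degree `d`. -/
def dehomogenize {n : ℕ} {K : Type u} [Field K] (i : Fin (n + 1)) {d : ℕ} (F : grading n K d) :
    Γ(ProjSpace n K, chart n K i) :=
  (Proj.awayToSection (grading n K) (MvPolynomial.X i)).hom (formFraction i F)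

theorem formFraction_val {n : ℕ} {K : Type u} [Field K] (i : Fin (n + 1)) {d : ℕ}
    (F : grading n K d) : (formFraction i F).val =
      Localization.mk F.1 ⟨MvPolynomial.X i ^ d, by use d⟩ :=
  rfl

theorem dehomogenize_add {n : ℕ} {K : Type u} [Field K] (i : Fin (n + 1)) {d : ℕ}
    (F G : grading n K d) : dehomogenize i (F + G) = dehomogenize i F + dehomogenize i G := by
  have h : formFraction i (F + G) = formFraction i F + formFraction i G := by
    apply HomogeneousLocalization.val_injective
    rw [HomogeneousLocalization.val_add, formFraction_val, formFraction_val, formFraction_val,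
      Localization.add_mk_self]
    rfl
  rw [dehomogenize, h, map_add]
  rfl

theorem dehomogenize_zero {n : ℕ} {K : Type u} [Field K] (i : Fin (n + 1)) {d : ℕ} :
    dehomogenize i (0 : grading n K d) = 0 := by
  simpa using dehomogenize_add i (0 : grading n K d) 0

theorem exists_dehomogenize_smul {n : ℕ} {K : Type u} [Field K] (i : Fin (n + 1)) {d : ℕ} (c : K)
    (F : grading n K d) : ∃ a : Γ(ProjSpace n K, chart n K i),
      dehomogenize i (c • F) = a * dehomogenize i F := by
  let c₀ : grading n K 0 := ⟨MvPolynomial.C c, MvPolynomial.isHomogeneous_C _ c⟩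
  have h : formFraction i (c • F) = formFraction i c₀ * formFraction i F := by
    apply HomogeneousLocalization.val_injective
    rw [HomogeneousLocalization.val_mul, formFraction_val, formFraction_val, formFraction_val,
      Localization.mk_mul]
    congr 1
    · simp [c₀, MvPolynomial.smul_eq_C_mul]
    · ext; simp
  refine ⟨dehomogenize i c₀, ?_⟩
  rw [dehomogenize, h, map_mul]
  rfl

/-- The degree `d` part of the (saturated) homogeneous ideal of the closed subscheme `C` of `ℙⁿ`:
the forms of degree `d` that vanish on `C`. -/
def idealPart {n : ℕ} {K : Type u} [Field K] (C : (ProjSpace n K).IdealSheafData) (d : ℕ) :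
    Submodule K (grading n K d) where
  carrier := {F | ∀ i, dehomogenize i F ∈ C.ideal (chart n K i)}
  zero_mem' i := by rw [dehomogenize_zero]; exact zero_mem _
  add_mem' hF hG i := by rw [dehomogenize_add]; exact add_mem (hF i) (hG i)
  smul_mem' c F hF i := by
    obtain ⟨a, ha⟩ := exists_dehomogenize_smul i c F
    rw [ha]
    exact Ideal.mul_mem_left _ a (hF i)

/-- The Hilbert function of a closed subscheme of `ℙⁿ`: the dimension of the degree `d` part of
its homogeneous coordinate ring. -/
def hilbertFunction {n : ℕ} {K : Type u} [Field K] (C : (ProjSpace n K).IdealSheafData)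
    (d : ℕ) : ℕ :=
  Module.finrank K (grading n K d ⧸ idealPart C d)

/-- A one-dimensional closed subscheme of `ℙⁿ` has degree `e` and arithmetic genus `g` if its
Hilbert polynomial is `e t + 1 - g`. -/
def HasDegreeAndGenus {n : ℕ} {K : Type u} [Field K] (C : (ProjSpace n K).IdealSheafData)
    (e g : ℤ) : Prop :=
  ∀ᶠ d : ℕ in Filter.atTop, (hilbertFunction C d : ℤ) = e * d + 1 - g

/-- A double line of genus `g` in `ℙⁿ`: a rope of degree `2` and arithmetic genus `g` supported
on a line. -/
structure IsDoubleLine {n : ℕ} {K : Type u} [Field K] (C : (ProjSpace n K).IdealSheafData)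
    (g : ℤ) : Prop where
  isRope : IsRope C
  degree_genus : HasDegreeAndGenus C 2 g

/-- The sections over `C ∩ U` of the normal sheaf `𝓗𝓸𝓶(𝓘/𝓘², 𝒪_C)` of `C`, for an affine
open subset `U` of `ℙⁿ`. (Linearity over `Γ(ℙⁿ, U)` is the same as linearity over
`Γ(C, C ∩ U) = Γ(ℙⁿ, U) ⧸ 𝓘(U)`.) -/
abbrev LocalNormalSections {n : ℕ} {K : Type u} [Field K] (C : (ProjSpace n K).IdealSheafData)
    (U : (ProjSpace n K).affineOpens) : Type u :=
  (C.ideal U).Cotangent →ₗ[Γ(ProjSpace n K, U)] (Γ(ProjSpace n K, U) ⧸ C.ideal U)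

/-- Restriction of sections of the ideal sheaf between affine opens. -/
def restrictIdeal {n : ℕ} {K : Type u} [Field K] (C : (ProjSpace n K).IdealSheafData)
    {U V : (ProjSpace n K).affineOpens} (h : U ≤ V) (s : C.ideal V) : C.ideal U :=
  ⟨((ProjSpace n K).presheaf.map (homOfLE (show U.1 ≤ V.1 from h)).op).hom s, C.ideal_le_comap_ideal h s.2⟩

/-- Restriction of sections of the structure sheaf of `C` between affine opens. -/
def restrictStructure {n : ℕ} {K : Type u} [Field K] (C : (ProjSpace n K).IdealSheafData)
    {U V : (ProjSpace n K).affineOpens} (h : U ≤ V) :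
    (Γ(ProjSpace n K, V) ⧸ C.ideal V) →+* (Γ(ProjSpace n K, U) ⧸ C.ideal U) :=
  Ideal.quotientMap (C.ideal U) ((ProjSpace n K).presheaf.map (homOfLE h).op).hom
    (C.ideal_le_comap_ideal h)

theorem restrictStructure_smul {n : ℕ} {K : Type u} [Field K]
    (C : (ProjSpace n K).IdealSheafData) {U V : (ProjSpace n K).affineOpens} (h : U ≤ V) (c : K)
    (a : Γ(ProjSpace n K, V) ⧸ C.ideal V) :
    restrictStructure C h (c • a) = c • restrictStructure C h a := by
  have key : ((ProjSpace n K).presheaf.map (homOfLE h).op).hom (scalars n K V c) =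
      scalars n K U c := by
    rw [scalars, scalars, ← RingHom.comp_apply, ← CommRingCat.hom_comp]
    simp only [Category.assoc, ← Functor.map_comp]
    rfl
  obtain ⟨a, rfl⟩ := Ideal.Quotient.mk_surjective a
  have h₁ : c • Ideal.Quotient.mk (C.ideal V) a =
      Ideal.Quotient.mk (C.ideal V) (scalars n K V c * a) := by
    rw [← Ideal.Quotient.mkₐ_eq_mk K, ← map_smul, Algebra.smul_def]
    rfl
  have h₂ (b : Γ(ProjSpace n K, U)) : c • Ideal.Quotient.mk (C.ideal U) b =
      Ideal.Quotient.mk (C.ideal U) (scalars n K U c * b) := by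
    rw [← Ideal.Quotient.mkₐ_eq_mk K, ← map_smul, Algebra.smul_def]
    rfl
  rw [h₁, restrictStructure, Ideal.quotientMap_mk, Ideal.quotientMap_mk, h₂, map_mul, key]

/-- The `K`-vector space `H⁰(C, 𝓝_C)` of global sections of the normal sheaf
`𝓝_C = 𝓗𝓸𝓶(𝓘/𝓘², 𝒪_C)`: the families of sections over all affine open subsets that are
compatible with restriction. -/
def normalSections {n : ℕ} {K : Type u} [Field K] (C : (ProjSpace n K).IdealSheafData) :
    Submodule K (∀ U : (ProjSpace n K).affineOpens, LocalNormalSections C U) where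
  carrier := {φ | ∀ (U V : (ProjSpace n K).affineOpens) (h : U ≤ V) (s : C.ideal V),
    φ U ((C.ideal U).toCotangent (restrictIdeal C h s)) =
      restrictStructure C h (φ V ((C.ideal V).toCotangent s))}
  zero_mem' U V h s := by simp
  add_mem' hφ hψ U V h s := by simp [hφ U V h s, hψ U V h s]
  smul_mem' c φ hφ U V h s := by simp [hφ U V h s, restrictStructure_smul]

/-- `h⁰(C, 𝓝_C)`. -/
def h0Normal {n : ℕ} {K : Type u} [Field K] (C : (ProjSpace n K).IdealSheafData) : ℕ :=
  Module.finrank K (normalSections C)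

end ProjCurve

end

/-! Complete the equations of `L` to a basis of linear forms. Two charts cover `L`; each has a
coordinate `u` on `L` and transverse coordinates `y_j`. There the ideal of `C` lies between `(y)²`
and `(y)`, so it is determined by its linear forms. Cohen–Macaulayness makes it saturated over
`K[u]`, and the Hilbert polynomial then identifies it with the kernel of `y_j ↦ f_j ε` into
`K[u][ε]`, where the vector `f` is unimodular and of degree exactly `-g = a + 1`
(`exists_unimodular`, `exists_chartIdeal_eq`). Thus `ε` changes by `u^a` from one chart to the
other, with `a = -1 - g`.

On a chart, every homomorphism from the ideal to the structure ring moves `y_j` by some `p_j` and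
`ε²` by some `q` (`IsNormalHom.exists_deform`). It vanishes exactly when it reparametrizes `ε` by
some `w`: `p_j = f_j w` and `q = -2εw` (`deform_eq_zero_iff`). Splitting everything into its `1`-
and `ε`-components gives an exact sequence `0 → W → E → 𝓝_C → 0` on `L = ℙ¹` with `W = 𝒪(-a) ⊕ 𝒪`
and `E = (𝒪(1) ⊕ 𝒪(a+1))^(n-1) ⊕ 𝒪(-2a) ⊕ 𝒪(-a)`. So `h⁰(𝓝_C) = h⁰(E) - h⁰(W) + dim ker(H¹(W) →
H¹(E))`. Here `H¹(W) = H¹(𝒪(-a))`. Its image in `H¹(𝒪(1))` is zero because that group is zero, and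
its image in `H¹(𝒪(-a))` is multiplication by `-2`. The kernel is therefore all of `H¹(𝒪(-a))`, of
dimension `a - 1` for `a ≥ 1`, in characteristic 2, and zero otherwise: this is the source of the
case distinction.

The computation is carried out with explicit Laurent polynomials
(`IsGlobalNormal.exists_isCompatible`, `finrank_of_range_eq_isGlobalNormal`). Since ideal
homomorphisms extend along flat restriction maps and glue (`exists_extends`,
`exists_normalSections`), the compatible families over all affine open subsets are the same as
compatible pairs on the two charts (`finrank_normalSections`). -/

namespace ProjCurve

/-! ### The normal module of a double structure on one chart -/

section LocalModel

variable {ι : Type*} {k : Type*} [CommRing k]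

/-- The homomorphism `k[y] → k[ε]`, `yⱼ ↦ fⱼ ε`, whose kernel is the ideal of the double
structure defined by the vector `f`. -/
noncomputable def theta (f : ι → k) : MvPolynomial ι k →ₐ[k] DualNumber k :=
  MvPolynomial.aeval fun j => TrivSqZeroExt.inr (f j)

/-- Restriction of a polynomial to the parametrized line `yⱼ = fⱼ z`. -/
noncomputable def ray (f : ι → k) : MvPolynomial ι k →ₐ[k] Polynomial k :=
  MvPolynomial.aeval fun j => Polynomial.C (f j) * Polynomial.X

@[simp] theorem theta_X (f : ι → k) (j : ι) :
    theta f (MvPolynomial.X j) = TrivSqZeroExt.inr (f j) := by simp [theta]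

theorem theta_C (f : ι → k) (a : k) :
    theta f (MvPolynomial.C a) = TrivSqZeroExt.inl a := by
  rw [MvPolynomial.algHom_C]; rfl

@[simp] theorem ray_X (f : ι → k) (j : ι) :
    ray f (MvPolynomial.X j) = Polynomial.C (f j) * Polynomial.X := by simp [ray]

theorem ray_C (f : ι → k) (a : k) :
    ray f (MvPolynomial.C a) = Polynomial.C a := by
  rw [MvPolynomial.algHom_C]; rfl

/-- Modulo `z²` the restriction to the ray is `theta`, with `z` in the role of `ε`. Hence the
restriction of an element of the ideal is divisible by `z²`. -/
theorem theta_fst_snd (f : ι → k) (F : MvPolynomial ι k) :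
    (theta f F).fst = (ray f F).coeff 0 ∧ (theta f F).snd = (ray f F).coeff 1 := by
  induction F using MvPolynomial.induction_on with
  | C a => rw [theta_C, ray_C]; simp
  | add p q hp hq => simp [hp, hq]
  | mul_X p j hp =>
    rw [map_mul, map_mul, ray_X, theta_X, ← mul_assoc]
    constructor
    · rw [Polynomial.coeff_mul_X_zero, TrivSqZeroExt.fst_mul, TrivSqZeroExt.fst_inr, mul_zero]
    · rw [show (1 : ℕ) = 0 + 1 from rfl, Polynomial.coeff_mul_X, Polynomial.coeff_mul_C,
        DualNumber.snd_mul, hp.1]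
      simp

/-- The coefficients of `z ^ 2` and `z ^ 3` of the restriction to the line `yⱼ = fⱼ z`. -/
noncomputable def quad (f : ι → k) (F : MvPolynomial ι k) : DualNumber k :=
  TrivSqZeroExt.inl ((ray f F).coeff 2) + TrivSqZeroExt.inr ((ray f F).coeff 3)

theorem quad_add (f : ι → k) (F G : MvPolynomial ι k) : quad f (F + G) = quad f F + quad f G := by
  ext <;> simp [quad]

/-- On the ideal, `quad` is division of the restriction to the ray by `z²`, taken modulo `z²`. This
makes it linear over `k[ε]`. -/
theorem quad_mul (f : ι → k) (F G : MvPolynomial ι k) (hG : theta f G = 0) :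
    quad f (F * G) = theta f F * quad f G := by
  have h0 : (ray f G).coeff 0 = 0 := by rw [← (theta_fst_snd f G).1, hG]; rfl
  have h1 : (ray f G).coeff 1 = 0 := by rw [← (theta_fst_snd f G).2, hG]; rfl
  ext
  · simp [quad, theta_fst_snd, Polynomial.coeff_mul, Finset.Nat.antidiagonal_succ, h0, h1]
  · simp [quad, theta_fst_snd, Polynomial.coeff_mul, Finset.Nat.antidiagonal_succ, h0, h1]

/-- Homomorphisms from the ideal of a double structure to its structure ring. -/
structure IsNormalHom (f : ι → k) (φ : RingHom.ker (theta f) → DualNumber k) : Prop where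
  add : ∀ s t, φ (s + t) = φ s + φ t
  smul : ∀ (a : MvPolynomial ι k) (s), φ (a • s) = theta f a * φ s

theorem IsNormalHom.zero {f : ι → k} {φ : RingHom.ker (theta f) → DualNumber k}
    (h : IsNormalHom f φ) : φ 0 = 0 := by
  simpa using h.add 0 0

theorem IsNormalHom.sub {f : ι → k} {φ ψ : RingHom.ker (theta f) → DualNumber k}
    (h : IsNormalHom f φ) (h' : IsNormalHom f ψ) : IsNormalHom f (φ - ψ) where
  add s t := by simp only [Pi.sub_apply, h.add, h'.add]; ring
  smul a s := by simp only [Pi.sub_apply, h.smul, h'.smul]; ring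

variable [Fintype ι]

/-- The first order deformation of a double structure obtained by moving `yⱼ` by `pⱼ` and
`ε ^ 2` by `q`. -/
noncomputable def deform (f : ι → k) (p : ι → DualNumber k) (q : DualNumber k) :
    RingHom.ker (theta f) → DualNumber k :=
  fun F => ∑ j, theta f (MvPolynomial.pderiv j F.1) * p j + q * quad f F.1

theorem isNormalHom_deform (f : ι → k) (p : ι → DualNumber k) (q : DualNumber k) :
    IsNormalHom f (deform f p q) where
  add s t := by
    simp only [deform, Submodule.coe_add, map_add, add_mul, Finset.sum_add_distrib, quad_add]
    ring
  smul a s := by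
    have hs : theta f s.1 = 0 := s.2
    simp only [deform, SetLike.val_smul, smul_eq_mul, Derivation.leibniz, map_add, map_mul, hs,
      zero_mul, add_zero, quad_mul f a _ hs, Finset.mul_sum, mul_add]
    congr 1
    · exact Finset.sum_congr rfl fun j _ => by ring
    · ring

/-- Unimodularity of `f` provides a linear form that lifts `ε`; it serves to write down generators
of the ideal. -/
theorem sum_theta_C (f h : ι → k) (hf : ∑ j, h j * f j = 1) :
    theta f (∑ j, MvPolynomial.C (h j) * MvPolynomial.X j) = TrivSqZeroExt.inr 1 := by
  rw [map_sum, ← hf, ← TrivSqZeroExt.inrHom_apply k k (∑ j, _), map_sum]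
  refine Finset.sum_congr rfl fun j _ => ?_
  rw [map_mul, theta_C, theta_X, TrivSqZeroExt.inl_mul_inr]
  rfl

/-- The linear generators of the ideal of the double structure. -/
noncomputable def linGen (f h : ι → k) (j : ι) : MvPolynomial ι k :=
  MvPolynomial.X j - MvPolynomial.C (f j) * ∑ i, MvPolynomial.C (h i) * MvPolynomial.X i

/-- The quadratic generator of the ideal of the double structure. -/
noncomputable def sqGen (h : ι → k) : MvPolynomial ι k :=
  (∑ i, MvPolynomial.C (h i) * MvPolynomial.X i) ^ 2

theorem theta_linGen (f h : ι → k) (hf : ∑ j, h j * f j = 1) (j : ι) :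
    theta f (linGen f h j) = 0 := by
  rw [linGen, map_sub, map_mul, sum_theta_C f h hf, theta_C]
  ext <;> simp

theorem theta_sqGen (f h : ι → k) (hf : ∑ j, h j * f j = 1) : theta f (sqGen h) = 0 := by
  rw [sqGen, map_pow, sum_theta_C f h hf, pow_two, TrivSqZeroExt.inr_mul_inr]

theorem ker_theta (f h : ι → k) (hf : ∑ j, h j * f j = 1) :
    RingHom.ker (theta f) = Ideal.span (Set.range (linGen f h) ∪ {sqGen h}) := by
  set g := Ideal.span (Set.range (linGen f h) ∪ {sqGen h}) with hg
  apply le_antisymm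
  -- Modulo the proposed generators, `w` squares to zero and `y_j = f_j w`. The quotient map
  -- therefore factors through `theta f`, and it kills the kernel.
  · let w : MvPolynomial ι k ⧸ g :=
      Ideal.Quotient.mk g (∑ i, MvPolynomial.C (h i) * MvPolynomial.X i)
    have hw : w * w = 0 := by
      rw [← map_mul, Ideal.Quotient.eq_zero_iff_mem, ← pow_two]
      exact Ideal.subset_span (Or.inr rfl)
    let e : DualNumber k →ₐ[k] MvPolynomial ι k ⧸ g :=
      DualNumber.lift ⟨(Algebra.ofId _ _, w), hw, fun r => mul_comm _ _⟩
    have key : e.comp (theta f) = Ideal.Quotient.mkₐ k g := by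
      apply MvPolynomial.algHom_ext
      intro j
      have h1 : (Ideal.Quotient.mk g) (MvPolynomial.X j) =
          Ideal.Quotient.mk g (MvPolynomial.C (f j)) * w := by
        rw [← map_mul, Ideal.Quotient.eq]
        exact Ideal.subset_span (Or.inl ⟨j, rfl⟩)
      rw [AlgHom.comp_apply, theta_X, Ideal.Quotient.mkₐ_eq_mk, h1, DualNumber.inr_eq_smul_eps,
        DualNumber.lift_smul, DualNumber.lift_apply_eps]
      rfl
    intro F hF
    have := congrArg (· F) key
    simp only [AlgHom.comp_apply] at this
    rw [show theta f F = 0 from hF, map_zero] at this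
    exact Ideal.Quotient.eq_zero_iff_mem.1 this.symm
  · rw [hg, Ideal.span_le]
    rintro _ (⟨j, rfl⟩ | rfl)
    · exact theta_linGen f h hf j
    · exact theta_sqGen f h hf

/-- A normal homomorphism is determined by its values on the generators. -/
theorem IsNormalHom.eq_zero {f h : ι → k} (hf : ∑ j, h j * f j = 1)
    {φ : RingHom.ker (theta f) → DualNumber k} (hφ : IsNormalHom f φ)
    (h1 : ∀ j, φ ⟨linGen f h j, theta_linGen f h hf j⟩ = 0)
    (h2 : φ ⟨sqGen h, theta_sqGen f h hf⟩ = 0) : φ = 0 := by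
  have key : ∀ F (hF : F ∈ Ideal.span (Set.range (linGen f h) ∪ {sqGen h})),
      φ ⟨F, (ker_theta f h hf).symm ▸ hF⟩ = 0 := by
    intro F hF
    induction hF using Submodule.span_induction with
    | mem x hx =>
      rcases hx with ⟨j, rfl⟩ | rfl
      · exact h1 j
      · exact h2
    | zero => exact hφ.zero
    | add x y hx hy ihx ihy =>
      have := hφ.add ⟨x, (ker_theta f h hf).symm ▸ hx⟩ ⟨y, (ker_theta f h hf).symm ▸ hy⟩
      rw [ihx, ihy, add_zero] at this
      exact this
    | smul a x hx ih =>
      have := hφ.smul a ⟨x, (ker_theta f h hf).symm ▸ hx⟩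
      rw [ih, mul_zero] at this
      exact this
  funext F
  exact key F.1 ((ker_theta f h hf) ▸ F.2)

theorem deform_linGen (f h : ι → k) (hf : ∑ j, h j * f j = 1) (p : ι → DualNumber k)
    (q : DualNumber k) (j : ι) :
    deform f p q ⟨linGen f h j, theta_linGen f h hf j⟩ =
      p j - TrivSqZeroExt.inl (f j) * ∑ i, TrivSqZeroExt.inl (h i) * p i := by
  classical
  have hq : quad f (linGen f h j) = 0 := by
    ext <;> simp [quad, linGen, Polynomial.coeff_C_mul]
  simp only [deform, hq, mul_zero, add_zero]
  simp only [linGen, map_sub, MvPolynomial.pderiv_C_mul, map_sum,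
    MvPolynomial.pderiv_X, Finset.mul_sum, sub_mul, Finset.sum_sub_distrib]
  congr 1
  · simp [Pi.single_apply, apply_ite]
  · refine Finset.sum_congr rfl fun i _ => ?_
    simp [Pi.single_apply, apply_ite, mul_assoc, TrivSqZeroExt.algebraMap_eq_inl]

theorem deform_sqGen (f h : ι → k) (hf : ∑ j, h j * f j = 1) (p : ι → DualNumber k)
    (q : DualNumber k) :
    deform f p q ⟨sqGen h, theta_sqGen f h hf⟩ =
      2 * TrivSqZeroExt.inr 1 * (∑ i, TrivSqZeroExt.inl (h i) * p i) + q := by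
  classical
  have hr : ray f (∑ i, MvPolynomial.C (h i) * MvPolynomial.X i) = Polynomial.X := by
    simp only [map_sum, map_mul, ray_X, ray_C, ← mul_assoc, ← Finset.sum_mul]
    simp only [← Polynomial.C_mul]
    rw [← map_sum, hf, map_one, one_mul]
  have hq : quad f (sqGen h) = 1 := by
    ext <;> simp [quad, sqGen, hr, Polynomial.coeff_X_pow]
  have hd (i : ι) : MvPolynomial.pderiv i (∑ i, MvPolynomial.C (h i) * MvPolynomial.X i) =
      MvPolynomial.C (h i) := by
    simp [MvPolynomial.pderiv_X, Pi.single_apply, apply_ite]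
  simp only [deform, hq, mul_one]
  simp only [sqGen, Derivation.leibniz_pow, hd, Finset.mul_sum]
  congr 1
  refine Finset.sum_congr rfl fun i _ => ?_
  simp only [Nat.add_one_sub_one, pow_one, nsmul_eq_mul, smul_eq_mul, map_mul, theta_C,
    sum_theta_C f h hf, Nat.cast_ofNat, map_ofNat]
  ring

/-- Every normal homomorphism comes from a deformation. -/
theorem IsNormalHom.exists_deform {f h : ι → k} (hf : ∑ j, h j * f j = 1)
    {φ : RingHom.ker (theta f) → DualNumber k} (hφ : IsNormalHom f φ) :
    ∃ p q, φ = deform f p q := by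
  let m (j : ι) : RingHom.ker (theta f) := ⟨linGen f h j, theta_linGen f h hf j⟩
  refine ⟨fun j => φ (m j), φ ⟨sqGen h, theta_sqGen f h hf⟩, ?_⟩
  -- The generators satisfy `∑ h_i linGen_i = 0`. With this relation the correction terms in
  -- `deform_linGen` and `deform_sqGen` vanish, so the values of `φ` on the generators can serve as
  -- `p` and `q`.
  have hsum : ∑ i, TrivSqZeroExt.inl (h i) * φ (m i) = 0 := by
    have h1 : ∀ i, TrivSqZeroExt.inl (h i) * φ (m i) = φ ((MvPolynomial.C (h i) : MvPolynomial ι k) • m i) := by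
      intro i; rw [hφ.smul, theta_C]
    let Φ : RingHom.ker (theta f) →+ DualNumber k := ⟨⟨φ, hφ.zero⟩, hφ.add⟩
    have h2 : ∑ i, (MvPolynomial.C (h i) : MvPolynomial ι k) • m i = 0 := by
      apply Subtype.ext
      simp only [AddSubmonoidClass.coe_finsetSum, SetLike.val_smul, smul_eq_mul, m, linGen,
        mul_sub, Finset.sum_sub_distrib, ← mul_assoc, ← Finset.sum_mul, ← map_mul, ← map_sum, hf]
      simp
    simp_rw [h1]
    change ∑ i, Φ _ = 0
    rw [← map_sum, h2, map_zero]
  rw [← sub_eq_zero]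
  refine (hφ.sub (isNormalHom_deform _ _ _)).eq_zero hf (fun j => ?_) ?_
  · rw [Pi.sub_apply, deform_linGen f h hf, hsum, mul_zero, sub_zero, sub_self]
  · rw [Pi.sub_apply, deform_sqGen f h hf, hsum, mul_zero, zero_add, sub_self]

/-- Trivial deformations are those that reparametrize `ε`. -/
theorem deform_eq_zero_iff {f h : ι → k} (hf : ∑ j, h j * f j = 1) (p : ι → DualNumber k)
    (q : DualNumber k) : deform f p q = 0 ↔
      ∃ w : DualNumber k, (∀ j, p j = TrivSqZeroExt.inl (f j) * w) ∧
        q = - (2 * TrivSqZeroExt.inr 1 * w) := by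
  constructor
  · intro H
    refine ⟨∑ i, TrivSqZeroExt.inl (h i) * p i, fun j => ?_, ?_⟩
    · rw [← sub_eq_zero, ← deform_linGen f h hf p q, H]; rfl
    · rw [eq_neg_iff_add_eq_zero, add_comm, ← deform_sqGen f h hf p q, H]; rfl
  · rintro ⟨w, hp, rfl⟩
    have hs : ∑ i, TrivSqZeroExt.inl (h i) * p i = w := by
      simp only [hp, ← mul_assoc, ← Finset.sum_mul, ← map_mul, ← map_sum, hf, map_one, one_mul,
        ← TrivSqZeroExt.algebraMap_eq_inl k k]
    refine (isNormalHom_deform _ _ _).eq_zero hf (fun j => ?_) ?_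
    · rw [deform_linGen f h hf, hs, hp, sub_self]
    · rw [deform_sqGen f h hf, hs, add_neg_cancel]

end LocalModel

end ProjCurve

/-! ### Change of chart: scaling `y` by `s` and `ε` by `t` -/

namespace ProjCurve

section BaseChange

variable {ι k k' : Type*} [CommRing k] [CommRing k']

/-- The homomorphism `k[ε] → k'[ε]` that extends `g` and maps `ε` to `t ε`. -/
def dualMap (g : k →+* k') (t : k') : DualNumber k →+* DualNumber k' where
  toFun x := TrivSqZeroExt.inl (g x.fst) + TrivSqZeroExt.inr (t * g x.snd)
  map_one' := by ext <;> simp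
  map_zero' := by ext <;> simp
  map_add' x y := by ext <;> simp [mul_add]
  map_mul' x y := by
    ext
    · simp
    · simp
      ring

@[simp] theorem fst_dualMap (g : k →+* k') (t : k') (x : DualNumber k) :
    (dualMap g t x).fst = g x.fst := by simp [dualMap]

@[simp] theorem snd_dualMap (g : k →+* k') (t : k') (x : DualNumber k) :
    (dualMap g t x).snd = t * g x.snd := by simp [dualMap]

theorem dualMap_inl (g : k →+* k') (t : k') (a : k) :
    dualMap g t (TrivSqZeroExt.inl a) = TrivSqZeroExt.inl (g a) := by
  ext <;> simp

theorem dualMap_injective {g : k →+* k'} (hg : Function.Injective g) {t : k'} (ht : IsUnit t) :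
    Function.Injective (dualMap g t) := by
  intro x y h
  ext
  · exact hg (by simpa using congrArg TrivSqZeroExt.fst h)
  · exact hg (ht.mul_left_cancel (by simpa using congrArg TrivSqZeroExt.snd h))

/-- The homomorphism `k[y] → k'[y]` that extends `g` and maps `yⱼ` to `s yⱼ`. -/
noncomputable def coordMap (g : k →+* k') (s : k') : MvPolynomial ι k →+* MvPolynomial ι k' :=
  MvPolynomial.eval₂Hom (MvPolynomial.C.comp g) fun j => MvPolynomial.C s * MvPolynomial.X j

@[simp] theorem coordMap_X (g : k →+* k') (s : k') (j : ι) :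
    coordMap g s (MvPolynomial.X j) = MvPolynomial.C s * MvPolynomial.X j := by simp [coordMap]

@[simp] theorem coordMap_C (g : k →+* k') (s : k') (a : k) :
    coordMap g s (MvPolynomial.C a : MvPolynomial ι k) = MvPolynomial.C (g a) := by
  simp [coordMap]

variable {g : k →+* k'} {s t : k'} {f : ι → k} {f' : ι → k'}

/-- The hypothesis `t g(f_j) = s f'_j` is the compatibility of `y_j ↦ s y_j` and `ε ↦ t ε` with `y_j
↦ f_j ε`. -/
theorem theta_coordMap (hff : ∀ j, t * g (f j) = s * f' j) (F : MvPolynomial ι k) :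
    theta f' (coordMap g s F) = dualMap g t (theta f F) := by
  suffices h : (theta f').toRingHom.comp (coordMap g s) =
      (dualMap g t).comp (theta f).toRingHom from congrArg (· F) h
  apply MvPolynomial.ringHom_ext
  · intro a
    simp only [RingHom.comp_apply, coordMap_C, AlgHom.toRingHom_eq_coe, RingHom.coe_coe, theta_C,
      dualMap_inl]
  · intro j
    simp only [RingHom.comp_apply, coordMap_X, AlgHom.toRingHom_eq_coe, RingHom.coe_coe, map_mul,
      theta_C, theta_X]
    ext
    · simp
    · simp [hff, mul_comm]

theorem coeff_ray_coordMap (hff : ∀ j, t * g (f j) = s * f' j) (F : MvPolynomial ι k) (i : ℕ) :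
    (ray f' (coordMap g s F)).coeff i = t ^ i * g ((ray f F).coeff i) := by
  have h : (ray f').toRingHom.comp (coordMap g s) =
      (Polynomial.eval₂RingHom (Polynomial.C.comp g) (Polynomial.C t * Polynomial.X)).comp
        (ray f).toRingHom := by
    apply MvPolynomial.ringHom_ext
    · intro a
      simp only [RingHom.comp_apply, coordMap_C, AlgHom.toRingHom_eq_coe, RingHom.coe_coe, ray_C]
      simp
    · intro j
      simp only [RingHom.comp_apply, coordMap_X, AlgHom.toRingHom_eq_coe, RingHom.coe_coe, map_mul,
        ray_C, ray_X]
      simp only [Polynomial.coe_eval₂RingHom, Polynomial.eval₂_C, Polynomial.eval₂_X,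
        RingHom.comp_apply]
      rw [← mul_assoc, ← mul_assoc, ← Polynomial.C_mul, ← Polynomial.C_mul, ← hff, mul_comm t]
  have h' : ray f' (coordMap g s F) =
      ((ray f F).map g).comp (Polynomial.C t * Polynomial.X) := by
    rw [Polynomial.comp, Polynomial.eval₂_map]
    exact congrArg (· F) h
  rw [h', Polynomial.comp_C_mul_X_coeff, Polynomial.coeff_map, mul_comm]

/-- The ray parameter `z` scales by `t`, as `ε` does, and `quad` divides by `z²`; hence the factor
`t²`. -/
theorem quad_coordMap (hff : ∀ j, t * g (f j) = s * f' j) (F : MvPolynomial ι k) :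
    quad f' (coordMap g s F) = TrivSqZeroExt.inl (t ^ 2) * dualMap g t (quad f F) := by
  ext
  · simp [quad, coeff_ray_coordMap hff]
  · simp [quad, coeff_ray_coordMap hff]
    ring

theorem pderiv_coordMap (F : MvPolynomial ι k) (j : ι) :
    MvPolynomial.pderiv j (coordMap g s F) =
      MvPolynomial.C s * coordMap g s (MvPolynomial.pderiv j F) := by
  classical
  induction F using MvPolynomial.induction_on with
  | C a => simp
  | add p q hp hq => simp [hp, hq, mul_add]
  | mul_X p i hp =>
    simp only [map_mul, Derivation.leibniz, hp, coordMap_X, MvPolynomial.pderiv_X, map_add, smul_eq_mul]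
    by_cases h : i = j
    · subst h
      simp
      ring
    · simp [Pi.single_eq_of_ne h]
      ring

theorem coordMap_mem_ker (hff : ∀ j, t * g (f j) = s * f' j) (F : RingHom.ker (theta f)) :
    coordMap g s F.1 ∈ RingHom.ker (theta f') := by
  have h : theta f F.1 = 0 := F.2
  rw [RingHom.mem_ker, theta_coordMap hff, h, map_zero]

variable [Fintype ι]

/-- The displacement of `y_j` is measured in units of `y_j` and that of `ε²` in units of `ε²`, which
explains the factors `s⁻¹` and `t⁻²`. These are the transition functions of the bundles in which `p`
and `q` live. -/
theorem deform_coordMap (hff : ∀ j, t * g (f j) = s * f' j) {s' t' : k'} (hs : s * s' = 1)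
    (ht : t * t' = 1) (p : ι → DualNumber k) (q : DualNumber k) (F : RingHom.ker (theta f)) :
    deform f' (fun j => TrivSqZeroExt.inl s' * dualMap g t (p j))
      (TrivSqZeroExt.inl (t' ^ 2) * dualMap g t q) ⟨coordMap g s F.1, coordMap_mem_ker hff F⟩ =
      dualMap g t (deform f p q F) := by
  simp only [deform, pderiv_coordMap, quad_coordMap hff, map_add, map_sum, map_mul, theta_C,
    theta_coordMap hff]
  congr 1
  · refine Finset.sum_congr rfl fun j _ => ?_
    have : (TrivSqZeroExt.inl s : DualNumber k') * TrivSqZeroExt.inl s' = 1 := by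
      rw [← TrivSqZeroExt.inl_mul, hs]; rfl
    linear_combination
      (dualMap g t (theta f (MvPolynomial.pderiv j F.1)) * dualMap g t (p j)) * this
  · have : (TrivSqZeroExt.inl (t ^ 2) : DualNumber k') * TrivSqZeroExt.inl (t' ^ 2) = 1 := by
      rw [← TrivSqZeroExt.inl_mul, ← mul_pow, ht, one_pow]; rfl
    linear_combination (dualMap g t q * dualMap g t (quad f F.1)) * this

/-- A normal homomorphism is determined by its values on the ideal before the base change. -/
theorem IsNormalHom.eq_zero_of_coordMap {h : ι → k} (hf : ∑ j, h j * f j = 1)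
    (hff : ∀ j, t * g (f j) = s * f' j) (hs : IsUnit s) (ht : IsUnit t)
    {φ : RingHom.ker (theta f') → DualNumber k'} (hφ : IsNormalHom f' φ)
    (h0 : ∀ F : RingHom.ker (theta f), φ ⟨coordMap g s F.1, coordMap_mem_ker hff F⟩ = 0) :
    φ = 0 := by
  obtain ⟨s', hs⟩ := hs.exists_right_inv
  obtain ⟨t', ht⟩ := ht.exists_right_inv
  -- For the coefficients `g(h_j) s t⁻¹`, the generators of the new ideal are the images of the old
  -- ones up to the units `s⁻¹` and `t⁻²`.
  have hf' : ∑ j, (g (h j) * s * t') * f' j = 1 := by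
    have : ∀ j, (g (h j) * s * t') * f' j = g (h j * f j) := by
      intro j
      rw [map_mul]
      linear_combination (- g (h j) * t') * hff j + g (h j) * g (f j) * ht
    simp_rw [this]
    rw [← map_sum, hf, map_one]
  have hw : ∑ i, MvPolynomial.C (g (h i) * s * t') * MvPolynomial.X i =
      MvPolynomial.C t' * coordMap g s (∑ i, MvPolynomial.C (h i) * MvPolynomial.X i) := by
    simp only [map_sum, map_mul, coordMap_C, coordMap_X, Finset.mul_sum]
    exact Finset.sum_congr rfl fun i _ => by ring
  have hCt : (MvPolynomial.C t : MvPolynomial ι k') * MvPolynomial.C t' = 1 := by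
    rw [← map_mul, ht, map_one]
  have hCs : (MvPolynomial.C s : MvPolynomial ι k') * MvPolynomial.C s' = 1 := by
    rw [← map_mul, hs, map_one]
  refine hφ.eq_zero hf' (fun j => ?_) ?_
  · have : (⟨linGen f' _ j, theta_linGen f' _ hf' j⟩ : RingHom.ker (theta f')) =
        (MvPolynomial.C s' : MvPolynomial ι k') •
          ⟨coordMap g s (linGen f h j), coordMap_mem_ker hff ⟨_, theta_linGen f h hf j⟩⟩ := by
      apply Subtype.ext
      have hj : (MvPolynomial.C t : MvPolynomial ι k') * MvPolynomial.C (g (f j)) =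
        MvPolynomial.C s * MvPolynomial.C (f' j) := by rw [← map_mul, hff, map_mul]
      simp only [linGen]
      rw [hw]
      simp only [SetLike.val_smul, smul_eq_mul, map_sub, map_mul, coordMap_X,
        coordMap_C]
      generalize coordMap g s (∑ i, MvPolynomial.C (h i) * MvPolynomial.X i) = w
      linear_combination (- MvPolynomial.X j + MvPolynomial.C t' * MvPolynomial.C (f' j) * w) * hCs
        + (MvPolynomial.C s' * MvPolynomial.C t' * w) * hj
        - (MvPolynomial.C s' * MvPolynomial.C (g (f j)) * w) * hCt
    rw [this, hφ.smul, h0 ⟨_, theta_linGen f h hf j⟩, mul_zero]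
  · have : (⟨sqGen _, theta_sqGen f' _ hf'⟩ : RingHom.ker (theta f')) =
        (MvPolynomial.C t' ^ 2 : MvPolynomial ι k') •
          ⟨coordMap g s (sqGen h), coordMap_mem_ker hff ⟨_, theta_sqGen f h hf⟩⟩ := by
      apply Subtype.ext
      simp only [sqGen, hw, SetLike.val_smul, smul_eq_mul, map_pow]
      ring
    rw [this, hφ.smul, h0 ⟨_, theta_sqGen f h hf⟩, mul_zero]

theorem IsNormalHom.eq_deform_of_coordMap {h : ι → k} (hf : ∑ j, h j * f j = 1)
    (hff : ∀ j, t * g (f j) = s * f' j) {s' t' : k'} (hs : s * s' = 1) (ht : t * t' = 1)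
    {φ : RingHom.ker (theta f') → DualNumber k'} (hφ : IsNormalHom f' φ)
    {p : ι → DualNumber k} {q : DualNumber k}
    (h0 : ∀ F : RingHom.ker (theta f), φ ⟨coordMap g s F.1, coordMap_mem_ker hff F⟩ =
      dualMap g t (deform f p q F)) :
    φ = deform f' (fun j => TrivSqZeroExt.inl s' * dualMap g t (p j))
      (TrivSqZeroExt.inl (t' ^ 2) * dualMap g t q) := by
  rw [← sub_eq_zero]
  refine (hφ.sub (isNormalHom_deform _ _ _)).eq_zero_of_coordMap hf hff
    (IsUnit.of_mul_eq_one _ hs) (IsUnit.of_mul_eq_one _ ht) fun F => ?_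
  rw [Pi.sub_apply, h0, deform_coordMap hff hs ht, sub_self]

end BaseChange

end ProjCurve

/-! ### Cohomology of line bundles on `ℙ¹` by Laurent polynomials -/

namespace ProjCurve

section Laurent

open LaurentPolynomial

variable {K : Type*} [Field K]

/-- The inclusion `K[u] → K[u, u⁻¹]`. -/
noncomputable abbrev iotaZero (K : Type*) [Field K] : Polynomial K →+* LaurentPolynomial K :=
  Polynomial.toLaurent

/-- The homomorphism `K[v] → K[u, u⁻¹]` that maps `v` to `u⁻¹`. -/
noncomputable def iotaOne (K : Type*) [Field K] : Polynomial K →+* LaurentPolynomial K :=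
  (invert (R := K)).toRingEquiv.toRingHom.comp Polynomial.toLaurent

@[simp] theorem iotaOne_X : iotaOne K Polynomial.X = T (-1) := by
  simp [iotaOne]

@[simp] theorem iotaOne_C (a : K) : iotaOne K (Polynomial.C a) = C a := by
  simp [iotaOne]

theorem iotaZero_monomial (n : ℕ) (a : K) :
    iotaZero K (Polynomial.monomial n a) = C a * T n := by
  rw [← Polynomial.C_mul_X_pow_eq_monomial, Polynomial.toLaurent_C_mul_X_pow]

theorem iotaOne_monomial (n : ℕ) (a : K) :
    iotaOne K (Polynomial.monomial n a) = C a * T (-n) := by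
  rw [← Polynomial.C_mul_X_pow_eq_monomial]
  simp [T_pow]

theorem coeff_T_mul (m n : ℤ) (x : LaurentPolynomial K) :
    (T m * x).coeff n = x.coeff (n - m) := by
  induction x using LaurentPolynomial.induction_on' with
  | add p q hp hq => rw [mul_add, AddMonoidAlgebra.coeff_add, Finsupp.add_apply, hp, hq]; rfl
  | C_mul_T k a =>
    rw [T_mul, mul_assoc, ← T_add, ← single_eq_C_mul_T, ← single_eq_C_mul_T]
    simp only [AddMonoidAlgebra.coeff_single, Finsupp.single_apply]
    congr 1
    apply propext
    omega

theorem coeff_iotaZero (A : Polynomial K) (n : ℤ) :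
    (iotaZero K A).coeff n = if 0 ≤ n then A.coeff n.toNat else 0 := by
  induction A using Polynomial.induction_on' with
  | add p q hp hq => simp only [map_add, AddMonoidAlgebra.coeff_add, Finsupp.add_apply, hp, hq,
      Polynomial.coeff_add]; split_ifs <;> simp
  | monomial k a =>
    rw [iotaZero_monomial, ← single_eq_C_mul_T]
    simp only [AddMonoidAlgebra.coeff_single, Finsupp.single_apply, Polynomial.coeff_monomial]
    split_ifs <;> first | rfl | omega

theorem coeff_iotaOne (A : Polynomial K) (n : ℤ) :
    (iotaOne K A).coeff n = if n ≤ 0 then A.coeff (-n).toNat else 0 := by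
  have : (iotaOne K A).coeff n = (iotaZero K A).coeff (-n) := invert_apply _ _
  rw [this, coeff_iotaZero]
  congr 1
  apply propext
  omega

theorem iotaZero_injective : Function.Injective (iotaZero K) := Polynomial.toLaurent_injective

theorem iotaOne_injective : Function.Injective (iotaOne K) :=
  (invert (R := K)).injective.comp Polynomial.toLaurent_injective

/-- The polynomial with the given coefficients. -/
noncomputable def ofCoeffs (N : ℕ) : (Fin (N + 1) → K) →ₗ[K] Polynomial K :=
  ∑ i : Fin (N + 1), (Polynomial.monomial (i : ℕ)) ∘ₗ LinearMap.proj i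

/-- The polynomial of degree at most `N` with the given coefficients, in reverse order. -/
noncomputable def ofCoeffsRev (N : ℕ) : (Fin (N + 1) → K) →ₗ[K] Polynomial K :=
  ∑ i : Fin (N + 1), (Polynomial.monomial (N - i : ℕ)) ∘ₗ LinearMap.proj i

theorem ofCoeffs_apply (N : ℕ) (c : Fin (N + 1) → K) :
    ofCoeffs N c = ∑ i : Fin (N + 1), Polynomial.monomial (i : ℕ) (c i) := by simp [ofCoeffs]

theorem ofCoeffsRev_apply (N : ℕ) (c : Fin (N + 1) → K) :
    ofCoeffsRev N c = ∑ i : Fin (N + 1), Polynomial.monomial (N - i : ℕ) (c i) := by simp [ofCoeffsRev]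

theorem coeff_ofCoeffs (N : ℕ) (c : Fin (N + 1) → K) (i : Fin (N + 1)) :
    (ofCoeffs N c).coeff i = c i := by
  rw [ofCoeffs_apply, Polynomial.finsetSum_coeff, Finset.sum_eq_single i]
  · simp
  · intro j _ hj
    rw [Polynomial.coeff_monomial, if_neg]
    exact fun h => hj (Fin.ext h)
  · simp

theorem ofCoeffs_injective (N : ℕ) : Function.Injective (ofCoeffs (K := K) N) := by
  intro c c' h
  funext i
  rw [← coeff_ofCoeffs N c, h, coeff_ofCoeffs]

theorem iotaZero_ofCoeffs (N : ℕ) (c : Fin (N + 1) → K) :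
    iotaZero K (ofCoeffs N c) = T N * iotaOne K (ofCoeffsRev N c) := by
  simp only [ofCoeffs_apply, ofCoeffsRev_apply, map_sum, Finset.mul_sum]
  refine Finset.sum_congr rfl fun i _ => ?_
  rw [iotaZero_monomial, iotaOne_monomial, T_mul, mul_assoc, ← T_add]
  congr 2
  have := i.2
  omega

/-- Pairs `(A, B)` with `A = u^N B(u⁻¹)` are the global sections of `𝒪(N)`: comparing exponents
bounds the degree of `A` by `N`, and `B` is then its reversal. -/
theorem exists_ofCoeffs (N : ℕ) {A B : Polynomial K}
    (h : iotaZero K A = T N * iotaOne K B) : ∃ c, A = ofCoeffs N c ∧ B = ofCoeffsRev N c := by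
  have hA : A = ofCoeffs N fun i : Fin (N + 1) => A.coeff i := by
    ext n
    by_cases hn : n ≤ N
    · exact (coeff_ofCoeffs N (fun i : Fin (N + 1) => A.coeff i) ⟨n, by omega⟩).symm
    · have h1 := congrArg (fun x : LaurentPolynomial K => x.coeff (n : ℤ)) h
      simp only [coeff_T_mul, coeff_iotaZero, coeff_iotaOne] at h1
      rw [if_pos (by omega), if_neg (by omega)] at h1
      rw [show A.coeff n = 0 from h1, ofCoeffs_apply, Polynomial.finsetSum_coeff]
      symm
      refine Finset.sum_eq_zero fun i _ => ?_
      rw [Polynomial.coeff_monomial, if_neg]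
      have := i.2
      omega
  refine ⟨fun i : Fin (N + 1) => A.coeff i, hA, ?_⟩
  have h2 := iotaZero_ofCoeffs N fun i : Fin (N + 1) => A.coeff i
  rw [← hA, h] at h2
  exact iotaOne_injective ((isUnit_T (R := K) N).mul_left_cancel h2)

/-- A line bundle of negative degree has no sections: the exponents on the left are at least `0`,
those on the right at most `-N`. -/
theorem eq_zero_of_iotaZero_eq {N : ℤ} (hN : 0 < N) {A B : Polynomial K}
    (h : iotaZero K A = T (-N) * iotaOne K B) : A = 0 ∧ B = 0 := by
  have hA : A = 0 := by
    ext n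
    have h1 := congrArg (fun x : LaurentPolynomial K => x.coeff (n : ℤ)) h
    simp only [coeff_T_mul, coeff_iotaZero, coeff_iotaOne] at h1
    rw [if_pos (by omega), if_neg (by omega)] at h1
    simpa using h1
  refine ⟨hA, ?_⟩
  rw [hA, map_zero] at h
  exact iotaOne_injective ((isUnit_T (R := K) (-N)).mul_left_cancel
    (by rw [← h, map_zero, mul_zero]))

/-- The rank of the constants that are sections of `𝒪(-a)` over the line. -/
def constRank (a : ℕ) : ℕ := if a = 0 then 1 else 0

/-- The constant polynomials that are sections of `𝒪(-a)`. -/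
noncomputable def constPoly (a : ℕ) : (Fin (constRank a) → K) →ₗ[K] Polynomial K :=
  ∑ i, (Polynomial.monomial 0) ∘ₗ LinearMap.proj i

theorem constPoly_apply (a : ℕ) (c : Fin (constRank a) → K) :
    constPoly a c = Polynomial.C (∑ i, c i) := by simp [constPoly]

theorem constPoly_injective (a : ℕ) : Function.Injective (constPoly (K := K) a) := by
  intro c c' h
  funext i
  rw [constPoly_apply, constPoly_apply] at h
  have h := Polynomial.C_injective h
  have : constRank a = 1 := by
    have := i.2
    unfold constRank at *
    split_ifs at * with h <;> omega
  have : Subsingleton (Fin (constRank a)) := by rw [this]; infer_instance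
  rwa [Fintype.sum_subsingleton _ i, Fintype.sum_subsingleton _ i] at h

theorem iotaZero_constPoly (a k : ℕ) (c : Fin (constRank a) → K) :
    iotaZero K (constPoly a c) = T (-(k * a : ℕ)) * iotaOne K (constPoly a c) := by
  by_cases ha : a = 0
  · simp [ha, constPoly_apply]
  · have : IsEmpty (Fin (constRank a)) := by simp [constRank, ha]; infer_instance
    simp [constPoly_apply]

/-- The multiple `k` allows one parameter space to serve for both `𝒪(-a)` and `𝒪(-2a)`, whose
sections are the constants if `a = 0` and zero otherwise. -/
theorem exists_constPoly (a : ℕ) {k : ℕ} (hk : 0 < k) {A B : Polynomial K}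
    (h : iotaZero K A = T (-(k * a : ℕ)) * iotaOne K B) :
    ∃ c, A = constPoly a c ∧ B = constPoly a c := by
  rcases Nat.eq_zero_or_pos a with rfl | ha
  · obtain ⟨c, hA, hB⟩ := exists_ofCoeffs 0 (A := A) (B := B) (by simpa using h)
    have hs : ∑ _i : Fin (constRank 0), c 0 = c 0 := Fin.sum_univ_one _
    refine ⟨fun _ => c 0, ?_, ?_⟩
    · rw [hA, constPoly_apply, hs]; simp [ofCoeffs_apply]
    · rw [hB, constPoly_apply, hs]; simp [ofCoeffsRev_apply]
  · obtain ⟨rfl, rfl⟩ := eq_zero_of_iotaZero_eq (by positivity) h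
    exact ⟨0, by simp, by simp⟩

/-- The Laurent polynomials that represent the first cohomology of `𝒪(-a)`. -/
noncomputable def polarPart (b : ℕ) (w : Fin b → K) : LaurentPolynomial K :=
  ∑ i, C (w i) * T (-(i + 1 : ℤ))

/-- Monomials with exponent at least `0` extend over the first chart, those with exponent at most
`-a` over the second. The exponents strictly between, `-1, …, -(a - 1)`, represent `H¹(𝒪(-a))`; for
`a = 0` the truncated subtraction correctly leaves none. -/
theorem exists_polarPart (a : ℕ) (x : LaurentPolynomial K) : ∃ A B : Polynomial K,
    ∃ w : Fin (a - 1) → K, x = iotaZero K A + T (-a) * iotaOne K B + polarPart _ w := by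
  induction x using LaurentPolynomial.induction_on' with
  | add p q hp hq =>
    obtain ⟨A, B, w, rfl⟩ := hp
    obtain ⟨A', B', w', rfl⟩ := hq
    refine ⟨A + A', B + B', w + w', ?_⟩
    simp only [polarPart, map_add, Pi.add_apply, add_mul, Finset.sum_add_distrib]
    ring
  | C_mul_T n c =>
    rcases le_or_gt 0 n with hn | hn
    · refine ⟨Polynomial.monomial n.toNat c, 0, 0, ?_⟩
      rw [iotaZero_monomial]
      simp [polarPart, hn]
    · rcases le_or_gt n (-a) with hn' | hn'
      · refine ⟨0, Polynomial.monomial (-a - n).toNat c, 0, ?_⟩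
        rw [iotaOne_monomial, T_mul, mul_assoc, ← T_add]
        simp only [polarPart, map_zero, Pi.zero_apply, zero_mul, Finset.sum_const_zero, add_zero,
          zero_add]
        congr 2
        omega
      · refine ⟨0, 0, Pi.single ⟨(-n - 1).toNat, by omega⟩ c, ?_⟩
        rw [polarPart, Finset.sum_eq_single ⟨(-n - 1).toNat, by omega⟩]
        · simp only [map_zero, mul_zero, zero_add, Pi.single_eq_same]
          congr 2
          omega
        · intro j _ hj
          rw [Pi.single_eq_of_ne hj, map_zero, zero_mul]
        · simp

theorem coeff_polarPart (b : ℕ) (w : Fin b → K) (i : Fin b) :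
    (polarPart b w).coeff (-(i + 1 : ℤ)) = w i := by
  have : polarPart b w = ∑ i : Fin b, AddMonoidAlgebra.single (-(i + 1 : ℤ)) (w i) := by
    simp only [polarPart, single_eq_C_mul_T]
  rw [this, AddMonoidAlgebra.coeff_sum, Finsupp.finsetSum_apply, Finset.sum_eq_single i]
  · rw [AddMonoidAlgebra.coeff_single, Finsupp.single_eq_same]
  · intro j _ hj
    simp only [AddMonoidAlgebra.coeff_single, Finsupp.single_apply]
    rw [if_neg]
    intro h
    exact hj (Fin.ext (by omega))
  · simp

/-- The exponents of a polar part occur on neither chart, so a nonzero polar part is not a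
coboundary. -/
theorem eq_zero_of_polarPart {a b : ℕ} (hb : b ≤ a - 1) {A B : Polynomial K} {w : Fin b → K}
    (h : polarPart b w = iotaZero K A - T (-a) * iotaOne K B) : w = 0 := by
  funext i
  have h1 := congrArg (fun x : LaurentPolynomial K => x.coeff (-(i + 1 : ℤ))) h
  have := i.2
  simp only [coeff_polarPart, AddMonoidAlgebra.coeff_sub, Finsupp.sub_apply, coeff_T_mul,
    coeff_iotaZero, coeff_iotaOne] at h1
  rw [if_neg (by omega), if_neg (by omega)] at h1
  simpa using h1

/-- This is the vanishing of `H¹(𝒪(1))`, obtained from that of `H¹(𝒪)` by multiplication by `u`. -/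
theorem exists_iotaZero_sub (x : LaurentPolynomial K) : ∃ A B : Polynomial K,
    iotaZero K A - T 1 * iotaOne K B = x := by
  obtain ⟨A, B, w, h⟩ := exists_polarPart 0 (T (-1) * x)
  refine ⟨Polynomial.X * A, -B, ?_⟩
  have hw : polarPart (0 - 1) w = 0 := Finset.sum_eq_zero fun i _ => i.elim0
  have h1 : (T 1 : LaurentPolynomial K) * T (-1) = 1 := by rw [← T_add]; rfl
  rw [hw] at h
  simp only [map_mul, map_neg, Polynomial.toLaurent_X, Nat.cast_zero, neg_zero, T_zero] at h ⊢
  linear_combination (- T 1) * h + x * h1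

end Laurent

end ProjCurve

/-! ### Gluing deformations on the two charts -/

namespace ProjCurve

section GlobalModel

open LaurentPolynomial

variable {K : Type*} [Field K] {ι : Type*} [Fintype ι]

/-- Pairs of normal homomorphisms on the two charts of the line that agree on the overlap. -/
def IsGlobalNormal (a : ℕ) (f₀ f₁ : ι → Polynomial K)
    (φ : (RingHom.ker (theta f₀) → DualNumber (Polynomial K)) ×
      (RingHom.ker (theta f₁) → DualNumber (Polynomial K))) : Prop :=
  IsNormalHom f₀ φ.1 ∧ IsNormalHom f₁ φ.2 ∧
    ∃ φ' : RingHom.ker (theta fun j => iotaZero K (f₀ j)) → DualNumber (LaurentPolynomial K),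
      IsNormalHom _ φ' ∧
      (∀ (s : RingHom.ker (theta f₀)) h, φ' ⟨coordMap (iotaZero K) 1 s.1, h⟩ =
        dualMap (iotaZero K) 1 (φ.1 s)) ∧
      ∀ (s : RingHom.ker (theta f₁)) h, φ' ⟨coordMap (iotaOne K) (T (-1)) s.1, h⟩ =
        dualMap (iotaOne K) (T a) (φ.2 s)

/-- Data of a deformation on a chart: the components of the displacements of the `yⱼ` and of the
perturbation of `ε ^ 2`. -/
abbrev ChartData (K : Type*) [Field K] (ι : Type*) : Type _ :=
  (ι → Polynomial K) × (ι → Polynomial K) × Polynomial K × Polynomial K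

/-- The deformation given by its data. -/
noncomputable def chartDeform (f : ι → Polynomial K) (P : ChartData K ι) :
    RingHom.ker (theta f) → DualNumber (Polynomial K) :=
  deform f (fun j => TrivSqZeroExt.inl (P.1 j) + TrivSqZeroExt.inr (P.2.1 j))
    (TrivSqZeroExt.inl P.2.2.1 + TrivSqZeroExt.inr P.2.2.2)

theorem deform_add {k : Type*} [CommRing k] (f : ι → k) (p p' : ι → DualNumber k)
    (q q' : DualNumber k) : deform f (p + p') (q + q') = deform f p q + deform f p' q' := by
  funext F
  simp only [deform, Pi.add_apply, mul_add, add_mul, Finset.sum_add_distrib]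
  ring

theorem deform_sub {k : Type*} [CommRing k] (f : ι → k) (p p' : ι → DualNumber k)
    (q q' : DualNumber k) : deform f (p - p') (q - q') = deform f p q - deform f p' q' := by
  rw [eq_sub_iff_add_eq, ← deform_add, sub_add_cancel, sub_add_cancel]

theorem deform_smul {k R : Type*} [CommRing k] [CommSemiring R] [Algebra R k] (f : ι → k) (c : R)
    (p : ι → DualNumber k) (q : DualNumber k) :
    deform f (c • p) (c • q) = c • deform f p q := by
  funext F
  simp only [deform, Pi.smul_apply, mul_smul_comm, smul_mul_assoc, smul_add, Finset.smul_sum]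

/-- The deformation given by its data, as a linear map. -/
noncomputable def chartDeformLinear (f : ι → Polynomial K) :
    ChartData K ι →ₗ[K] (RingHom.ker (theta f) → DualNumber (Polynomial K)) where
  toFun := chartDeform f
  map_add' P Q := by
    rw [chartDeform, chartDeform, chartDeform, ← deform_add]
    congr 1
    · funext j; ext <;> simp
    · ext <;> simp
  map_smul' c P := by
    rw [chartDeform, chartDeform, RingHom.id_apply, ← deform_smul]
    congr 1
    · funext j; ext <;> simp
    · ext <;> simp

/-- The conditions under which deformations on the two charts agree on the overlap up to a
normalized reparametrization `w`. -/
structure IsCompatible (a : ℕ) {b : ℕ} (f₀ : ι → Polynomial K) (P Q : ChartData K ι)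
    (w : Fin b → K) : Prop where
  fst : ∀ j, iotaZero K (P.1 j) - T 1 * iotaOne K (Q.1 j) = iotaZero K (f₀ j) * polarPart b w
  snd : ∀ j, iotaZero K (P.2.1 j) = T (a + 1 : ℕ) * iotaOne K (Q.2.1 j)
  sq_fst : iotaZero K P.2.2.1 = T (-(2 * a : ℕ)) * iotaOne K Q.2.2.1
  sq_snd : iotaZero K P.2.2.2 - T (-(1 * a : ℕ)) * iotaOne K Q.2.2.2 = - 2 * polarPart b w

variable {a : ℕ} {f₀ f₁ h₀ h₁ : ι → Polynomial K}

theorem T_inv (n : ℤ) : (T n : LaurentPolynomial K) * T (-n) = 1 := by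
  rw [← T_add, add_neg_cancel, T_zero]

theorem IsCompatible.isGlobalNormal {b : ℕ} (hf₀ : ∑ j, h₀ j * f₀ j = 1)
    (hT : ∀ j, T (a : ℤ) * iotaOne K (f₁ j) = T (-1) * iotaZero K (f₀ j))
    {P Q : ChartData K ι} {w : Fin b → K} (H : IsCompatible a f₀ P Q w) :
    IsGlobalNormal a f₀ f₁ (chartDeform f₀ P, chartDeform f₁ Q) := by
  have hff₀ : ∀ j, 1 * iotaZero K (f₀ j) = 1 * iotaZero K (f₀ j) := fun j => rfl
  have hF : ∑ j, iotaZero K (h₀ j) * iotaZero K (f₀ j) = 1 := by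
    simp only [← map_mul]; rw [← map_sum, hf₀, map_one]
  -- On the overlap take the deformation induced from the first chart. What remains is that the one
  -- induced from the second chart is the same, that is, that their difference is the
  -- reparametrization of `ε` by the polar part.
  refine ⟨isNormalHom_deform _ _ _, isNormalHom_deform _ _ _, _, isNormalHom_deform _ _ _,
    fun s h => deform_coordMap hff₀ (mul_one 1) (mul_one 1) _ _ s, fun s h => ?_⟩
  refine Eq.trans ?_ (deform_coordMap hT (s' := T 1) (T_inv (-1)) (T_inv a) _ _ s)
  rw [← sub_eq_zero]
  refine Eq.trans (congrFun (deform_sub _ _ _ _ _).symm _) ?_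
  refine congrFun ((deform_eq_zero_iff hF _ _).2 ⟨TrivSqZeroExt.inl (polarPart b w), fun j => ?_,
    ?_⟩) _
  · apply TrivSqZeroExt.ext
    · simpa using H.fst j
    · simp only [Pi.sub_apply, TrivSqZeroExt.snd_sub, DualNumber.snd_mul, snd_dualMap,
        TrivSqZeroExt.fst_inl, TrivSqZeroExt.snd_inl, TrivSqZeroExt.snd_add,
        TrivSqZeroExt.snd_inr, zero_add, fst_dualMap, zero_mul, add_zero, mul_zero, one_mul, H.snd]
      rw [← mul_assoc, ← T_add]
      push_cast
      ring_nf
  · apply TrivSqZeroExt.ext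
    · have h2 : (T (-a) : LaurentPolynomial K) ^ 2 = T (-(2 * a : ℕ)) := by
        rw [T_pow]; congr 1; push_cast; ring
      simp only [TrivSqZeroExt.fst_sub, TrivSqZeroExt.fst_mul, TrivSqZeroExt.fst_inl,
        fst_dualMap, TrivSqZeroExt.fst_add, TrivSqZeroExt.fst_inr, add_zero, H.sq_fst, h2,
        TrivSqZeroExt.fst_neg]
      simp
    · have h2 : (T (-a) : LaurentPolynomial K) ^ 2 * T a = T (-(1 * a : ℕ)) := by
        rw [T_pow, ← T_add]; congr 1; push_cast; ring
      simp only [TrivSqZeroExt.snd_sub, DualNumber.snd_mul, TrivSqZeroExt.fst_inl,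
        TrivSqZeroExt.snd_inl, snd_dualMap, TrivSqZeroExt.snd_add, TrivSqZeroExt.snd_inr,
        TrivSqZeroExt.snd_neg, zero_mul, add_zero, zero_add, mul_zero, fst_dualMap]
      have h4 : (2 * TrivSqZeroExt.inr 1 : DualNumber (LaurentPolynomial K)).fst = 0 := by
        simp
      have h5 : (2 * TrivSqZeroExt.inr 1 : DualNumber (LaurentPolynomial K)).snd = 2 := by
        simp [two_mul, one_add_one_eq_two]
      have h6 : (2 : DualNumber (LaurentPolynomial K)).fst = 2 := rfl
      simp only [TrivSqZeroExt.fst_inr, h6]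
      linear_combination H.sq_snd - iotaOne K Q.2.2.2 * h2

/-- A reparametrization of `ε` defined on a whole chart changes the data but not the homomorphism.
This is the freedom used to normalize the discrepancy on the overlap. -/
theorem chartDeform_add_eq {f h : ι → Polynomial K} (hf : ∑ j, h j * f j = 1) (P : ChartData K ι)
    (A B : Polynomial K) : chartDeform f (fun j => P.1 j + f j * A, fun j => P.2.1 j + f j * B,
      P.2.2.1, P.2.2.2 - 2 * A) = chartDeform f P := by
  rw [← sub_eq_zero, chartDeform, chartDeform, ← deform_sub]
  refine (deform_eq_zero_iff hf _ _).2 ⟨TrivSqZeroExt.inl A + TrivSqZeroExt.inr B, fun j => ?_, ?_⟩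
  · ext <;> simp
  · ext <;> simp [two_mul]

theorem chartDeform_eq_zero_iff {f h : ι → Polynomial K} (hf : ∑ j, h j * f j = 1)
    (P : ChartData K ι) : chartDeform f P = 0 ↔ ∃ A B : Polynomial K,
      P = (fun j => f j * A, fun j => f j * B, 0, - (2 * A)) := by
  rw [chartDeform, deform_eq_zero_iff hf]
  constructor
  · rintro ⟨w, h1, h2⟩
    refine ⟨w.fst, w.snd, Prod.ext (funext fun j => ?_) (Prod.ext (funext fun j => ?_)
      (Prod.ext ?_ ?_))⟩
    · simpa using congrArg TrivSqZeroExt.fst (h1 j)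
    · simpa using congrArg TrivSqZeroExt.snd (h1 j)
    · simpa using congrArg TrivSqZeroExt.fst h2
    · simpa [two_mul] using congrArg TrivSqZeroExt.snd h2
  · rintro ⟨A, B, rfl⟩
    refine ⟨TrivSqZeroExt.inl A + TrivSqZeroExt.inr B, fun j => ?_, ?_⟩
    · ext <;> simp
    · ext <;> simp [two_mul]

theorem exists_chartDeform {f h : ι → Polynomial K} (hf : ∑ j, h j * f j = 1)
    {φ : RingHom.ker (theta f) → DualNumber (Polynomial K)} (hφ : IsNormalHom f φ) :
    ∃ P, φ = chartDeform f P := by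
  obtain ⟨p, q, rfl⟩ := hφ.exists_deform hf
  refine ⟨(fun j => (p j).fst, fun j => (p j).snd, q.fst, q.snd), ?_⟩
  simp only [chartDeform, TrivSqZeroExt.inl_fst_add_inr_snd_eq]

/-- On the overlap the data of the two charts differ by a reparametrization `x`. Its `ε`-component
is a cocycle of `𝒪`, hence a coboundary; its other component is a cocycle of `𝒪(-a)`, hence a
coboundary plus a polar part. The coboundaries are absorbed into the data of the charts. -/
theorem IsGlobalNormal.exists_isCompatible (hf₀ : ∑ j, h₀ j * f₀ j = 1)
    (hf₁ : ∑ j, h₁ j * f₁ j = 1)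
    (hT : ∀ j, T (a : ℤ) * iotaOne K (f₁ j) = T (-1) * iotaZero K (f₀ j))
    {φ} (hφ : IsGlobalNormal a f₀ f₁ φ) : ∃ (P Q : ChartData K ι) (w : Fin (a - 1) → K),
      IsCompatible a f₀ P Q w ∧ φ = (chartDeform f₀ P, chartDeform f₁ Q) := by
  obtain ⟨φ₀, φ₁⟩ := φ
  obtain ⟨hφ₀, hφ₁, φ', hφ', H₀, H₁⟩ := hφ
  obtain ⟨P, rfl⟩ := exists_chartDeform hf₀ hφ₀
  obtain ⟨Q, rfl⟩ := exists_chartDeform hf₁ hφ₁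
  have hff₀ : ∀ j, 1 * iotaZero K (f₀ j) = 1 * iotaZero K (f₀ j) := fun j => rfl
  have hF : ∑ j, iotaZero K (h₀ j) * iotaZero K (f₀ j) = 1 := by
    simp only [← map_mul]; rw [← map_sum, hf₀, map_one]
  have e₀ := hφ'.eq_deform_of_coordMap hf₀ hff₀ (mul_one 1) (mul_one 1) fun s => H₀ s _
  have e₁ := hφ'.eq_deform_of_coordMap hf₁ hT (s' := T 1) (T_inv (-1)) (T_inv a) fun s => H₁ s _
  have e := sub_eq_zero.2 (e₀.symm.trans e₁)
  rw [← deform_sub, deform_eq_zero_iff hF] at e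
  obtain ⟨x, hx, hx'⟩ := e
  obtain ⟨A, A', w, hA⟩ := exists_polarPart a x.fst
  obtain ⟨B, B', w', hB⟩ := exists_polarPart 0 x.snd
  have hw' : polarPart (0 - 1) w' = 0 := Finset.sum_eq_zero fun i _ => i.elim0
  rw [hw', Nat.cast_zero, neg_zero, T_zero, one_mul, add_zero] at hB
  have hT' : ∀ j, iotaZero K (f₀ j) = T (a + 1 : ℕ) * iotaOne K (f₁ j) := by
    intro j
    have h1 : (T (a + 1 : ℕ) : LaurentPolynomial K) = T 1 * T a := by
      rw [← T_add]; congr 1; push_cast; ring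
    rw [h1, mul_assoc, hT, ← mul_assoc, T_inv, one_mul]
  have hTT : (T 1 : LaurentPolynomial K) = T (a + 1 : ℕ) * T (-a) := by
    rw [← T_add]; congr 1; push_cast; ring
  have h2T : (T (-a) : LaurentPolynomial K) ^ 2 = T (-(2 * a : ℕ)) := by
    rw [T_pow]; congr 1; push_cast; ring
  -- The first chart is reparametrized by `-(A + Bε)` and the second by `A' + B'ε`; only the polar
  -- part of `x` survives.
  refine ⟨(fun j => P.1 j + f₀ j * (-A), fun j => P.2.1 j + f₀ j * (-B),
      P.2.2.1, P.2.2.2 - 2 * (-A)), (fun j => Q.1 j + f₁ j * A', fun j => Q.2.1 j + f₁ j * B',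
      Q.2.2.1, Q.2.2.2 - 2 * A'), w, ⟨fun j => ?_, fun j => ?_, ?_, ?_⟩, ?_⟩
  · have := congrArg TrivSqZeroExt.fst (hx j)
    simp only [Pi.sub_apply, TrivSqZeroExt.fst_sub, TrivSqZeroExt.fst_mul, TrivSqZeroExt.fst_inl,
      fst_dualMap, TrivSqZeroExt.fst_add, TrivSqZeroExt.fst_inr, add_zero, one_mul, hA] at this
    simp only [map_add, map_mul, map_neg]
    linear_combination this + iotaOne K A' * T (-a) * hT' j - iotaOne K (f₁ j) * iotaOne K A' * hTT
  · have := congrArg TrivSqZeroExt.snd (hx j)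
    simp only [Pi.sub_apply, TrivSqZeroExt.snd_sub, DualNumber.snd_mul, snd_dualMap,
        TrivSqZeroExt.fst_inl, TrivSqZeroExt.snd_inl, TrivSqZeroExt.snd_add,
        TrivSqZeroExt.snd_inr, zero_add, fst_dualMap, zero_mul, add_zero, one_mul, hB] at this
    simp only [map_add, map_mul, map_neg]
    have h1 : (T (a + 1 : ℕ) : LaurentPolynomial K) = T 1 * T a := by
      rw [← T_add]; congr 1; push_cast; ring
    linear_combination this + iotaOne K B' * hT' j - iotaOne K (Q.2.1 j) * h1
  · have := congrArg TrivSqZeroExt.fst hx'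
    simp only [TrivSqZeroExt.fst_sub, TrivSqZeroExt.fst_mul, TrivSqZeroExt.fst_inl,
        fst_dualMap, TrivSqZeroExt.fst_add, TrivSqZeroExt.fst_inr, add_zero, h2T, one_mul, one_pow,
        TrivSqZeroExt.fst_neg, mul_zero, zero_mul, neg_zero] at this
    linear_combination this
  · have := congrArg TrivSqZeroExt.snd hx'
    have h2 : (T (-a) : LaurentPolynomial K) ^ 2 * T a = T (-(1 * a : ℕ)) := by
      rw [T_pow, ← T_add]; congr 1; push_cast; ring
    have h3 : (T (-(1 * a : ℕ)) : LaurentPolynomial K) = T (-a) := by rw [one_mul]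
    have h4 : (2 * TrivSqZeroExt.inr 1 * x).snd = 2 * x.fst := by
      simp [two_mul]
    simp only [TrivSqZeroExt.snd_sub, DualNumber.snd_mul, TrivSqZeroExt.fst_inl,
      TrivSqZeroExt.snd_inl, snd_dualMap, TrivSqZeroExt.snd_add, TrivSqZeroExt.snd_inr,
      TrivSqZeroExt.snd_neg, zero_mul, add_zero, zero_add, h4] at this
    simp only [map_sub, map_mul, map_neg, map_ofNat]
    linear_combination this - 2 * hA + iotaOne K Q.2.2.2 * h2 + 2 * iotaOne K A' * h3
  · rw [chartDeform_add_eq hf₀, chartDeform_add_eq hf₁]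

end GlobalModel

end ProjCurve

/-! ### Counting parameters and relations -/

namespace ProjCurve

section Dimension

open LaurentPolynomial

variable {K : Type*} [Field K] {ι : Type*} [Fintype ι]

/-- Parameters for the global normal homomorphisms. -/
abbrev Params (K : Type*) [Field K] (ι : Type*) (a b : ℕ) : Type _ :=
  (ι → Fin (1 + 1) → K) × (ι → Fin (a + 1 + 1) → K) × (Fin (constRank a) → K) ×
    (Fin (constRank a) → K) × (Fin b → K)

/-- The deformation of a chart with given parameters; `q` is the way in which polynomials are
written on the chart, and `A` describes the contribution of the polar part. -/
noncomputable def chartParam {a b : ℕ} (q : (N : ℕ) → (Fin (N + 1) → K) →ₗ[K] Polynomial K)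
    (A : ℕ → ι → Polynomial K) : Params K ι a b →ₗ[K] ChartData K ι where
  toFun d := (fun j => q 1 (d.1 j) + ∑ i, d.2.2.2.2 i • A i j, fun j => q (a + 1) (d.2.1 j),
    constPoly a d.2.2.1, constPoly a d.2.2.2.1)
  map_add' d d' := by
    refine Prod.ext (funext fun j => ?_) (Prod.ext (funext fun j => ?_) (Prod.ext ?_ ?_))
    · simp only [Prod.fst_add, Prod.snd_add, Pi.add_apply, map_add, add_smul,
        Finset.sum_add_distrib]
      abel
    · simp
    · simp
    · simp
  map_smul' c d := by
    refine Prod.ext (funext fun j => ?_) (Prod.ext (funext fun j => ?_) (Prod.ext ?_ ?_))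
    · simp [Finset.smul_sum, smul_smul]
    · simp
    · simp
    · simp

variable {a b : ℕ} {f₀ f₁ h₀ h₁ : ι → Polynomial K} {A A' : ℕ → ι → Polynomial K}

theorem iotaZero_smul (c : K) (x : Polynomial K) : iotaZero K (c • x) = C c * iotaZero K x := by
  rw [Polynomial.smul_eq_C_mul, map_mul, Polynomial.toLaurent_C]

theorem iotaOne_smul (c : K) (x : Polynomial K) : iotaOne K (c • x) = C c * iotaOne K x := by
  rw [Polynomial.smul_eq_C_mul, map_mul, iotaOne_C]

/-- The pair `(A i, A' i)` splits the cocycle `u^(-(i+1)) f₀` of copies of `𝒪(1)`; by linearity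
every polar part can be split once these are chosen. -/
theorem iota_sum_sub
    (hA : ∀ i j, iotaZero K (A i j) - T 1 * iotaOne K (A' i j) = T (-(i + 1 : ℤ)) * iotaZero K (f₀ j))
    (w : Fin b → K) (j : ι) : iotaZero K (∑ i : Fin b, w i • A i j) -
      T 1 * iotaOne K (∑ i : Fin b, w i • A' i j) = iotaZero K (f₀ j) * polarPart b w := by
  simp only [map_sum, polarPart, Finset.mul_sum, ← Finset.sum_sub_distrib, iotaZero_smul,
    iotaOne_smul]
  refine Finset.sum_congr rfl fun i _ => ?_
  linear_combination C (w i) * hA i j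

theorem two_mul_polarPart (hb : b = 0 ∨ (2 : K) = 0) (w : Fin b → K) :
    -2 * polarPart b w = 0 := by
  rcases hb with rfl | h2
  · rw [polarPart, Finset.sum_eq_zero fun i _ => i.elim0, mul_zero]
  · have : (2 : LaurentPolynomial K) = 0 := by
      rw [← map_ofNat (C (R := K)) 2, h2, map_zero]
    rw [this]; simp

theorem isCompatible_chartParam
    (hA : ∀ i j, iotaZero K (A i j) - T 1 * iotaOne K (A' i j) = T (-(i + 1 : ℤ)) * iotaZero K (f₀ j))
    (hb : b = 0 ∨ (2 : K) = 0) (d : Params K ι a b) :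
    IsCompatible a f₀ (chartParam ofCoeffs A d) (chartParam ofCoeffsRev A' d) d.2.2.2.2 where
  fst j := by
    have h1 := iotaZero_ofCoeffs 1 (d.1 j)
    have h2 := iota_sum_sub hA d.2.2.2.2 j
    simp only [chartParam, LinearMap.coe_mk, AddHom.coe_mk, Nat.cast_one] at h1 ⊢
    rw [map_add, map_add, h1, ← h2]
    ring
  snd j := iotaZero_ofCoeffs (a + 1) (d.2.1 j)
  sq_fst := iotaZero_constPoly a 2 d.2.2.1
  sq_snd := by
    rw [two_mul_polarPart hb, sub_eq_zero]
    exact iotaZero_constPoly a 1 d.2.2.2.1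

theorem IsCompatible.exists_chartParam
    (hA : ∀ i j, iotaZero K (A i j) - T 1 * iotaOne K (A' i j) = T (-(i + 1 : ℤ)) * iotaZero K (f₀ j))
    (hb : b = 0 ∨ (2 : K) = 0) {P Q : ChartData K ι} {w : Fin b → K}
    (H : IsCompatible a f₀ P Q w) : ∃ d : Params K ι a b, chartParam ofCoeffs A d = P ∧
      chartParam ofCoeffsRev A' d = Q ∧ d.2.2.2.2 = w := by
  have h1 : ∀ j, ∃ c, P.1 j - ∑ i : Fin b, w i • A i j = ofCoeffs 1 c ∧
      Q.1 j - ∑ i : Fin b, w i • A' i j = ofCoeffsRev 1 c := by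
    intro j
    apply exists_ofCoeffs
    rw [map_sub, map_sub, Nat.cast_one]
    linear_combination H.fst j - iota_sum_sub hA w j
  choose c hc hc' using h1
  have h2 := fun j => exists_ofCoeffs (a + 1) (H.snd j)
  choose c₂ hc₂ hc₂' using h2
  obtain ⟨c₃, hc₃, hc₃'⟩ := exists_constPoly a two_pos H.sq_fst
  have h4 := H.sq_snd
  rw [two_mul_polarPart hb, sub_eq_zero] at h4
  obtain ⟨c₄, hc₄, hc₄'⟩ := exists_constPoly a one_pos h4
  refine ⟨(c, c₂, c₃, c₄, w), ?_, ?_, rfl⟩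
  · refine Prod.ext (funext fun j => ?_) (Prod.ext (funext fun j => ?_) (Prod.ext ?_ ?_))
    · simp [chartParam, ← hc]
    · exact (hc₂ j).symm
    · exact hc₃.symm
    · exact hc₄.symm
  · refine Prod.ext (funext fun j => ?_) (Prod.ext (funext fun j => ?_) (Prod.ext ?_ ?_))
    · simp [chartParam, ← hc']
    · exact (hc₂' j).symm
    · exact hc₃'.symm
    · exact hc₄'.symm

/-- The rank of the contribution of the polar parts. -/
noncomputable def polarRank (K : Type*) [Field K] (a : ℕ) : ℕ := by
  classical exact if (2 : K) = 0 then a - 1 else 0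

/-- If `2` is invertible, `sq_snd` divided by `-2` exhibits the polar part as a coboundary for
`𝒪(-a)`, so it is zero. If `2 = 0`, that condition no longer restricts it, and all `a - 1`
coefficients remain free. -/
theorem IsCompatible.exists_polarRank {P Q : ChartData K ι} {w : Fin (a - 1) → K}
    (H : IsCompatible a f₀ P Q w) : ∃ w' : Fin (polarRank K a) → K, IsCompatible a f₀ P Q w' := by
  by_cases h2 : (2 : K) = 0
  · have : polarRank K a = a - 1 := by simp [polarRank, h2]
    rw [this]
    exact ⟨w, H⟩
  · have hw : w = 0 := by
      refine eq_zero_of_polarPart (a := a) (A := Polynomial.C (-(1 / 2)) * P.2.2.2)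
        (B := Polynomial.C (-(1 / 2)) * Q.2.2.2) le_rfl ?_
      have h := H.sq_snd
      have hC : (C (-(1 / 2) : K) : LaurentPolynomial K) * (-2) = 1 := by
        have : (-2 : LaurentPolynomial K) = C (-2) := by rw [map_neg, map_ofNat]
        rw [this, ← map_mul, ← map_one C]
        congr 1
        field_simp
      have h3 : (T (-(1 * a : ℕ)) : LaurentPolynomial K) = T (-a) := by rw [one_mul]
      rw [h3] at h
      simp only [map_mul, Polynomial.toLaurent_C, iotaOne_C]
      linear_combination (- polarPart (a - 1) w) * hC - C (-(1 / 2)) * h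
    subst hw
    have h0 : ∀ b, polarPart b (0 : Fin b → K) = 0 := fun b => by simp [polarPart]
    exact ⟨0, fun j => by rw [H.fst, h0, h0], H.snd, H.sq_fst, by rw [H.sq_snd, h0, h0]⟩

/-- A unimodular vector can be cancelled: multiply by the `h_j` and add. -/
theorem sum_iota_mul (hf₀ : ∑ j, h₀ j * f₀ j = 1) {x y : LaurentPolynomial K}
    (h : ∀ j, iotaZero K (f₀ j) * x = iotaZero K (f₀ j) * y) : x = y := by
  have hF : ∑ j, iotaZero K (h₀ j) * iotaZero K (f₀ j) = 1 := by
    simp only [← map_mul]; rw [← map_sum, hf₀, map_one]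
  calc x = (∑ j, iotaZero K (h₀ j) * iotaZero K (f₀ j)) * x := by rw [hF, one_mul]
    _ = ∑ j, iotaZero K (h₀ j) * (iotaZero K (f₀ j) * x) := by
      rw [Finset.sum_mul]; simp only [mul_assoc]
    _ = ∑ j, iotaZero K (h₀ j) * (iotaZero K (f₀ j) * y) := by simp only [h]
    _ = y := by simp only [← mul_assoc, ← Finset.sum_mul]; rw [hF, one_mul]

/-- The data of the reparametrizations of `ε` on a chart. -/
noncomputable def reparam (a : ℕ) (f : ι → Polynomial K) :
    (Fin (constRank a) → K) × K →ₗ[K] ChartData K ι where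
  toFun c := (fun j => f j * constPoly a c.1, fun j => f j * Polynomial.C c.2, 0,
    - (2 * constPoly a c.1))
  map_add' c c' := by
    refine Prod.ext (funext fun j => ?_) (Prod.ext (funext fun j => ?_) (Prod.ext ?_ ?_)) <;>
      simp [mul_add] <;> ring
  map_smul' r c := by
    refine Prod.ext (funext fun j => ?_) (Prod.ext (funext fun j => ?_) (Prod.ext ?_ ?_)) <;>
      (simp [Polynomial.smul_eq_C_mul]; try ring)

theorem reparam_injective (hf₀ : ∑ j, h₀ j * f₀ j = 1) :
    Function.Injective (reparam a f₀) := by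
  rintro ⟨c, x⟩ ⟨c', x'⟩ h
  have key : ∀ p q : Polynomial K, (∀ j, f₀ j * p = f₀ j * q) → p = q := by
    intro p q hpq
    rw [← iotaZero_injective.eq_iff]
    exact sum_iota_mul hf₀ fun j => by rw [← map_mul, hpq, map_mul]
  have h1 := key _ _ (congrFun (congrArg Prod.fst h))
  have h2 := key _ _ (congrFun (congrArg (fun z => z.2.1) h))
  exact Prod.ext (constPoly_injective a h1) (Polynomial.C_injective h2)

/-- The dimension of the space of global normal homomorphisms. -/
theorem finrank_of_range_eq_isGlobalNormal {E : Type*} [AddCommGroup E] [Module K E]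
    (hf₀ : ∑ j, h₀ j * f₀ j = 1) (hf₁ : ∑ j, h₁ j * f₁ j = 1)
    (hT : ∀ j, T (a : ℤ) * iotaOne K (f₁ j) = T (-1) * iotaZero K (f₀ j))
    (Θ : E →ₗ[K] (RingHom.ker (theta f₀) → DualNumber (Polynomial K)) ×
      (RingHom.ker (theta f₁) → DualNumber (Polynomial K)))
    (hinj : Function.Injective Θ) (hΘ : ∀ φ, φ ∈ Set.range Θ ↔ IsGlobalNormal a f₀ f₁ φ) :
    Module.finrank K E + (constRank a + 1) =
      Fintype.card ι * 2 + Fintype.card ι * (a + 2) + 2 * constRank a + polarRank K a := by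
  have hT' : ∀ j, iotaZero K (f₀ j) = T (a + 1 : ℕ) * iotaOne K (f₁ j) := by
    intro j
    have h1 : (T (a + 1 : ℕ) : LaurentPolynomial K) = T 1 * T a := by
      rw [← T_add]; congr 1; push_cast; ring
    rw [h1, mul_assoc, hT, ← mul_assoc, T_inv, one_mul]
  have hTT : (T 1 : LaurentPolynomial K) = T (a + 1 : ℕ) * T (-a) := by
    rw [← T_add]; congr 1; push_cast; ring
  have hTa : (T (-(1 * a : ℕ)) : LaurentPolynomial K) = T (-a) := by rw [one_mul]
  have hb : polarRank K a = 0 ∨ (2 : K) = 0 := by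
    unfold polarRank
    split_ifs with h
    · exact Or.inr h
    · exact Or.inl rfl
  have hA := fun (i : ℕ) (j : ι) => exists_iotaZero_sub (T (-(i + 1 : ℤ)) * iotaZero K (f₀ j))
  choose A A' hA using hA
  let δ₀ : Params K ι a (polarRank K a) →ₗ[K] ChartData K ι := chartParam ofCoeffs A
  let δ₁ : Params K ι a (polarRank K a) →ₗ[K] ChartData K ι := chartParam ofCoeffsRev A'
  let wL : Params K ι a (polarRank K a) →ₗ[K] (Fin (polarRank K a) → K) :=
    LinearMap.snd _ _ _ ∘ₗ LinearMap.snd _ _ _ ∘ₗ LinearMap.snd _ _ _ ∘ₗ LinearMap.snd _ _ _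
  -- The coefficients `w` are recorded separately because the first component of the chart data
  -- mixes the section of `𝒪(1)` with the splitting of the polar part. With `w` known, the other
  -- parameters can be read off.
  let δ := δ₀.prod (δ₁.prod wL)
  let Ψ := (chartDeformLinear f₀ ∘ₗ δ₀).prod (chartDeformLinear f₁ ∘ₗ δ₁)
  have hΨ : LinearMap.range Ψ = LinearMap.range Θ := by
    ext φ
    refine Iff.trans ?_ (hΘ φ).symm
    constructor
    · rintro ⟨d, rfl⟩
      exact (isCompatible_chartParam hA hb d).isGlobalNormal hf₀ hT
    · intro hφ
      obtain ⟨P, Q, w, H, rfl⟩ := hφ.exists_isCompatible hf₀ hf₁ hT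
      obtain ⟨w', H'⟩ := H.exists_polarRank
      obtain ⟨d, rfl, rfl, -⟩ := H'.exists_chartParam hA hb
      exact ⟨d, rfl⟩
  have hδ : Function.Injective δ := by
    intro d d' h
    have h0 : δ₀ d = δ₀ d' := congrArg Prod.fst h
    have hw : d.2.2.2.2 = d'.2.2.2.2 := congrArg (fun z => z.2.2) h
    refine Prod.ext (funext fun j => ?_) (Prod.ext (funext fun j => ?_)
      (Prod.ext ?_ (Prod.ext ?_ hw)))
    · have := congrFun (congrArg Prod.fst h0) j
      simp only [δ₀, chartParam, LinearMap.coe_mk, AddHom.coe_mk, hw, add_left_inj] at this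
      exact ofCoeffs_injective 1 this
    · exact ofCoeffs_injective _ (congrFun (congrArg (fun z => z.2.1) h0) j)
    · exact constPoly_injective _ (congrArg (fun z => z.2.2.1) h0)
    · exact constPoly_injective _ (congrArg (fun z => z.2.2.2) h0)
  let κ := (reparam a f₀).prod ((reparam a f₁).prod
    (0 : (Fin (constRank a) → K) × K →ₗ[K] (Fin (polarRank K a) → K)))
  have hκ : Function.Injective κ := by
    intro c c' h
    exact reparam_injective hf₀ (congrArg Prod.fst h)
  -- If both chart deformations vanish, the data are reparametrizations on each chart. Compatibility
  -- makes the polar part a coboundary, so `w = 0`, and then glues the two reparametrizations to a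
  -- global section of `𝒪(-a) ⊕ 𝒪`. This space has dimension `constRank a + 1`.
  have hker : (LinearMap.ker Ψ).map δ = LinearMap.range κ := by
    ext v
    constructor
    · rintro ⟨d, hd, rfl⟩
      have H := isCompatible_chartParam hA hb d
      have hd0 : chartDeform f₀ (δ₀ d) = 0 := congrArg Prod.fst hd
      have hd1 : chartDeform f₁ (δ₁ d) = 0 := congrArg Prod.snd hd
      obtain ⟨x, y, h0⟩ := (chartDeform_eq_zero_iff hf₀ _).1 hd0
      obtain ⟨x', y', h1⟩ := (chartDeform_eq_zero_iff hf₁ _).1 hd1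
      change IsCompatible a f₀ (δ₀ d) (δ₁ d) _ at H
      rw [h0, h1] at H
      have hw : polarPart _ d.2.2.2.2 = iotaZero K x - T (-a) * iotaOne K x' := by
        refine sum_iota_mul hf₀ fun j => ?_
        rw [← H.fst j]
        simp only [map_mul]
        linear_combination (T (-a) * iotaOne K x') * hT' j
          - iotaOne K (f₁ j) * iotaOne K x' * hTT
      have hb' : polarRank K a ≤ a - 1 := by
        unfold polarRank; split_ifs <;> omega
      have hw0 := eq_zero_of_polarPart hb' hw
      rw [hw0] at hw
      have hx : iotaZero K x = T (-(1 * a : ℕ)) * iotaOne K x' := by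
        rw [← sub_eq_zero, hTa, ← hw]; simp [polarPart]
      obtain ⟨c, rfl, rfl⟩ := exists_constPoly a one_pos hx
      have hy : iotaZero K y = T (0 : ℕ) * iotaOne K y' := by
        refine sum_iota_mul hf₀ fun j => ?_
        have := H.snd j
        simp only [map_mul] at this
        rw [this, Nat.cast_zero, T_zero, hT']
        ring
      obtain ⟨z, rfl, rfl⟩ := exists_ofCoeffs 0 hy
      refine ⟨(c, z 0), Prod.ext ?_ (Prod.ext ?_ hw0.symm)⟩
      · refine Eq.trans ?_ h0.symm
        simp [reparam, κ, ofCoeffs_apply]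
      · refine Eq.trans ?_ h1.symm
        simp [reparam, κ, ofCoeffsRev_apply]
    · rintro ⟨c, rfl⟩
      have H : IsCompatible a f₀ (reparam a f₀ c) (reparam a f₁ c)
          (0 : Fin (polarRank K a) → K) := by
        have h0 : polarPart (polarRank K a) (0 : Fin (polarRank K a) → K) = 0 := by
          simp [polarPart]
        have hc := iotaZero_constPoly a 1 c.1
        rw [hTa] at hc
        refine ⟨fun j => ?_, fun j => ?_, ?_, ?_⟩
        · simp only [reparam, LinearMap.coe_mk, AddHom.coe_mk, map_mul, h0]
          linear_combination (T (-a) * iotaOne K (constPoly a c.1)) * hT' j +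
            iotaZero K (f₀ j) * hc - iotaOne K (f₁ j) * iotaOne K (constPoly a c.1) * hTT
        · simp only [reparam, LinearMap.coe_mk, AddHom.coe_mk, map_mul, hT', iotaOne_C,
            Polynomial.toLaurent_C, mul_assoc]
        · simp [reparam]
        · rw [hTa, h0]
          simp only [reparam, LinearMap.coe_mk, AddHom.coe_mk, map_mul, map_neg, map_ofNat, hc]
          ring
      obtain ⟨d, hd0, hd1, hdw⟩ := H.exists_chartParam hA hb
      refine ⟨d, ?_, Prod.ext hd0 (Prod.ext hd1 hdw)⟩
      refine Prod.ext ?_ ?_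
      · change chartDeform f₀ (chartParam ofCoeffs A d) = 0
        rw [hd0, chartDeform_eq_zero_iff hf₀]
        exact ⟨_, _, rfl⟩
      · change chartDeform f₁ (chartParam ofCoeffsRev A' d) = 0
        rw [hd1, chartDeform_eq_zero_iff hf₁]
        exact ⟨_, _, rfl⟩
  have e1 : Module.finrank K (LinearMap.ker Ψ) = constRank a + 1 := by
    rw [(Submodule.equivMapOfInjective δ hδ (LinearMap.ker Ψ)).finrank_eq, hker,
      LinearMap.finrank_range_of_inj hκ]
    simp
  have e2 := LinearMap.finrank_range_add_finrank_ker Ψ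
  rw [e1, hΨ, LinearMap.finrank_range_of_inj hinj] at e2
  rw [e2]
  simp only [Module.finrank_prod, Module.finrank_pi_fintype, Module.finrank_self, Finset.sum_const,
    Finset.card_univ, Fintype.card_fin, smul_eq_mul]
  ring

end Dimension

end ProjCurve

/-! ### Extension of homomorphisms on ideals along flat maps -/

namespace ProjCurve

section Flat

/-- Linear maps on an ideal extend along flat base changes. -/
theorem exists_extend_of_flat {A B M : Type*} [CommRing A] [CommRing B] [Algebra A B]
    [Module.Flat A B] [AddCommGroup M] [Module A M] [Module B M] [IsScalarTower A B M]
    (I : Ideal A) (φ : I →ₗ[A] M) : ∃ ψ : I.map (algebraMap A B) →ₗ[B] M,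
      ∀ s : I, ψ ⟨algebraMap A B s, Ideal.mem_map_of_mem _ s.2⟩ = φ s := by
  let μ : TensorProduct A B I →ₗ[B] B :=
    (TensorProduct.AlgebraTensorModule.rid A B B).toLinearMap ∘ₗ I.subtype.baseChange B
  -- Flatness identifies `B ⊗ I` with the extended ideal `IB`, on which the base change of `φ` is
  -- then defined.
  have hμ : Function.Injective μ :=
    (TensorProduct.AlgebraTensorModule.rid A B B).injective.comp
      (Module.Flat.lTensor_preserves_injective_linearMap _ I.injective_subtype)
  have hμ' (b : B) (s : I) : μ (b ⊗ₜ s) = b * algebraMap A B s := by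
    simp [μ, Algebra.smul_def, mul_comm]
  have hr : LinearMap.range μ = I.map (algebraMap A B) := by
    apply le_antisymm
    · rintro _ ⟨x, rfl⟩
      induction x using TensorProduct.induction_on with
      | zero => simp
      | tmul b s =>
        rw [hμ']
        exact Ideal.mul_mem_left _ _ (Ideal.mem_map_of_mem _ s.2)
      | add x y hx hy => rw [map_add]; exact add_mem hx hy
    · refine Ideal.map_le_iff_le_comap.2 fun s hs => ⟨1 ⊗ₜ ⟨s, hs⟩, ?_⟩
      rw [hμ', one_mul]
  let e := (LinearEquiv.ofInjective μ hμ).trans (LinearEquiv.ofEq _ _ hr)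
  refine ⟨φ.liftBaseChange B ∘ₗ e.symm.toLinearMap, fun s => ?_⟩
  have : e.symm ⟨algebraMap A B s, Ideal.mem_map_of_mem _ s.2⟩ = 1 ⊗ₜ s := by
    rw [LinearEquiv.symm_apply_eq]
    apply Subtype.ext
    change _ = μ (1 ⊗ₜ s)
    rw [hμ', one_mul]
  rw [LinearMap.comp_apply, LinearEquiv.coe_coe, this, LinearMap.liftBaseChange_tmul, one_smul]

end Flat

/-! ### Sections of the normal sheaf from two charts -/

section Gluing

variable {n : ℕ} {K : Type u} [Field K] (C : (ProjSpace n K).IdealSheafData)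

/-- The restriction map between sections over affine open subsets. -/
noncomputable abbrev res {U V : (ProjSpace n K).affineOpens} (h : U ≤ V) :
    Γ(ProjSpace n K, V) →+* Γ(ProjSpace n K, U) :=
  ((ProjSpace n K).presheaf.map (homOfLE (show U.1 ≤ V.1 from h)).op).hom

theorem res_res {U V W : (ProjSpace n K).affineOpens} (h : U ≤ V) (h' : V ≤ W)
    (s : Γ(ProjSpace n K, W)) : res h (res h' s) = res (h.trans h') s := by
  rw [res, res, ← RingHom.comp_apply, ← CommRingCat.hom_comp, ← Functor.map_comp]
  rfl

theorem restrictStructure_mk {U V : (ProjSpace n K).affineOpens} (h : U ≤ V)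
    (s : Γ(ProjSpace n K, V)) : restrictStructure C h (Ideal.Quotient.mk _ s) =
      Ideal.Quotient.mk _ (res h s) := rfl

theorem restrictStructure_comp {U V W : (ProjSpace n K).affineOpens} (h : U ≤ V) (h' : V ≤ W)
    (z : Γ(ProjSpace n K, W) ⧸ C.ideal W) :
    restrictStructure C h (restrictStructure C h' z) = restrictStructure C (h.trans h') z := by
  obtain ⟨z, rfl⟩ := Ideal.Quotient.mk_surjective z
  rw [restrictStructure_mk, restrictStructure_mk, restrictStructure_mk, res_res]

theorem restrictIdeal_comp {U V W : (ProjSpace n K).affineOpens} (h : U ≤ V) (h' : V ≤ W)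
    (s : C.ideal W) :
    restrictIdeal C h (restrictIdeal C h' s) = restrictIdeal C (h.trans h') s :=
  Subtype.ext (res_res h h' s.1)

/-- Restriction of sections to the subscheme `C`. -/
noncomputable abbrev toSub (U : (ProjSpace n K).affineOpens) :
    Γ(ProjSpace n K, U) →+* Γ(C.subscheme, C.subschemeι ⁻¹ᵁ U.1) :=
  (C.subschemeι.app U.1).hom

theorem toSub_eq_zero_iff {U : (ProjSpace n K).affineOpens} (s : Γ(ProjSpace n K, U)) :
    toSub C U s = 0 ↔ s ∈ C.ideal U := by
  rw [← C.ker_subschemeι_app U]; rfl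

theorem toSub_res {U V : (ProjSpace n K).affineOpens} (h : U ≤ V) (s : Γ(ProjSpace n K, V)) :
    toSub C U (res h s) = (C.subscheme.presheaf.map
      (homOfLE (show C.subschemeι ⁻¹ᵁ U.1 ≤ C.subschemeι ⁻¹ᵁ V.1 from
        (TopologicalSpace.Opens.map _).monotone h)).op).hom (toSub C V s) := by
  have := C.subschemeι.naturality (homOfLE (show U.1 ≤ V.1 from h)).op
  exact congrArg (fun f => f.hom s) this

/-- The points of `C` are those of its support, so open sets that cover only the support already
cover `C`. This is why two charts suffice although they do not cover `ℙⁿ`. -/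
theorem preimage_le_iSup {J : Type*} {U : (ProjSpace n K).affineOpens}
    {V : J → (ProjSpace n K).affineOpens}
    (hc : ∀ x ∈ U.1, x ∈ C.support → ∃ i, x ∈ (V i).1) :
    C.subschemeι ⁻¹ᵁ U.1 ≤ ⨆ i, C.subschemeι ⁻¹ᵁ (V i).1 := by
  intro x hx
  have hs : C.subschemeι x ∈ C.support := by
    have : C.subschemeι x ∈ Set.range C.subschemeι := ⟨x, rfl⟩
    rwa [C.range_subschemeι] at this
  obtain ⟨i, hi⟩ := hc _ hx hs
  exact TopologicalSpace.Opens.mem_iSup.2 ⟨i, hi⟩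

/-- Membership in the ideal of a subscheme is local. -/
theorem mem_ideal_of_locally {J : Type u} {U : (ProjSpace n K).affineOpens}
    {V : J → (ProjSpace n K).affineOpens} (hV : ∀ i, V i ≤ U)
    (hc : ∀ x ∈ U.1, x ∈ C.support → ∃ i, x ∈ (V i).1) {s : Γ(ProjSpace n K, U)}
    (hs : ∀ i, res (hV i) s ∈ C.ideal (V i)) : s ∈ C.ideal U := by
  rw [← toSub_eq_zero_iff]
  refine C.subscheme.sheaf.eq_of_locally_eq' (fun i => C.subschemeι ⁻¹ᵁ (V i).1)
    (C.subschemeι ⁻¹ᵁ U.1) (fun i => homOfLE ((TopologicalSpace.Opens.map _).monotone (hV i)))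
    (preimage_le_iSup C hc) _ _ fun i => ?_
  have := (toSub_eq_zero_iff C _).2 (hs i)
  rw [toSub_res] at this
  exact this.trans (map_zero _).symm

theorem eq_of_restrictStructure {J : Type u} {U : (ProjSpace n K).affineOpens}
    {V : J → (ProjSpace n K).affineOpens} (hV : ∀ i, V i ≤ U)
    (hc : ∀ x ∈ U.1, x ∈ C.support → ∃ i, x ∈ (V i).1) {z z' : Γ(ProjSpace n K, U) ⧸ C.ideal U}
    (hz : ∀ i, restrictStructure C (hV i) z = restrictStructure C (hV i) z') : z = z' := by
  obtain ⟨s, rfl⟩ := Ideal.Quotient.mk_surjective z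
  obtain ⟨s', rfl⟩ := Ideal.Quotient.mk_surjective z'
  rw [Ideal.Quotient.eq]
  refine mem_ideal_of_locally C hV hc fun i => ?_
  have := hz i
  rw [restrictStructure_mk, restrictStructure_mk, Ideal.Quotient.eq] at this
  rwa [map_sub]

/-- Sections of the structure sheaf of a subscheme can be glued. -/
theorem exists_glue {U V₀ V₁ V₀₁ : (ProjSpace n K).affineOpens} (h₀ : V₀ ≤ U) (h₁ : V₁ ≤ U)
    (h₀₁ : V₀₁.1 = V₀.1 ⊓ V₁.1) (hc : ∀ x ∈ U.1, x ∈ C.support → x ∈ V₀.1 ∨ x ∈ V₁.1)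
    (z₀ : Γ(ProjSpace n K, V₀) ⧸ C.ideal V₀) (z₁ : Γ(ProjSpace n K, V₁) ⧸ C.ideal V₁)
    (hz : restrictStructure C (show V₀₁ ≤ V₀ from h₀₁.trans_le inf_le_left) z₀ =
      restrictStructure C (show V₀₁ ≤ V₁ from h₀₁.trans_le inf_le_right) z₁) :
    ∃ z, restrictStructure C h₀ z = z₀ ∧ restrictStructure C h₁ z = z₁ := by
  obtain ⟨s₀, rfl⟩ := Ideal.Quotient.mk_surjective z₀
  obtain ⟨s₁, rfl⟩ := Ideal.Quotient.mk_surjective z₁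
  rw [restrictStructure_mk, restrictStructure_mk, Ideal.Quotient.eq, ← toSub_eq_zero_iff, map_sub,
    sub_eq_zero, toSub_res, toSub_res] at hz
  let W : Bool → (ProjSpace n K).affineOpens := fun i => match i with
    | true => V₀
    | false => V₁
  have hW : ∀ i, W i ≤ U := fun i => match i with
    | true => h₀
    | false => h₁
  let t : ∀ i, Γ(C.subscheme, C.subschemeι ⁻¹ᵁ (W i).1) := fun i => match i with
    | true => toSub C V₀ s₀
    | false => toSub C V₁ s₁
  have hle : C.subschemeι ⁻¹ᵁ V₀.1 ⊓ C.subschemeι ⁻¹ᵁ V₁.1 ≤ C.subschemeι ⁻¹ᵁ V₀₁.1 := by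
    rw [h₀₁]; exact le_rfl
  have comp : ∀ {A B D : C.subscheme.Opens} (i : A ≤ B) (j : B ≤ D) (x : Γ(C.subscheme, D)),
      (C.subscheme.presheaf.map (homOfLE i).op).hom
        ((C.subscheme.presheaf.map (homOfLE j).op).hom x) =
      (C.subscheme.presheaf.map (homOfLE (i.trans j)).op).hom x := by
    intro A B D i j x
    rw [← RingHom.comp_apply, ← CommRingCat.hom_comp, ← Functor.map_comp]
    rfl
  have key := congrArg (C.subscheme.presheaf.map (homOfLE hle).op).hom hz
  have key' := congrArg (C.subscheme.presheaf.map
    (homOfLE (inf_comm (C.subschemeι ⁻¹ᵁ V₁.1) (C.subschemeι ⁻¹ᵁ V₀.1)).le).op).hom key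
  rw [comp, comp] at key
  rw [comp, comp, comp, comp] at key'
  obtain ⟨y, hy, -⟩ := C.subscheme.sheaf.existsUnique_gluing'
    (fun i => C.subschemeι ⁻¹ᵁ (W i).1) (C.subschemeι ⁻¹ᵁ U.1)
    (fun i => homOfLE ((TopologicalSpace.Opens.map _).monotone (hW i)))
    (preimage_le_iSup C fun x hx hs => (hc x hx hs).elim (fun h => ⟨true, h⟩) fun h => ⟨false, h⟩)
    t (by
      rintro (_ | _) (_ | _)
      · rfl
      · exact key'.symm
      · exact key
      · rfl)
  obtain ⟨s, rfl⟩ := C.subschemeι_app_surjective U y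
  refine ⟨Ideal.Quotient.mk _ s, ?_, ?_⟩
  · rw [restrictStructure_mk, Ideal.Quotient.eq, ← toSub_eq_zero_iff, map_sub, sub_eq_zero,
      toSub_res]
    exact hy true
  · rw [restrictStructure_mk, Ideal.Quotient.eq, ← toSub_eq_zero_iff, map_sub, sub_eq_zero,
      toSub_res]
    exact hy false

/-- The restriction map is induced by the identity of `ℙⁿ`, which is a flat morphism. -/
theorem res_flat {U V : (ProjSpace n K).affineOpens} (h : U ≤ V) : (res h).Flat := by
  have := Scheme.Hom.flat_appLE (𝟙 (ProjSpace n K)) V.2 U.2 h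
  have e : Scheme.Hom.appLE (𝟙 (ProjSpace n K)) V.1 U.1 h =
      (ProjSpace n K).presheaf.map (homOfLE (show U.1 ≤ V.1 from h)).op :=
    Category.id_comp _
  rwa [e] at this

/-- Homomorphisms from the ideal of `C` to its structure ring, over an affine open subset. -/
abbrev IdealHom (U : (ProjSpace n K).affineOpens) : Type u :=
  C.ideal U →ₗ[Γ(ProjSpace n K, U)] (Γ(ProjSpace n K, U) ⧸ C.ideal U)

/-- A homomorphism on a smaller open subset extends one on a larger open subset. -/
def Extends {U V : (ProjSpace n K).affineOpens} (h : U ≤ V) (φ : IdealHom C V)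
    (ψ : IdealHom C U) : Prop :=
  ∀ s, ψ (restrictIdeal C h s) = restrictStructure C h (φ s)

theorem restrictStructure_smul' {U V : (ProjSpace n K).affineOpens} (h : U ≤ V)
    (a : Γ(ProjSpace n K, V)) (z : Γ(ProjSpace n K, V) ⧸ C.ideal V) :
    restrictStructure C h (a • z) = res h a • restrictStructure C h z := by
  obtain ⟨z, rfl⟩ := Ideal.Quotient.mk_surjective z
  have h1 : a • Ideal.Quotient.mk (C.ideal V) z = Ideal.Quotient.mk _ (a * z) := rfl
  rw [h1, restrictStructure_mk, restrictStructure_mk, map_mul]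
  rfl

/-- The ideal over `U` is the extension of the ideal over `V`, and restriction is flat, so
`exists_extend_of_flat` applies. -/
theorem exists_extends {U V : (ProjSpace n K).affineOpens} (h : U ≤ V) (φ : IdealHom C V) :
    ∃ ψ, Extends C h φ ψ := by
  let _ : Algebra Γ(ProjSpace n K, V) Γ(ProjSpace n K, U) := (res h).toAlgebra
  have : Module.Flat Γ(ProjSpace n K, V) Γ(ProjSpace n K, U) := res_flat h
  let φ' : C.ideal V →ₗ[Γ(ProjSpace n K, V)] (Γ(ProjSpace n K, U) ⧸ C.ideal U) :=
    { toFun s := restrictStructure C h (φ s)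
      map_add' s t := by rw [map_add, map_add]
      map_smul' a s := by
        rw [map_smul, restrictStructure_smul', RingHom.id_apply]
        obtain ⟨z, hz⟩ := Ideal.Quotient.mk_surjective (restrictStructure C h (φ s))
        rw [← hz]
        rfl }
  obtain ⟨ψ, hψ⟩ := exists_extend_of_flat (B := Γ(ProjSpace n K, U)) (C.ideal V) φ'
  have hm : (C.ideal V).map (algebraMap Γ(ProjSpace n K, V) Γ(ProjSpace n K, U)) = C.ideal U :=
    C.map_ideal h
  exact ⟨ψ ∘ₗ (LinearEquiv.ofEq _ _ hm.symm).toLinearMap, fun s => hψ s⟩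

theorem restrictIdeal_add {U V : (ProjSpace n K).affineOpens} (h : U ≤ V) (s t : C.ideal V) :
    restrictIdeal C h (s + t) = restrictIdeal C h s + restrictIdeal C h t :=
  Subtype.ext (map_add _ _ _)

theorem restrictIdeal_smul {U V : (ProjSpace n K).affineOpens} (h : U ≤ V)
    (a : Γ(ProjSpace n K, V)) (s : C.ideal V) :
    restrictIdeal C h (a • s) = res h a • restrictIdeal C h s :=
  Subtype.ext (map_mul _ _ _)

/-- The ideal over `U` is generated by restrictions from `V`, so a linear map is determined by its
values on these. -/
theorem Extends.unique {U V : (ProjSpace n K).affineOpens} {h : U ≤ V} {φ : IdealHom C V}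
    {ψ ψ' : IdealHom C U} (H : Extends C h φ ψ) (H' : Extends C h φ ψ') : ψ = ψ' := by
  have hm : (C.ideal V).map (res h) = C.ideal U := C.map_ideal h
  have key : ∀ s (hs : s ∈ (C.ideal V).map (res h)), ψ ⟨s, hm ▸ hs⟩ = ψ' ⟨s, hm ▸ hs⟩ := by
    intro s hs
    induction hs using Submodule.span_induction with
    | mem x hx =>
      obtain ⟨s, hs, rfl⟩ := hx
      exact (H ⟨s, hs⟩).trans (H' ⟨s, hs⟩).symm
    | zero => exact (map_zero ψ).trans (map_zero ψ').symm
    | add x y hx hy ihx ihy =>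
      have e : (⟨x + y, hm ▸ add_mem hx hy⟩ : C.ideal U) = ⟨x, hm ▸ hx⟩ + ⟨y, hm ▸ hy⟩ := rfl
      rw [e, map_add, map_add, ihx, ihy]
    | smul a x hx ih =>
      have e : (⟨a • x, hm ▸ Submodule.smul_mem _ a hx⟩ : C.ideal U) = a • ⟨x, hm ▸ hx⟩ := rfl
      rw [e, map_smul, map_smul, ih]
  ext1 s
  exact key s.1 (hm.symm ▸ s.2)

theorem Extends.trans {U V W : (ProjSpace n K).affineOpens} {h : U ≤ V} {h' : V ≤ W}
    {φ : IdealHom C W} {ψ : IdealHom C V} {χ : IdealHom C U} (H : Extends C h' φ ψ)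
    (H' : Extends C h ψ χ) : Extends C (h.trans h') φ χ := fun s => by
  rw [← restrictIdeal_comp C h h', H', H, restrictStructure_comp]

theorem Extends.of_trans {U V W : (ProjSpace n K).affineOpens} {h : U ≤ V} {h' : V ≤ W}
    {φ : IdealHom C W} {ψ : IdealHom C V} {χ : IdealHom C U} (H : Extends C h' φ ψ)
    (H' : Extends C (h.trans h') φ χ) : Extends C h ψ χ := by
  obtain ⟨χ', hχ'⟩ := exists_extends C h ψ
  rwa [H'.unique C (H.trans C hχ')]

/-- The intersection of two affine open subsets. -/
noncomputable def infOpens (U V : (ProjSpace n K).affineOpens) : (ProjSpace n K).affineOpens :=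
  ⟨U.1 ⊓ V.1, U.2.inf V.2⟩

theorem infOpens_le_left (U V : (ProjSpace n K).affineOpens) : infOpens U V ≤ U :=
  show U.1 ⊓ V.1 ≤ U.1 from inf_le_left

theorem infOpens_le_right (U V : (ProjSpace n K).affineOpens) : infOpens U V ≤ V :=
  show U.1 ⊓ V.1 ≤ V.1 from inf_le_right

theorem infOpens_mono {U U' : (ProjSpace n K).affineOpens} (h : U ≤ U')
    (V : (ProjSpace n K).affineOpens) : infOpens U V ≤ infOpens U' V :=
  show U.1 ⊓ V.1 ≤ U'.1 ⊓ V.1 from inf_le_inf_right _ h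

/-- The homomorphism on the ideal underlying a local normal section. -/
noncomputable def LocalNormalSections.toIdealHom {U : (ProjSpace n K).affineOpens}
    (φ : LocalNormalSections C U) : IdealHom C U :=
  φ ∘ₗ (C.ideal U).toCotangent

/-- A linear map `I → A/I` kills `I²`. The cotangent module can therefore be replaced by the ideal
itself. -/
theorem exists_toIdealHom_eq {U : (ProjSpace n K).affineOpens} (φ : IdealHom C U) :
    ∃ ψ : LocalNormalSections C U, LocalNormalSections.toIdealHom C ψ = φ := by
  refine ⟨Ideal.Cotangent.lift φ fun x y => ?_, Ideal.Cotangent.lift_comp_toCotangent _ _⟩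
  have : x * y = x.1 • y := rfl
  rw [this, map_smul]
  obtain ⟨z, hz⟩ := Ideal.Quotient.mk_surjective (φ y)
  rw [← hz]
  exact Ideal.Quotient.eq_zero_iff_mem.2 (Ideal.mul_mem_right z _ x.2)

theorem LocalNormalSections.eq_zero_of_toIdealHom {U : (ProjSpace n K).affineOpens}
    {φ : LocalNormalSections C U} (h : LocalNormalSections.toIdealHom C φ = 0) : φ = 0 := by
  ext1 x
  obtain ⟨s, rfl⟩ := (C.ideal U).toCotangent_surjective x
  exact congrArg (· s) h

theorem mem_normalSections_iff (φ : ∀ U : (ProjSpace n K).affineOpens, LocalNormalSections C U) :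
    φ ∈ normalSections C ↔ ∀ (U V : (ProjSpace n K).affineOpens) (h : U ≤ V),
      Extends C h (LocalNormalSections.toIdealHom C (φ V))
        (LocalNormalSections.toIdealHom C (φ U)) := Iff.rfl

variable {C} {U₀ U₁ U₀₁ : (ProjSpace n K).affineOpens}

/-- A section of the normal sheaf is determined by its restrictions to an open cover of `C`. -/
theorem normalSections_eq_zero (hc : ∀ x ∈ C.support, x ∈ U₀.1 ∨ x ∈ U₁.1)
    {φ : ∀ U, LocalNormalSections C U} (hφ : φ ∈ normalSections C)
    (h₀ : LocalNormalSections.toIdealHom C (φ U₀) = 0)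
    (h₁ : LocalNormalSections.toIdealHom C (φ U₁) = 0) : φ = 0 := by
  rw [mem_normalSections_iff] at hφ
  have hle : ∀ (U V : (ProjSpace n K).affineOpens) (h : U ≤ V),
      LocalNormalSections.toIdealHom C (φ V) = 0 →
      LocalNormalSections.toIdealHom C (φ U) = 0 := by
    intro U V h hV
    have H := hφ U V h
    rw [hV] at H
    refine H.unique C fun s => ?_
    rw [LinearMap.zero_apply, LinearMap.zero_apply, map_zero]
  funext U
  apply LocalNormalSections.eq_zero_of_toIdealHom
  ext1 s
  let V : ULift.{u} Bool → (ProjSpace n K).affineOpens := fun i => match i with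
    | ⟨true⟩ => infOpens U U₀
    | ⟨false⟩ => infOpens U U₁
  have hV : ∀ i, V i ≤ U := fun i => match i with
    | ⟨true⟩ => infOpens_le_left U U₀
    | ⟨false⟩ => infOpens_le_left U U₁
  have hV0 : ∀ i, LocalNormalSections.toIdealHom C (φ (V i)) = 0 := fun i => match i with
    | ⟨true⟩ => hle _ _ (infOpens_le_right U U₀) h₀
    | ⟨false⟩ => hle _ _ (infOpens_le_right U U₁) h₁
  refine eq_of_restrictStructure C hV (fun x hx hs => (hc x hs).elim
    (fun h => ⟨⟨true⟩, hx, h⟩) fun h => ⟨⟨false⟩, hx, h⟩) fun i => ?_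
  rw [← hφ _ _ (hV i), hV0, LinearMap.zero_apply, LinearMap.zero_apply, map_zero]

/-- Local normal sections over an open cover of `C` that agree on the overlap glue. -/
theorem exists_normalSections (h₀₁ : U₀₁.1 = U₀.1 ⊓ U₁.1)
    (hc : ∀ x ∈ C.support, x ∈ U₀.1 ∨ x ∈ U₁.1)
    {φ₀ : IdealHom C U₀} {φ₁ : IdealHom C U₁} {φ₀₁ : IdealHom C U₀₁}
    (H₀ : Extends C (show U₀₁ ≤ U₀ from h₀₁.trans_le inf_le_left) φ₀ φ₀₁)
    (H₁ : Extends C (show U₀₁ ≤ U₁ from h₀₁.trans_le inf_le_right) φ₁ φ₀₁) :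
    ∃ φ ∈ normalSections C, LocalNormalSections.toIdealHom C (φ U₀) = φ₀ ∧
      LocalNormalSections.toIdealHom C (φ U₁) = φ₁ := by
  have hle₀ : U₀₁ ≤ U₀ := h₀₁.trans_le inf_le_left
  have hle₁ : U₀₁ ≤ U₁ := h₀₁.trans_le inf_le_right
  choose ψ₀ hψ₀ using fun (V : (ProjSpace n K).affineOpens) (h : V ≤ U₀) => exists_extends C h φ₀
  choose ψ₁ hψ₁ using fun (V : (ProjSpace n K).affineOpens) (h : V ≤ U₁) => exists_extends C h φ₁
  -- Such a `V` lies in the overlap, where both maps extend the same `φ₀₁`.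
  have hψ (V : (ProjSpace n K).affineOpens) (h : V ≤ U₀) (h' : V ≤ U₁) : ψ₀ V h = ψ₁ V h' := by
    have hV : V ≤ U₀₁ := show V.1 ≤ U₀₁.1 by rw [h₀₁]; exact le_inf h h'
    obtain ⟨χ, hχ⟩ := exists_extends C hV φ₀₁
    rw [(hψ₀ V h).unique C (H₀.trans C hχ), (hψ₁ V h').unique C (H₁.trans C hχ)]
  have hcU (U : (ProjSpace n K).affineOpens) : ∀ x ∈ U.1, x ∈ C.support →
      x ∈ (infOpens U U₀).1 ∨ x ∈ (infOpens U U₁).1 := fun x hx hs =>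
    (hc x hs).imp (fun h => ⟨hx, h⟩) fun h => ⟨hx, h⟩
  have huniq (U : (ProjSpace n K).affineOpens) {z z' : Γ(ProjSpace n K, U) ⧸ C.ideal U}
      (h0 : restrictStructure C (infOpens_le_left U U₀) z =
        restrictStructure C (infOpens_le_left U U₀) z')
      (h1 : restrictStructure C (infOpens_le_left U U₁) z =
        restrictStructure C (infOpens_le_left U U₁) z') : z = z' := by
    let V : ULift.{u} Bool → (ProjSpace n K).affineOpens := fun i => match i with
      | ⟨true⟩ => infOpens U U₀
      | ⟨false⟩ => infOpens U U₁
    have hV : ∀ i, V i ≤ U := fun i => match i with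
      | ⟨true⟩ => infOpens_le_left U U₀
      | ⟨false⟩ => infOpens_le_left U U₁
    refine eq_of_restrictStructure C hV (fun x hx hs => (hcU U x hx hs).elim
      (fun h => ⟨⟨true⟩, h⟩) fun h => ⟨⟨false⟩, h⟩) fun i => ?_
    match i with
    | ⟨true⟩ => exact h0
    | ⟨false⟩ => exact h1
  -- The value at `s` over `U` is glued from the values over `U ∩ U₀` and `U ∩ U₁`, which agree on
  -- the common intersection by `hψ`. Its uniqueness, `huniq`, gives linearity and compatibility
  -- with restriction.
  have hex (U : (ProjSpace n K).affineOpens) (s : C.ideal U) : ∃ z,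
      restrictStructure C (infOpens_le_left U U₀) z =
        ψ₀ _ (infOpens_le_right U U₀) (restrictIdeal C (infOpens_le_left U U₀) s) ∧
      restrictStructure C (infOpens_le_left U U₁) z =
        ψ₁ _ (infOpens_le_right U U₁) (restrictIdeal C (infOpens_le_left U U₁) s) := by
    have hl : infOpens (infOpens U U₀) (infOpens U U₁) ≤ infOpens U U₀ := infOpens_le_left _ _
    have hr : infOpens (infOpens U U₀) (infOpens U U₁) ≤ infOpens U U₁ := infOpens_le_right _ _
    refine exists_glue C (V₀₁ := infOpens (infOpens U U₀) (infOpens U U₁)) _ _ rfl (hcU U) _ _ ?_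
    have e₀ := Extends.of_trans C (h := hl) (hψ₀ _ (infOpens_le_right U U₀))
      (hψ₀ _ (hl.trans (infOpens_le_right U U₀)))
    have e₁ := Extends.of_trans C (h := hr) (hψ₁ _ (infOpens_le_right U U₁))
      (hψ₁ _ (hr.trans (infOpens_le_right U U₁)))
    have e₀' := e₀ (restrictIdeal C (infOpens_le_left U U₀) s)
    have e₁' := e₁ (restrictIdeal C (infOpens_le_left U U₁) s)
    rw [restrictIdeal_comp] at e₀' e₁'
    rw [← e₀', ← e₁', hψ _ (hl.trans (infOpens_le_right U U₀)) (hr.trans (infOpens_le_right U U₁))]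
  choose z hz₀ hz₁ using hex
  let χ (U : (ProjSpace n K).affineOpens) : IdealHom C U :=
    { toFun := z U
      map_add' s t := by
        apply huniq U
        · rw [map_add, hz₀, hz₀, hz₀, restrictIdeal_add, map_add]
        · rw [map_add, hz₁, hz₁, hz₁, restrictIdeal_add, map_add]
      map_smul' a s := by
        apply huniq U
        · rw [RingHom.id_apply, restrictStructure_smul', hz₀, hz₀, restrictIdeal_smul, map_smul]
        · rw [RingHom.id_apply, restrictStructure_smul', hz₁, hz₁, restrictIdeal_smul, map_smul] }
  have hχ (U V : (ProjSpace n K).affineOpens) (h : U ≤ V) : Extends C h (χ V) (χ U) := by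
    intro s
    have e₀ := Extends.of_trans C (h := infOpens_mono h U₀) (hψ₀ _ (infOpens_le_right V U₀))
      (hψ₀ _ (infOpens_le_right U U₀)) (restrictIdeal C (infOpens_le_left V U₀) s)
    have e₁ := Extends.of_trans C (h := infOpens_mono h U₁) (hψ₁ _ (infOpens_le_right V U₁))
      (hψ₁ _ (infOpens_le_right U U₁)) (restrictIdeal C (infOpens_le_left V U₁) s)
    rw [restrictIdeal_comp] at e₀ e₁
    apply huniq U
    · refine (hz₀ U _).trans ?_
      rw [restrictIdeal_comp, e₀, ← hz₀ V, restrictStructure_comp, restrictStructure_comp]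
      rfl
    · refine (hz₁ U _).trans ?_
      rw [restrictIdeal_comp, e₁, ← hz₁ V, restrictStructure_comp, restrictStructure_comp]
      rfl
  choose φ hφ using fun U => exists_toIdealHom_eq C (χ U)
  refine ⟨φ, (mem_normalSections_iff C φ).2 fun U V h => by rw [hφ, hφ]; exact hχ U V h, ?_, ?_⟩
  · rw [hφ]
    ext1 s
    apply huniq U₀
    · refine (hz₀ U₀ s).trans (hψ₀ _ _ s)
    · refine (hz₁ U₀ s).trans ?_
      rw [← hψ _ (infOpens_le_left U₀ U₁)]
      exact hψ₀ _ _ s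
  · rw [hφ]
    ext1 s
    apply huniq U₁
    · refine (hz₀ U₁ s).trans ?_
      rw [hψ _ _ (infOpens_le_left U₁ U₀)]
      exact hψ₁ _ _ s
    · refine (hz₁ U₁ s).trans (hψ₁ _ _ s)

end Gluing

end ProjCurve

/-! ### Homogeneous fractions as sections -/

namespace ProjCurve

section Fractions

open HomogeneousLocalization

variable {n : ℕ} {K : Type u} [Field K]

/-- The constants in a homogeneous localization of the polynomial ring. -/
noncomputable def awayC (f : MvPolynomial (Fin (n + 1)) K) : K →+* Away (grading n K) f :=
  (fromZeroRingHom (grading n K) _).comp (algebraMap K (grading n K 0))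

/-- Both sides are pullbacks of `c` along `D₊(f) ⟶ Spec K`. This matches the scalars that define the
`K`-structure on sections with the constants of the chart ring. -/
theorem awayToSection_awayC {m : ℕ} {f : MvPolynomial (Fin (n + 1)) K} (hf : f ∈ grading n K m)
    (hm : 0 < m) (c : K) : (Proj.awayToSection (grading n K) f).hom (awayC f c) =
      scalars n K (Proj.basicOpen (grading n K) f) c := by
  have h1 : (Proj.basicOpen (grading n K) f).ι ≫ structureMorphism n K =
      Proj.basicOpenToSpec (grading n K) f ≫ Spec.map (CommRingCat.ofHom (awayC f)) := by
    have := Proj.awayι_toSpecZero (grading n K) f hf hm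
    rw [Proj.awayι, Category.assoc, Iso.inv_comp_eq, Proj.basicOpenIsoSpec_hom] at this
    rw [structureMorphism, reassoc_of% this, ← Spec.map_comp]
    rfl
  have h2 := congrArg Scheme.Hom.appTop h1
  rw [Scheme.Hom.comp_appTop, Scheme.Hom.comp_appTop] at h2
  have h3 : (Proj.basicOpenToSpec (grading n K) f).appTop = _ :=
    Proj.basicOpenToSpec_app_top (grading n K) f
  rw [h3] at h2
  have h4 := congrArg (fun t => (Scheme.ΓSpecIso (.of K)).inv ≫ t ≫
    (Proj.basicOpen (grading n K) f).topIso.hom) h2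
  simp only [Category.assoc, Iso.inv_hom_id, Category.comp_id, Scheme.ΓSpecIso_naturality_assoc,
    Iso.inv_hom_id_assoc] at h4
  have h5 : (Proj.basicOpen (grading n K) f).ι.appTop ≫
      (Proj.basicOpen (grading n K) f).topIso.hom = (ProjSpace n K).presheaf.map
        (homOfLE (le_top : Proj.basicOpen (grading n K) f ≤ ⊤)).op := by
    exact ((ProjSpace n K).presheaf.map_comp _ _).symm
  rw [h5] at h4
  exact (congrArg (fun t => t.hom c) h4).symm

/-- The affine open set `D₊(f)`, for a form `f` of positive degree. -/
noncomputable def nonvanishing {m : ℕ} (f : grading n K (m + 1)) : (ProjSpace n K).affineOpens :=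
  ⟨Proj.basicOpen (grading n K) f.1,
    Proj.isAffineOpen_basicOpen (grading n K) f.1 f.2 m.succ_pos⟩

/-- Sections over `D₊(f)` are fractions. -/
noncomputable def awayEquiv {m : ℕ} (f : grading n K (m + 1)) :
    Away (grading n K) f.1 ≃+* Γ(ProjSpace n K, nonvanishing f) :=
  (Proj.basicOpenIsoAway (grading n K) f.1 f.2 m.succ_pos).commRingCatIsoToRingEquiv

/-- The fraction `F / f ^ d`, for a form `F` of degree `d`. -/
noncomputable def awayFrac (f : grading n K 1) {d : ℕ} (F : grading n K d) :
    Away (grading n K) f.1 :=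
  Away.mk (grading n K) f.2 d F.1 (by rw [smul_eq_mul, mul_one]; exact F.2)

/-- The section `F / f ^ d` over `D₊(f)`, for a form `F` of degree `d`. -/
noncomputable def frac (f : grading n K 1) {d : ℕ} (F : grading n K d) :
    Γ(ProjSpace n K, nonvanishing f) := awayEquiv f (awayFrac f F)

/-- The product of two linear forms. -/
noncomputable def mulForm (f g : grading n K 1) : grading n K (1 + 1) :=
  ⟨f.1 * g.1, SetLike.mul_mem_graded f.2 g.2⟩

theorem coe_mulForm (f g : grading n K 1) : (mulForm f g).1 = f.1 * g.1 := rfl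

theorem coe_mulForm' (f g : grading n K 1) : (mulForm f g).1 = g.1 * f.1 := mul_comm _ _

theorem nonvanishing_mulForm (f g : grading n K 1) :
    (nonvanishing (mulForm f g)).1 = (nonvanishing f).1 ⊓ (nonvanishing g).1 :=
  Proj.basicOpen_mul _ _ _

theorem nonvanishing_mulForm_le_left (f g : grading n K 1) :
    nonvanishing (mulForm f g) ≤ nonvanishing f :=
  (nonvanishing_mulForm f g).trans_le inf_le_left

theorem nonvanishing_mulForm_le_right (f g : grading n K 1) :
    nonvanishing (mulForm f g) ≤ nonvanishing g :=
  (nonvanishing_mulForm f g).trans_le inf_le_right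

theorem res_awayEquiv_left (f g : grading n K 1) (x : Away (grading n K) f.1) :
    res (nonvanishing_mulForm_le_left f g) (awayEquiv f x) =
      awayEquiv (mulForm f g) (awayMap (grading n K) g.2 (coe_mulForm f g) x) :=
  (congrArg (fun t => t.hom x) (Proj.awayMap_awayToSection (grading n K) (f := f.1) (g := g.1)
    g.2 (coe_mulForm f g))).symm

theorem res_awayEquiv_right (f g : grading n K 1) (x : Away (grading n K) g.1) :
    res (nonvanishing_mulForm_le_right f g) (awayEquiv g x) =
      awayEquiv (mulForm f g) (awayMap (grading n K) f.2 (coe_mulForm' f g) x) :=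
  (congrArg (fun t => t.hom x) (Proj.awayMap_awayToSection (grading n K) (f := g.1) (g := f.1)
    f.2 (coe_mulForm' f g))).symm

/-- The factor is the transition function of `𝒪(d)`. -/
theorem res_frac (f g : grading n K 1) {d : ℕ} (F : grading n K d) :
    res (nonvanishing_mulForm_le_left f g) (frac f F) =
      res (nonvanishing_mulForm_le_left f g) (frac f g) ^ d *
        res (nonvanishing_mulForm_le_right f g) (frac g F) := by
  rw [frac, frac, frac, res_awayEquiv_left, res_awayEquiv_left, res_awayEquiv_right]
  refine Eq.trans ?_ ((map_mul (awayEquiv (mulForm f g)) _ _).trans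
    (congrArg (· * _) (map_pow (awayEquiv (mulForm f g)) _ _)))
  congr 1
  apply HomogeneousLocalization.val_injective
  rw [HomogeneousLocalization.val_mul, HomogeneousLocalization.val_pow]
  simp only [awayFrac, awayMap_mk, Away.val_mk, Localization.mk_pow, Localization.mk_mul]
  rw [Localization.mk_eq_mk_iff, Localization.r_iff_exists]
  refine ⟨1, ?_⟩
  change 1 * (((f.1 * g.1) ^ 1) ^ d * (f.1 * g.1) ^ d * (F.1 * g.1 ^ d)) =
    1 * ((f.1 * g.1) ^ d * ((g.1 * g.1 ^ 1) ^ d * (F.1 * f.1 ^ d)))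
  ring

end Fractions

end ProjCurve

/-! ### Affine coordinates from a basis of linear forms -/

namespace ProjCurve

section Charts

open HomogeneousLocalization

variable {n : ℕ} {K : Type u} [Field K] {ι : Type}

/-- The variables as linear forms. -/
noncomputable def varForm (n : ℕ) (K : Type u) [Field K] (i : Fin (n + 1)) : grading n K 1 :=
  ⟨MvPolynomial.X i, MvPolynomial.isHomogeneous_X K i⟩

/-- The homomorphism from the polynomial ring with given values on a basis of linear forms. -/
noncomputable def evalForms {σ R : Type*} [CommRing R] [Algebra K R]
    (b : Module.Basis σ K (grading n K 1)) (w : σ → R) :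
    MvPolynomial (Fin (n + 1)) K →ₐ[K] R :=
  MvPolynomial.aeval fun i => b.constr K w (varForm n K i)

theorem evalForms_coe {σ R : Type*} [CommRing R] [Algebra K R]
    (b : Module.Basis σ K (grading n K 1)) (w : σ → R) (F : grading n K 1) :
    evalForms b w F.1 = b.constr K w F := by
  have h : ∀ G (hG : G ∈ Submodule.span K (Set.range MvPolynomial.X)), evalForms b w G =
      b.constr K w ⟨G, MvPolynomial.homogeneousSubmodule_one_eq_span_X.ge hG⟩ := by
    intro G hG
    induction hG using Submodule.span_induction with
    | mem x hx =>
      obtain ⟨i, rfl⟩ := hx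
      exact MvPolynomial.aeval_X _ _
    | zero => exact (map_zero _).trans (map_zero _).symm
    | add x y _ _ hx hy => rw [map_add, hx, hy, ← map_add]; rfl
    | smul a x _ hx => rw [map_smul, hx, ← map_smul]; rfl
  exact h F.1 (MvPolynomial.homogeneousSubmodule_one_eq_span_X.le F.2)

theorem evalForms_basis {σ R : Type*} [CommRing R] [Algebra K R]
    (b : Module.Basis σ K (grading n K 1)) (w : σ → R) (s : σ) :
    evalForms b w (b s).1 = w s := by
  rw [evalForms_coe, b.constr_basis]

/-- Homomorphisms that are proportional on a basis of linear forms are proportional on forms. -/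
theorem map_form_eq {σ R : Type*} [CommRing R] (b : Module.Basis σ K (grading n K 1))
    {φ ψ : MvPolynomial (Fin (n + 1)) K →+* R} {t : R}
    (hC : ∀ c, φ (MvPolynomial.C c) = ψ (MvPolynomial.C c))
    (hb : ∀ s, φ (b s).1 = t * ψ (b s).1) {d : ℕ} (F : grading n K d) :
    φ F.1 = t ^ d * ψ F.1 := by
  have h1 (F : grading n K 1) : φ F.1 = t * ψ F.1 := by
    have hF := b.mem_span F
    induction hF using Submodule.span_induction with
    | mem x hx =>
      obtain ⟨s, rfl⟩ := hx
      exact hb s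
    | zero => simp
    | add x y _ _ hx hy => rw [Submodule.coe_add, map_add, map_add, hx, hy, mul_add]
    | smul a x _ hx =>
      rw [Submodule.coe_smul, MvPolynomial.smul_eq_C_mul, map_mul, map_mul, hx, hC]
      ring
  have hm (e : Fin (n + 1) →₀ ℕ) (c : K) : φ (MvPolynomial.monomial e c) =
      t ^ e.degree * ψ (MvPolynomial.monomial e c) := by
    rw [MvPolynomial.monomial_eq, map_mul, map_mul, hC, Finsupp.prod, map_prod, map_prod,
      Finsupp.degree_apply, ← Finset.prod_pow_eq_pow_sum, mul_left_comm, ← Finset.prod_mul_distrib]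
    congr 1
    refine Finset.prod_congr rfl fun i _ => ?_
    rw [map_pow, map_pow, ← mul_pow]
    congr 1
    exact h1 (varForm n K i)
  rw [F.1.as_sum, map_sum, map_sum, Finset.mul_sum]
  refine Finset.sum_congr rfl fun e he => ?_
  have h := F.2 (MvPolynomial.mem_support_iff.1 he)
  have h' : e.degree = d := (DFunLike.congr_fun Finsupp.degree_eq_weight_one e).trans h
  rw [hm, h']

variable (b : Module.Basis (Fin 2 ⊕ ι) K (grading n K 1))

/-- Dehomogenization with respect to a basis of linear forms. -/
noncomputable def dehom : MvPolynomial (Fin (n + 1)) K →ₐ[K] MvPolynomial ι (Polynomial K) :=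
  evalForms b (Sum.elim ![1, MvPolynomial.C Polynomial.X] MvPolynomial.X)

theorem dehom_zero : dehom b (b (.inl 0)).1 = 1 := evalForms_basis _ _ _

theorem dehom_one : dehom b (b (.inl 1)).1 = MvPolynomial.C Polynomial.X := evalForms_basis _ _ _

theorem dehom_inr (j : ι) : dehom b (b (.inr j)).1 = MvPolynomial.X j := evalForms_basis _ _ _

/-- The inverse of dehomogenization. -/
noncomputable def toAway :
    MvPolynomial ι (Polynomial K) →+* Away (grading n K) (b (.inl 0)).1 :=
  MvPolynomial.eval₂Hom (Polynomial.eval₂RingHom (awayC (b (.inl 0)).1)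
    (awayFrac (b (.inl 0)) (b (.inl 1)))) fun j => awayFrac (b (.inl 0)) (b (.inr j))

theorem val_awayC (f : MvPolynomial (Fin (n + 1)) K) (c : K) :
    (awayC f c).val = algebraMap (MvPolynomial (Fin (n + 1)) K) _ (MvPolynomial.C c) := rfl

theorem val_awayFrac (f : grading n K 1) {d : ℕ} (F : grading n K d) :
    (awayFrac f F).val = Localization.mk F.1 ⟨f.1 ^ d, (Submonoid.mem_powers_iff _ _).2 ⟨d, rfl⟩⟩ := rfl

theorem toAway_dehom {d : ℕ} (F : grading n K d) :
    toAway b (dehom b F.1) = awayFrac (b (.inl 0)) F := by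
  apply HomogeneousLocalization.val_injective
  let v := algebraMap (Away (grading n K) (b (.inl 0)).1) (Localization.Away (b (.inl 0)).1)
  -- Here `t = 1 / b₀`. On linear forms, dehomogenization is multiplication by `t`, so `map_form_eq`
  -- turns forms of degree `d` into multiples of `t ^ d`.
  let t : Localization.Away (b (.inl 0)).1 := Localization.mk 1 ⟨(b (.inl 0)).1, 1, pow_one _⟩
  have ht : ∀ F : grading n K 1, (awayFrac (b (.inl 0)) F).val =
      t * algebraMap _ (Localization.Away (b (.inl 0)).1) F.1 := by
    intro F
    rw [val_awayFrac, ← Localization.mk_one_eq_algebraMap, Localization.mk_mul]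
    congr 1
    · rw [one_mul]
    · apply Subtype.ext
      simp
  have := map_form_eq b (φ := (v.comp (toAway b)).comp (dehom b).toRingHom)
    (ψ := algebraMap _ (Localization.Away (b (.inl 0)).1)) (t := t) ?_ ?_ F
  · refine this.trans ?_
    rw [val_awayFrac, ← Localization.mk_one_eq_algebraMap, Localization.mk_pow,
      Localization.mk_mul]
    congr 1
    · rw [one_pow, one_mul]
    · apply Subtype.ext
      simp
  · intro c
    change v (toAway b (dehom b (algebraMap _ _ c))) = _
    rw [AlgHom.commutes]
    change v (toAway b (MvPolynomial.C (Polynomial.C c))) = _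
    rw [toAway, MvPolynomial.coe_eval₂Hom, MvPolynomial.eval₂_C, Polynomial.coe_eval₂RingHom,
      Polynomial.eval₂_C]
    rfl
  · rintro (i | j)
    · fin_cases i
      · change v (toAway b (dehom b (b (.inl 0)).1)) = _
        rw [dehom_zero, map_one, map_one]
        change 1 = t * algebraMap _ (Localization.Away (b (.inl 0)).1) (b (.inl 0)).1
        rw [← Localization.mk_one_eq_algebraMap, Localization.mk_mul, one_mul, mul_one]
        exact (Localization.mk_self ⟨(b (.inl 0)).1, _⟩).symm
      · change v (toAway b (dehom b (b (.inl 1)).1)) = _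
        rw [dehom_one, toAway, MvPolynomial.coe_eval₂Hom, MvPolynomial.eval₂_C,
          Polynomial.coe_eval₂RingHom, Polynomial.eval₂_X]
        exact ht _
    · change v (toAway b (dehom b (b (.inr j)).1)) = _
      rw [dehom_inr, toAway, MvPolynomial.coe_eval₂Hom, MvPolynomial.eval₂_X]
      exact ht _

/-- Dehomogenization of fractions. -/
noncomputable def fromAway :
    Away (grading n K) (b (.inl 0)).1 →+* MvPolynomial ι (Polynomial K) :=
  (IsLocalization.Away.lift (S := Localization.Away (b (.inl 0)).1) (b (.inl 0)).1
    (g := (dehom b).toRingHom) (by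
      change IsUnit (dehom b (b (.inl 0)).1)
      rw [dehom_zero]
      exact isUnit_one)).comp
    (algebraMap (Away (grading n K) (b (.inl 0)).1) (Localization.Away (b (.inl 0)).1))

theorem fromAway_awayFrac {d : ℕ} (F : grading n K d) :
    fromAway b (awayFrac (b (.inl 0)) F) = dehom b F.1 := by
  change IsLocalization.lift (S := Localization.Away (b (.inl 0)).1) _
    (awayFrac (b (.inl 0)) F).val = _
  rw [val_awayFrac, Localization.mk_eq_mk', IsLocalization.lift_mk'_spec]
  change dehom b F.1 = dehom b ((b (.inl 0)).1 ^ d) * dehom b F.1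
  rw [map_pow, dehom_zero, one_pow, one_mul]

theorem exists_awayFrac (f : grading n K 1) (x : Away (grading n K) f.1) :
    ∃ (d : ℕ) (F : grading n K d), x = awayFrac f F := by
  obtain ⟨d, F, hF, rfl⟩ := Away.mk_surjective (grading n K) f.2 x
  exact ⟨d, ⟨F, by simpa using hF⟩, rfl⟩

theorem toAway_C (c : K) :
    toAway b (MvPolynomial.C (Polynomial.C c)) = awayC (b (.inl 0)).1 c := by
  rw [toAway, MvPolynomial.coe_eval₂Hom, MvPolynomial.eval₂_C, Polynomial.coe_eval₂RingHom,
    Polynomial.eval₂_C]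

theorem toAway_C_X : toAway b (MvPolynomial.C Polynomial.X) =
    awayFrac (b (.inl 0)) (b (.inl 1)) := by
  rw [← dehom_one b, toAway_dehom]

theorem toAway_X (j : ι) : toAway b (MvPolynomial.X j) =
    awayFrac (b (.inl 0)) (b (.inr j)) := by
  rw [← dehom_inr b, toAway_dehom]

theorem awayC_eq (f : grading n K 1) (c : K) : awayC f.1 c =
    awayFrac f (⟨MvPolynomial.C c, MvPolynomial.isHomogeneous_C _ c⟩ : grading n K 0) := by
  apply HomogeneousLocalization.val_injective
  rw [val_awayC, val_awayFrac, ← Localization.mk_one_eq_algebraMap]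
  congr 1

/-- Functions on the chart `D₊(b₀)` are polynomials. -/
noncomputable def awayPolyEquiv :
    MvPolynomial ι (Polynomial K) ≃+* Away (grading n K) (b (.inl 0)).1 :=
  RingEquiv.ofRingHom (toAway b) (fromAway b)
    (by
      ext x
      obtain ⟨d, F, rfl⟩ := exists_awayFrac _ x
      rw [RingHom.comp_apply, fromAway_awayFrac, toAway_dehom, RingHom.id_apply])
    (by
      apply MvPolynomial.ringHom_ext
      · intro r
        have : ((fromAway b).comp (toAway b)).comp MvPolynomial.C =
            (MvPolynomial.C (σ := ι) : Polynomial K →+* _) := by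
          apply Polynomial.ringHom_ext
          · intro c
            change fromAway b (toAway b (MvPolynomial.C (Polynomial.C c))) = _
            rw [toAway_C, awayC_eq, fromAway_awayFrac]
            exact (dehom b).commutes c
          · change fromAway b (toAway b (MvPolynomial.C Polynomial.X)) = _
            rw [toAway_C_X, fromAway_awayFrac, dehom_one]
        exact congrArg (fun t => t r) this
      · intro j
        rw [RingHom.comp_apply, toAway_X, fromAway_awayFrac, dehom_inr, RingHom.id_apply])

/-- Functions on the chart `D₊(b₀)` are polynomials. -/
noncomputable def chartEquiv :
    MvPolynomial ι (Polynomial K) ≃+* Γ(ProjSpace n K, nonvanishing (b (.inl 0))) :=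
  (awayPolyEquiv b).trans (awayEquiv (b (.inl 0)))

theorem chartEquiv_dehom {d : ℕ} (F : grading n K d) :
    chartEquiv b (dehom b F.1) = frac (b (.inl 0)) F :=
  congrArg (awayEquiv (b (.inl 0))) (toAway_dehom b F)

theorem chartEquiv_C (c : K) : chartEquiv b (MvPolynomial.C (Polynomial.C c)) =
    scalars n K (nonvanishing (b (.inl 0))) c :=
  (congrArg (awayEquiv (b (.inl 0))) (toAway_C b c)).trans
    (awayToSection_awayC (b (.inl 0)).2 one_pos c)

theorem chartEquiv_C_X : chartEquiv b (MvPolynomial.C Polynomial.X) =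
    frac (b (.inl 0)) (b (.inl 1)) := by
  rw [← dehom_one b, chartEquiv_dehom]

theorem chartEquiv_X (j : ι) : chartEquiv b (MvPolynomial.X j) =
    frac (b (.inl 0)) (b (.inr j)) := by
  rw [← dehom_inr b, chartEquiv_dehom]

end Charts

end ProjCurve

/-! ### The overlap of the two charts -/

namespace ProjCurve

section Overlap

open HomogeneousLocalization

variable {n : ℕ} {K : Type u} [Field K] {ι : Type}

/-- The bases `b` and `b'` differ by exchanging the first two forms. -/
structure IsSwap (b b' : Module.Basis (Fin 2 ⊕ ι) K (grading n K 1)) : Prop where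
  zero : b' (.inl 0) = b (.inl 1)
  one : b' (.inl 1) = b (.inl 0)
  inr : ∀ j, b' (.inr j) = b (.inr j)

theorem exists_isSwap (b : Module.Basis (Fin 2 ⊕ ι) K (grading n K 1)) : ∃ b', IsSwap b b' :=
  ⟨b.reindex (Equiv.sumCongr (Equiv.swap 0 1) (Equiv.refl ι)), by simp, by simp, by simp⟩

theorem coordMap_iotaZero_one : (coordMap (iotaZero K) 1 : MvPolynomial ι (Polynomial K) →+* _) =
    MvPolynomial.map (algebraMap (Polynomial K) (LaurentPolynomial K)) := by
  apply MvPolynomial.ringHom_ext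
  · intro r
    rw [coordMap_C, MvPolynomial.map_C]
    rfl
  · intro j
    rw [coordMap_X, MvPolynomial.map_X, map_one, one_mul]

theorem isLocalization_coordMap :
    @IsLocalization.Away (MvPolynomial ι (Polynomial K)) _ (MvPolynomial.C Polynomial.X)
      (MvPolynomial ι (LaurentPolynomial K)) _ (coordMap (iotaZero K) 1).toAlgebra := by
  have h := MvPolynomial.isLocalization (σ := ι) (Submonoid.powers (Polynomial.X : Polynomial K))
    (LaurentPolynomial K)
  rw [coordMap_iotaZero_one]
  rw [Submonoid.map_powers] at h
  exact h

variable (b b' : Module.Basis (Fin 2 ⊕ ι) K (grading n K 1))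

/-- The overlap of the two charts that contain the line. -/
noncomputable def overlap : (ProjSpace n K).affineOpens :=
  nonvanishing (mulForm (b (.inl 0)) (b' (.inl 0)))

theorem overlap_eq : (overlap b b').1 =
    (nonvanishing (b (.inl 0))).1 ⊓ (nonvanishing (b' (.inl 0))).1 :=
  nonvanishing_mulForm _ _

theorem overlap_le_left : overlap b b' ≤ nonvanishing (b (.inl 0)) :=
  nonvanishing_mulForm_le_left _ _

theorem overlap_le_right : overlap b b' ≤ nonvanishing (b' (.inl 0)) :=
  nonvanishing_mulForm_le_right _ _

variable {b b'}

/-- Both rings are localizations of the first chart ring at `u = b₁ / b₀`. -/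
theorem exists_overlapEquiv (h : IsSwap b b') :
    ∃ e : MvPolynomial ι (LaurentPolynomial K) ≃+* Γ(ProjSpace n K, overlap b b'),
      ∀ F, e (coordMap (iotaZero K) 1 F) = res (overlap_le_left b b') (chartEquiv b F) := by
  let _ : Algebra (MvPolynomial ι (Polynomial K)) (MvPolynomial ι (LaurentPolynomial K)) :=
    (coordMap (iotaZero K) 1).toAlgebra
  have h1 : IsLocalization.Away (MvPolynomial.C Polynomial.X : MvPolynomial ι (Polynomial K))
    (MvPolynomial ι (LaurentPolynomial K)) := isLocalization_coordMap
  let _ : Algebra (Away (grading n K) (b (.inl 0)).1)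
    (Away (grading n K) (mulForm (b (.inl 0)) (b' (.inl 0))).1) :=
      (awayMap (grading n K) (b' (.inl 0)).2 (coe_mulForm _ _)).toAlgebra
  have h2 : IsLocalization.Away (awayPolyEquiv b (MvPolynomial.C Polynomial.X))
      (Away (grading n K) (mulForm (b (.inl 0)) (b' (.inl 0))).1) := by
    have h3 := Away.isLocalization_mul (b (.inl 0)).2 (b' (.inl 0)).2
      (coe_mulForm (b (.inl 0)) (b' (.inl 0))) one_ne_zero
    have h4 : awayPolyEquiv b (MvPolynomial.C Polynomial.X) =
        Away.isLocalizationElem (b (.inl 0)).2 (b' (.inl 0)).2 := by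
      refine (toAway_C_X b).trans ?_
      apply HomogeneousLocalization.val_injective
      rw [val_awayFrac, Away.isLocalizationElem, Away.val_mk, ← h.zero]
      congr 1
      exact (pow_one _).symm
    rw [h4]
    exact h3
  let e := IsLocalization.ringEquivOfRingEquiv (MvPolynomial ι (LaurentPolynomial K))
    (Away (grading n K) (mulForm (b (.inl 0)) (b' (.inl 0))).1) (awayPolyEquiv b)
    (Submonoid.map_powers (awayPolyEquiv b) (MvPolynomial.C Polynomial.X))
  refine ⟨e.trans (awayEquiv (mulForm (b (.inl 0)) (b' (.inl 0)))), fun F => ?_⟩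
  have h5 : e (coordMap (iotaZero K) 1 F) =
      awayMap (grading n K) (b' (.inl 0)).2 (coe_mulForm _ _) (awayPolyEquiv b F) :=
    IsLocalization.ringEquivOfRingEquiv_eq _ F
  refine (congrArg (awayEquiv (mulForm (b (.inl 0)) (b' (.inl 0)))) h5).trans ?_
  exact (res_awayEquiv_left _ _ _).symm

/-- Functions on the overlap are Laurent polynomials. -/
noncomputable def overlapEquiv (h : IsSwap b b') :
    MvPolynomial ι (LaurentPolynomial K) ≃+* Γ(ProjSpace n K, overlap b b') :=
  (exists_overlapEquiv h).choose

theorem overlapEquiv_left (h : IsSwap b b') (F : MvPolynomial ι (Polynomial K)) :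
    overlapEquiv h (coordMap (iotaZero K) 1 F) = res (overlap_le_left b b') (chartEquiv b F) :=
  (exists_overlapEquiv h).choose_spec F

theorem res_scalars {U V : (ProjSpace n K).affineOpens} (h : U ≤ V) (c : K) :
    res h (scalars n K V c) = scalars n K U c := by
  rw [res, scalars, scalars, ← RingHom.comp_apply, ← CommRingCat.hom_comp]
  simp only [Category.assoc, ← Functor.map_comp]
  rfl

theorem frac_self : frac (b (.inl 0)) (b (.inl 0)) = 1 := by
  rw [← chartEquiv_dehom, dehom_zero, map_one]

theorem res_frac_linear (f g F : grading n K 1) :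
    res (nonvanishing_mulForm_le_left f g) (frac f F) =
      res (nonvanishing_mulForm_le_left f g) (frac f g) *
        res (nonvanishing_mulForm_le_right f g) (frac g F) := by
  rw [res_frac f g F, pow_one]

-- The coordinates of the second chart are `b₀ / b₁ = u⁻¹` on the line and `u⁻¹ y_j` transversally;
-- it suffices to compare the two homomorphisms on constants and these coordinates.
open LaurentPolynomial in
theorem overlapEquiv_right (h : IsSwap b b') (F : MvPolynomial ι (Polynomial K)) :
    overlapEquiv h (coordMap (iotaOne K) (T (-1)) F) =
      res (overlap_le_right b b') (chartEquiv b' F) := by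
  have hu : overlapEquiv h (MvPolynomial.C (T 1)) =
      res (overlap_le_left b b') (frac (b (.inl 0)) (b' (.inl 0))) := by
    rw [h.zero, ← chartEquiv_C_X, ← overlapEquiv_left h, coordMap_C]
    congr 2
    exact (Polynomial.toLaurent_X).symm
  have hv : overlapEquiv h (MvPolynomial.C (T (-1))) *
      res (overlap_le_left b b') (frac (b (.inl 0)) (b' (.inl 0))) = 1 := by
    rw [← hu, ← map_mul, ← map_mul, ← T_add, neg_add_cancel, T_zero, map_one, map_one]
  have hv' : ∀ x y, x = res (overlap_le_left b b') (frac (b (.inl 0)) (b' (.inl 0))) * y →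
      overlapEquiv h (MvPolynomial.C (T (-1))) * x = y := by
    rintro x y rfl
    rw [← mul_assoc, hv, one_mul]
  suffices H : (overlapEquiv h).toRingHom.comp (coordMap (iotaOne K) (T (-1))) =
      (res (overlap_le_right b b')).comp (chartEquiv b').toRingHom from
    congrArg (fun t => t F) H
  apply MvPolynomial.ringHom_ext
  · intro r
    suffices H : ((overlapEquiv h).toRingHom.comp (coordMap (iotaOne K) (T (-1)))).comp
        MvPolynomial.C = ((res (overlap_le_right b b')).comp (chartEquiv b').toRingHom).comp
          MvPolynomial.C from congrArg (fun t => t r) H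
    apply Polynomial.ringHom_ext
    · intro c
      change overlapEquiv h (coordMap (iotaOne K) (T (-1)) (MvPolynomial.C (Polynomial.C c))) =
        res (overlap_le_right b b') (chartEquiv b' (MvPolynomial.C (Polynomial.C c)))
      rw [chartEquiv_C, res_scalars, ← res_scalars (overlap_le_left b b'), ← chartEquiv_C,
        ← overlapEquiv_left h, coordMap_C, coordMap_C]
      congr 2
      simp
    · change overlapEquiv h (coordMap (iotaOne K) (T (-1)) (MvPolynomial.C Polynomial.X)) =
        res (overlap_le_right b b') (chartEquiv b' (MvPolynomial.C Polynomial.X))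
      rw [chartEquiv_C_X, h.one, coordMap_C]
      have e1 : iotaOne K Polynomial.X = T (-1) := by simp
      rw [e1, ← mul_one (overlapEquiv h _)]
      apply hv'
      rw [← map_one (res (overlap_le_left b b')), ← frac_self (b := b)]
      exact res_frac_linear _ _ _
  · intro j
    change overlapEquiv h (coordMap (iotaOne K) (T (-1)) (MvPolynomial.X j)) =
      res (overlap_le_right b b') (chartEquiv b' (MvPolynomial.X j))
    rw [coordMap_X, map_mul, chartEquiv_X]
    apply hv'
    rw [h.inr j]
    have e2 : (MvPolynomial.X j : MvPolynomial ι (LaurentPolynomial K)) =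
        coordMap (iotaZero K) 1 (MvPolynomial.X j) := by
      rw [coordMap_X, map_one, one_mul]
    rw [e2, overlapEquiv_left, chartEquiv_X]
    exact res_frac_linear _ _ _

end Overlap

end ProjCurve

/-! ### The line, its points and its ideal in a chart -/

namespace ProjCurve

section Support

open HomogeneousLocalization

variable {n : ℕ} {K : Type u} [Field K] {ι : Type}

theorem mem_basicOpen_frac (f : grading n K 1) {d : ℕ} (F : grading n K d) {x : ProjSpace n K}
    (hx : x ∈ (nonvanishing f).1) :
    x ∈ (ProjSpace n K).basicOpen (frac f F) ↔ F.1 ∉ x.asHomogeneousIdeal := by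
  have : x.asHomogeneousIdeal.toIdeal.IsPrime := x.isPrime
  rw [Scheme.mem_basicOpen _ _ _ hx]
  have h := congrArg (fun t => t.hom (awayFrac f F))
    (ProjectiveSpectrum.Proj.awayToSection_germ (grading n K) f.1 x hx)
  have h' : ((ProjSpace n K).presheaf.germ _ x hx).hom (frac f F) =
      (Proj.stalkIso' (grading n K) x).symm (HomogeneousLocalization.mapId (grading n K)
        (Submonoid.powers_le.mpr hx) (awayFrac f F)) := h
  erw [h']
  refine (MulEquiv.isUnit_map (Proj.stalkIso' (grading n K) x).symm).trans ?_
  refine (isUnit_iff_isUnit_val _ _ _).symm.trans ?_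
  have h2 : (HomogeneousLocalization.mapId (grading n K) (Submonoid.powers_le.mpr hx)
      (awayFrac f F)).val = IsLocalization.mk'
        (Localization x.asHomogeneousIdeal.toIdeal.primeCompl) F.1
        (⟨f.1 ^ d, pow_mem (show f.1 ∈ x.asHomogeneousIdeal.toIdeal.primeCompl from hx) d⟩ :
          x.asHomogeneousIdeal.toIdeal.primeCompl) := by
    rw [← Localization.mk_eq_mk']
    rfl
  rw [h2, IsLocalization.AtPrime.isUnit_mk'_iff _ x.asHomogeneousIdeal.toIdeal]
  rfl

variable (b : Module.Basis (Fin 2 ⊕ ι) K (grading n K 1))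

/-- The points of the line defined by the last forms of a basis. -/
def lineSet : Set (ProjSpace n K) :=
  {x | ∀ j, (b (.inr j)).1 ∈ x.asHomogeneousIdeal}

theorem exists_varForm_notMem (x : ProjSpace n K) :
    ∃ i, (varForm n K i).1 ∉ x.asHomogeneousIdeal := by
  by_contra! H
  have h := Proj.iSup_basicOpen_eq_top' (grading n K) (fun i => (varForm n K i).1)
    (fun i => ⟨1, (varForm n K i).2⟩) (by
      rw [eq_top_iff]
      rintro F -
      induction F using MvPolynomial.induction_on with
      | C a =>
        exact Subalgebra.algebraMap_mem _
          (⟨MvPolynomial.C a, MvPolynomial.isHomogeneous_C _ a⟩ : grading n K 0)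
      | add p q hp hq => exact add_mem hp hq
      | mul_X p i hp => exact mul_mem hp (Algebra.subset_adjoin ⟨i, rfl⟩))
  have hx : x ∈ ⨆ i, Proj.basicOpen (grading n K) (varForm n K i).1 := by
    rw [h]; trivial
  obtain ⟨i, hi⟩ := TopologicalSpace.Opens.mem_iSup.1 hx
  exact hi (H i)

/-- If both remaining basis forms vanished at a point of the line, all linear forms would vanish
there, which happens at no point of `ℙⁿ`. -/
theorem mem_nonvanishing_or {b b' : Module.Basis (Fin 2 ⊕ ι) K (grading n K 1)} (h : IsSwap b b')
    {x : ProjSpace n K} (hx : x ∈ lineSet b) :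
    x ∈ (nonvanishing (b (.inl 0))).1 ∨ x ∈ (nonvanishing (b' (.inl 0))).1 := by
  by_contra! H
  obtain ⟨h0, h1⟩ := H
  replace h0 : (b (.inl 0)).1 ∈ x.asHomogeneousIdeal := not_not.1 h0
  replace h1 : (b' (.inl 0)).1 ∈ x.asHomogeneousIdeal := not_not.1 h1
  rw [h.zero] at h1
  obtain ⟨i, hi⟩ := exists_varForm_notMem x
  apply hi
  generalize varForm n K i = F
  have hF := b.mem_span F
  induction hF using Submodule.span_induction with
  | mem y hy =>
    obtain ⟨s, rfl⟩ := hy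
    rcases s with s | j
    · fin_cases s
      · exact h0
      · exact h1
    · exact hx j
  | zero => exact zero_mem _
  | add y z _ _ hy hz => exact add_mem hy hz
  | smul a y _ hy =>
    rw [Submodule.coe_smul, MvPolynomial.smul_eq_C_mul]
    exact Ideal.mul_mem_left _ _ hy

/-- The ideal of the line in a chart. -/
noncomputable def lineIdeal (ι : Type) (k : Type*) [CommRing k] : Ideal (MvPolynomial ι k) :=
  RingHom.ker (MvPolynomial.constantCoeff : MvPolynomial ι k →+* k)

theorem lineIdeal_eq_span (k : Type*) [CommRing k] :
    lineIdeal ι k = Ideal.span (Set.range MvPolynomial.X) := by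
  ext F
  have := MvPolynomial.mem_pow_idealOfVars_iff' 1 F
  rw [pow_one] at this
  refine Iff.trans ?_ this.symm
  rw [lineIdeal, RingHom.mem_ker, MvPolynomial.constantCoeff_eq]
  refine ⟨fun h x hx => ?_, fun h => h 0 (by simp)⟩
  rwa [(Finsupp.degree_eq_zero_iff x).1 (Nat.lt_one_iff.1 hx)]

instance lineIdeal_isPrime (k : Type*) [CommRing k] [IsDomain k] : (lineIdeal ι k).IsPrime :=
  RingHom.ker_isPrime _

variable (C : (ProjSpace n K).IdealSheafData)

/-- The ideal of a subscheme in the chart given by a basis of linear forms. -/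
noncomputable def chartIdeal : Ideal (MvPolynomial ι (Polynomial K)) :=
  (C.ideal (nonvanishing (b (.inl 0)))).comap (chartEquiv b).toRingHom

theorem mem_chartIdeal {F : MvPolynomial ι (Polynomial K)} :
    F ∈ chartIdeal b C ↔ chartEquiv b F ∈ C.ideal (nonvanishing (b (.inl 0))) := Iff.rfl

variable {C}

/-- The prime `(y)` is the generic point of the line in the chart. It lies in the support of `C`, so
every function in the ideal of `C` vanishes there. -/
theorem chartIdeal_le (hC : (C.support : Set (ProjSpace n K)) = lineSet b) :
    chartIdeal b C ≤ lineIdeal ι (Polynomial K) := by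
  let U := nonvanishing (b (.inl 0))
  let P : PrimeSpectrum Γ(ProjSpace n K, U) :=
    ⟨(lineIdeal ι (Polynomial K)).comap (chartEquiv b).symm.toRingHom,
      Ideal.IsPrime.comap _⟩
  have hP (s : Γ(ProjSpace n K, U)) : U.2.fromSpec P ∈ (ProjSpace n K).basicOpen s ↔
      (chartEquiv b).symm s ∉ lineIdeal ι (Polynomial K) := by
    have : U.2.fromSpec P ∈ (ProjSpace n K).basicOpen s ↔
      P ∈ U.2.fromSpec ⁻¹ᵁ (ProjSpace n K).basicOpen s := Iff.rfl
    rw [this, U.2.fromSpec_preimage_basicOpen]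
    rfl
  have hU : U.2.fromSpec P ∈ U.1 := by
    have := U.2.range_fromSpec
    have h : U.2.fromSpec P ∈ Set.range U.2.fromSpec := ⟨P, rfl⟩
    rwa [this] at h
  have hs : U.2.fromSpec P ∈ C.support := by
    change U.2.fromSpec P ∈ (C.support : Set (ProjSpace n K))
    rw [hC]
    intro j
    have h1 := (mem_basicOpen_frac (b (.inl 0)) (b (.inr j)) hU).symm.trans (hP _)
    rw [not_iff_not] at h1
    rw [h1, ← chartEquiv_X, RingEquiv.symm_apply_apply, lineIdeal_eq_span]
    exact Ideal.subset_span ⟨j, rfl⟩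
  rw [Scheme.IdealSheafData.mem_support_iff_of_mem hU, Scheme.mem_zeroLocus_iff] at hs
  intro F hF
  have := hs _ hF
  rw [hP] at this
  have h2 := not_not.1 this
  erw [RingEquiv.symm_apply_apply] at h2
  exact h2

/-- The coordinates `y_j` vanish at every point of `L`, so they lie in its vanishing ideal, whose
square is contained in the ideal of `C`. -/
theorem lineIdeal_sq_le {L : Closeds (ProjSpace n K)} (hL : (L : Set (ProjSpace n K)) = lineSet b)
    (hC : Scheme.IdealSheafData.vanishingIdeal L ^ 2 ≤ C) :
    lineIdeal ι (Polynomial K) ^ 2 ≤ chartIdeal b C := by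
  let U := nonvanishing (b (.inl 0))
  have h1 : lineIdeal ι (Polynomial K) ≤
      ((Scheme.IdealSheafData.vanishingIdeal L).ideal U).comap (chartEquiv b).toRingHom := by
    rw [lineIdeal_eq_span, Ideal.span_le]
    rintro _ ⟨j, rfl⟩
    change chartEquiv b (MvPolynomial.X j) ∈ (Scheme.IdealSheafData.vanishingIdeal L).ideal U
    rw [Scheme.IdealSheafData.vanishingIdeal_ideal, PrimeSpectrum.mem_vanishingIdeal]
    intro P hP
    have hU : U.2.fromSpec P ∈ U.1 := by
      have := U.2.range_fromSpec
      have h : U.2.fromSpec P ∈ Set.range U.2.fromSpec := ⟨P, rfl⟩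
      rwa [this] at h
    have hP' : U.2.fromSpec P ∈ (L : Set (ProjSpace n K)) := hP
    rw [hL] at hP'
    have h2 := hP' j
    by_contra h3
    have h4 : P ∈ U.2.fromSpec ⁻¹ᵁ (ProjSpace n K).basicOpen (chartEquiv b (MvPolynomial.X j)) := by
      rw [U.2.fromSpec_preimage_basicOpen]
      exact h3
    have h5 : U.2.fromSpec P ∈ (ProjSpace n K).basicOpen (chartEquiv b (MvPolynomial.X j)) := h4
    rw [chartEquiv_X] at h5
    exact (mem_basicOpen_frac _ _ hU).1 h5 h2
  calc lineIdeal ι (Polynomial K) ^ 2 ≤ _ := Ideal.pow_right_mono h1 2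
    _ ≤ ((Scheme.IdealSheafData.vanishingIdeal L).ideal U ^ 2).comap (chartEquiv b).toRingHom :=
      Ideal.le_comap_pow _ 2
    _ ≤ _ := Ideal.comap_mono (hC U)

end Support

end ProjCurve

/-! ### Cohen–Macaulayness excludes torsion -/

namespace ProjCurve

section CohenMacaulay

/-- The maximal ideal of `S = B_m` annihilates the nonzero image of `y`, so it contains no regular
element and the regular sequence is empty. The dimension is not zero, since `p` lies in the maximal
ideal without being nilpotent in `S`. -/
theorem not_isCohenMacaulayLocal {B S : Type*} [CommRing B] [CommRing S] [Algebra B S]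
    [IsLocalRing S] (m : Ideal B) [m.IsPrime] [IsLocalization.AtPrime S m] {y p : B}
    (hy : ∀ a, a ∈ m ↔ a * y = 0) (hp : p ∈ m) (hp' : ∀ s ∉ m, ∀ k : ℕ, s * p ^ k ≠ 0) :
    ¬ IsCohenMacaulayLocal S := by
  rintro ⟨hN, rs, hrs, hreg, hlen⟩
  rcases rs with _ | ⟨r, rs⟩
  · have h0 : ringKrullDim S = 0 := by rw [← hlen]; rfl
    have : Ring.KrullDimLE 0 S := (Ring.krullDimLE_iff).2 h0.le
    have h1 : algebraMap B S p ∈ IsLocalRing.maximalIdeal S :=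
      (IsLocalization.AtPrime.to_map_mem_maximal_iff S m p).2 hp
    obtain ⟨k, hk⟩ := ((Ring.krullDimLE_zero_and_isLocalRing_tfae S).out 0 2 rfl rfl).1
      ⟨inferInstance, inferInstance⟩ (algebraMap B S p) |>.2 h1
    rw [← map_pow, IsLocalization.map_eq_zero_iff m.primeCompl] at hk
    obtain ⟨s, hs⟩ := hk
    exact hp' s.1 s.2 k hs
  · have hr := hrs r (by simp)
    have hreg' : IsSMulRegular S r := ((RingTheory.Sequence.isRegular_cons_iff S r rs).1 hreg).1
    obtain ⟨⟨a, s⟩, has⟩ := IsLocalization.surj m.primeCompl r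
    have ha : a ∈ m := by
      rw [← IsLocalization.AtPrime.to_map_mem_maximal_iff S m, ← has]
      exact Ideal.mul_mem_right _ _ hr
    have h1 : r • (algebraMap B S (s * y)) = r • 0 := by
      rw [smul_zero, smul_eq_mul, map_mul, ← mul_assoc, has, ← map_mul, (hy a).1 ha, map_zero]
    have h2 := hreg' h1
    rw [IsLocalization.map_eq_zero_iff m.primeCompl] at h2
    obtain ⟨t, ht⟩ := h2
    rw [← mul_assoc] at ht
    have := (hy _).2 ht
    exact (t * s).2 this

/-- On a Cohen–Macaulay double structure on an integral scheme, functions that do not vanish on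
the underlying integral scheme are regular. -/
theorem mem_of_mul_mem_of_isCohenMacaulayLocal {A B : Type*} [CommRing A] [CommRing B]
    [IsNoetherianRing B] (ρ : A →+* B) (hρ : Function.Surjective ρ) {J : Ideal A} [J.IsPrime]
    (hJ : RingHom.ker ρ ≤ J) (hJ' : J ^ 2 ≤ RingHom.ker ρ)
    (hCM : ∀ (m : Ideal B) [m.IsPrime], ∃ (S : Type u) (_ : CommRing S) (_ : Algebra B S)
      (_ : IsLocalRing S), IsLocalization.AtPrime S m ∧ IsCohenMacaulayLocal S)
    {p F : A} (hp : p ∉ J) (h : p * F ∈ RingHom.ker ρ) : F ∈ RingHom.ker ρ := by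
  by_contra hF
  -- If `F` were not in the kernel, its annihilator in `B` would lie in an associated prime `m`,
  -- which contains the image of `p`. The localization at `m` would then contradict
  -- `not_isCohenMacaulayLocal`.
  obtain ⟨m, hm, hle⟩ := exists_le_isAssociatedPrime_of_isNoetherianRing B (ρ F) hF
  obtain ⟨hm', y, hy⟩ := (isAssociatedPrime_iff).1 hm
  obtain ⟨S, _, _, _, hS, hS'⟩ := hCM m
  refine not_isCohenMacaulayLocal (y := y) (p := ρ p) m (fun a => ?_) (hle ?_)
    (fun s hs k hk => hs ?_) hS'
  · rw [hy, Submodule.mem_colon_singleton, smul_eq_mul, Submodule.mem_bot]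
  · rw [Submodule.mem_colon_singleton, smul_eq_mul, Submodule.mem_bot, ← map_mul]
    exact h
  -- If `s p^k = 0` in `B`, then `s ∈ J` because `p` is outside the prime `J`; hence `s² = 0` in `B`
  -- and `s` lies in `m`.
  · obtain ⟨s, rfl⟩ := hρ s
    have h1 : s * p ^ k ∈ RingHom.ker ρ := by rw [RingHom.mem_ker, map_mul, map_pow, hk]
    have h2 : s ∈ J := ((Ideal.IsPrime.mem_or_mem ‹_› (hJ h1)).resolve_right
      fun h => hp (Ideal.IsPrime.mem_of_pow_mem ‹_› k h))
    have h3 : ρ s ^ 2 = 0 := by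
      rw [← map_pow]
      exact hJ' (Ideal.pow_mem_pow h2 2)
    exact hm'.mem_of_pow_mem 2 (h3 ▸ zero_mem m)

variable {n : ℕ} {K : Type u} [Field K] {ι : Type} [Finite ι]

/-- Nonzero functions of `u` do not vanish identically on the line, so they are regular on `C`. The
local rings required by the algebraic criterion are the stalks of `C`. -/
theorem mem_chartIdeal_of_mul_mem (b : Module.Basis (Fin 2 ⊕ ι) K (grading n K 1))
    {C : (ProjSpace n K).IdealSheafData}
    (hCM : ∀ x : C.subscheme, IsCohenMacaulayLocal (C.subscheme.presheaf.stalk x))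
    (h1 : chartIdeal b C ≤ lineIdeal ι (Polynomial K))
    (h2 : lineIdeal ι (Polynomial K) ^ 2 ≤ chartIdeal b C) {p : Polynomial K} (hp : p ≠ 0)
    {F : MvPolynomial ι (Polynomial K)} (h : MvPolynomial.C p * F ∈ chartIdeal b C) :
    F ∈ chartIdeal b C := by
  let U := nonvanishing (b (.inl 0))
  let ρ := (toSub C U).comp (chartEquiv b).toRingHom
  have hρ : Function.Surjective ρ :=
    (C.subschemeι_app_surjective U).comp (chartEquiv b).surjective
  have hker : RingHom.ker ρ = chartIdeal b C := by
    ext F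
    exact toSub_eq_zero_iff C _
  have : IsNoetherianRing Γ(C.subscheme, C.subschemeι ⁻¹ᵁ U.1) :=
    isNoetherianRing_of_surjective _ _ ρ hρ
  have hU : IsAffineOpen (C.subschemeι ⁻¹ᵁ U.1) := U.2.preimage _
  rw [← hker] at h1 h2 h ⊢
  refine mem_of_mul_mem_of_isCohenMacaulayLocal ρ hρ h1 h2 (fun m hm => ?_) ?_ h
  · let P : PrimeSpectrum Γ(C.subscheme, C.subschemeι ⁻¹ᵁ U.1) := ⟨m, hm⟩
    have hP : hU.fromSpec P ∈ C.subschemeι ⁻¹ᵁ U.1 := by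
      have := hU.range_fromSpec
      have h : hU.fromSpec P ∈ Set.range hU.fromSpec := ⟨P, rfl⟩
      rwa [this] at h
    exact ⟨C.subscheme.presheaf.stalk (hU.fromSpec P), inferInstance,
      TopCat.Presheaf.algebra_section_stalk C.subscheme.presheaf ⟨_, hP⟩, inferInstance,
      hU.isLocalization_stalk' P hP, hCM _⟩
  · rw [lineIdeal, RingHom.mem_ker, MvPolynomial.constantCoeff_C]
    exact hp

end CohenMacaulay

end ProjCurve

/-! ### The homogeneous ideal of `C` in adapted coordinates -/

namespace ProjCurve

section IdealPart

variable {n : ℕ} {K : Type u} [Field K] {ι : Type} {C : (ProjSpace n K).IdealSheafData}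

/-- Passing between charts multiplies the fraction of a form by a power of a transition function, so
vanishing on `C` can be tested on any charts that cover the support. -/
theorem frac_mem_ideal {J : Type} (g : J → grading n K 1)
    (hg : ∀ x ∈ C.support, ∃ j, x ∈ (nonvanishing (g j)).1) {d : ℕ} {F : grading n K d}
    (hF : ∀ j, frac (g j) F ∈ C.ideal (nonvanishing (g j))) (f : grading n K 1) :
    frac f F ∈ C.ideal (nonvanishing f) := by
  refine mem_ideal_of_locally C (J := ULift.{u} J)
    (V := fun j => nonvanishing (mulForm f (g j.down)))
    (fun j => nonvanishing_mulForm_le_left f (g j.down)) (fun x hx hs => ?_) fun j => ?_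
  · obtain ⟨j, hj⟩ := hg x hs
    refine ⟨⟨j⟩, ?_⟩
    rw [nonvanishing_mulForm]
    exact ⟨hx, hj⟩
  · rw [res_frac]
    exact Ideal.mul_mem_left _ _
      (C.ideal_le_comap_ideal (nonvanishing_mulForm_le_right f (g j.down)) (hF j.down))

theorem mem_idealPart_iff {b b' : Module.Basis (Fin 2 ⊕ ι) K (grading n K 1)} (h : IsSwap b b')
    (hC : (C.support : Set (ProjSpace n K)) = lineSet b) {d : ℕ} (F : grading n K d) :
    F ∈ idealPart C d ↔ dehom b F.1 ∈ chartIdeal b C ∧ dehom b' F.1 ∈ chartIdeal b' C := by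
  rw [mem_chartIdeal, mem_chartIdeal, chartEquiv_dehom, chartEquiv_dehom]
  have hF : F ∈ idealPart C d ↔
      ∀ i, frac (varForm n K i) F ∈ C.ideal (nonvanishing (varForm n K i)) := Iff.rfl
  rw [hF]
  constructor
  · intro H
    have hc : ∀ x ∈ C.support, ∃ i, x ∈ (nonvanishing (varForm n K i)).1 :=
      fun x _ => exists_varForm_notMem x
    exact ⟨frac_mem_ideal _ hc H _, frac_mem_ideal _ hc H _⟩
  · rintro ⟨h0, h1⟩ i
    refine frac_mem_ideal (J := Bool)
      (fun j => match j with | true => b (.inl 0) | false => b' (.inl 0)) (fun x hx => ?_)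
      (fun j => match j with | true => h0 | false => h1) (varForm n K i)
    have hx' : x ∈ lineSet b := hC ▸ hx
    exact (mem_nonvanishing_or h hx').elim (fun h => ⟨true, h⟩) fun h => ⟨false, h⟩

theorem finite_linearForms : Module.Finite K (grading n K 1) := by
  have h : Submodule.span K (Set.range MvPolynomial.X) = grading n K 1 :=
    MvPolynomial.homogeneousSubmodule_one_eq_span_X.symm
  rw [← h]
  exact FiniteDimensional.span_of_finite K (Set.finite_range _)

theorem finrank_linearForms : Module.finrank K (grading n K 1) = n + 1 := by
  have h : Submodule.span K (Set.range MvPolynomial.X) = grading n K 1 :=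
    MvPolynomial.homogeneousSubmodule_one_eq_span_X.symm
  rw [← h, finrank_span_eq_card (MvPolynomial.linearIndependent_X _ _), Fintype.card_fin]

/-- A basis of `W` supplies the last `n - 1` forms; a two-dimensional complement in the space of
linear forms supplies the first two. -/
theorem IsLine.exists_basis {L : Closeds (ProjSpace n K)} (hL : IsLine L) :
    ∃ b : Module.Basis (Fin 2 ⊕ Fin (n - 1)) K (grading n K 1),
      (L : Set (ProjSpace n K)) = lineSet b := by
  obtain ⟨W, hW, hr, hLW⟩ := hL
  have := finite_linearForms (n := n) (K := K)
  let W' := W.submoduleOf (grading n K 1)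
  have hW' : Module.finrank K W' = n - 1 := by
    rw [(Submodule.submoduleOfEquivOfLe hW).finrank_eq]
    omega
  obtain ⟨Q, hQ⟩ := W'.exists_isCompl
  have hQ' : Module.finrank K Q = 2 := by
    have := Submodule.finrank_add_eq_of_isCompl hQ
    rw [finrank_linearForms] at this
    omega
  have := Module.Free.of_divisionRing K W'
  have := Module.Free.of_divisionRing K Q
  let bW := Module.finBasisOfFinrankEq K W' hW'
  let bQ := Module.finBasisOfFinrankEq K Q hQ'
  refine ⟨(bQ.prod bW).map (Submodule.prodEquivOfIsCompl Q W' hQ.symm), ?_⟩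
  have hb (j) : ((bQ.prod bW).map (Submodule.prodEquivOfIsCompl Q W' hQ.symm)) (.inr j) =
      (bW j : grading n K 1) := by
    simp
  rw [hLW]
  refine Set.ext fun x => (ProjectiveSpectrum.mem_zeroLocus _ x (W : Set _)).trans ?_
  constructor
  · intro h j
    rw [hb]
    exact h (bW j).2
  · intro h F hF
    have hF' := bW.mem_span ⟨⟨F, hW hF⟩, hF⟩
    suffices H : ∀ G : W', G.1.1 ∈ x.asHomogeneousIdeal from H ⟨⟨F, hW hF⟩, hF⟩
    intro G
    have hG := bW.mem_span G
    induction hG using Submodule.span_induction with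
    | mem y hy =>
      obtain ⟨j, rfl⟩ := hy
      rw [← hb]
      exact h j
    | zero => exact zero_mem _
    | add y z _ _ hy hz => exact add_mem hy hz
    | smul a y _ hy =>
      rw [Submodule.coe_smul, Submodule.coe_smul, MvPolynomial.smul_eq_C_mul]
      exact Ideal.mul_mem_left _ _ hy

theorem chartIdeal_map (b : Module.Basis (Fin 2 ⊕ ι) K (grading n K 1)) :
    (chartIdeal b C).map (chartEquiv b).toRingHom = C.ideal (nonvanishing (b (.inl 0))) :=
  Ideal.map_comap_of_surjective _ (chartEquiv b).surjective _

variable {b b' : Module.Basis (Fin 2 ⊕ ι) K (grading n K 1)}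

theorem overlap_ideal_left (h : IsSwap b b') :
    (C.ideal (overlap b b')).comap (overlapEquiv h).toRingHom =
      (chartIdeal b C).map (coordMap (iotaZero K) 1) := by
  have h1 : (C.ideal (nonvanishing (b (.inl 0)))).map (res (overlap_le_left b b')) =
    C.ideal (overlap b b') := C.map_ideal (overlap_le_left b b')
  have h2 : (res (overlap_le_left b b')).comp (chartEquiv b).toRingHom =
      (overlapEquiv h).toRingHom.comp (coordMap (iotaZero K) 1) :=
    RingHom.ext fun F => (overlapEquiv_left h F).symm
  rw [← h1, ← chartIdeal_map, Ideal.map_map, h2, ← Ideal.map_map]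
  exact Ideal.comap_map_of_bijective _ (overlapEquiv h).bijective

theorem overlap_ideal_right (h : IsSwap b b') :
    (C.ideal (overlap b b')).comap (overlapEquiv h).toRingHom =
      (chartIdeal b' C).map (coordMap (iotaOne K) (LaurentPolynomial.T (-1))) := by
  have h1 : (C.ideal (nonvanishing (b' (.inl 0)))).map (res (overlap_le_right b b')) =
    C.ideal (overlap b b') := C.map_ideal (overlap_le_right b b')
  have h2 : (res (overlap_le_right b b')).comp (chartEquiv b').toRingHom =
      (overlapEquiv h).toRingHom.comp (coordMap (iotaOne K) (LaurentPolynomial.T (-1))) :=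
    RingHom.ext fun F => (overlapEquiv_right h F).symm
  rw [← h1, ← chartIdeal_map, Ideal.map_map, h2, ← Ideal.map_map]
  exact Ideal.comap_map_of_bijective _ (overlapEquiv h).bijective

end IdealPart

end ProjCurve

/-! ### Recovering an ideal from the overlap -/

namespace ProjCurve

section Torsion

open LaurentPolynomial

variable {K : Type u} [Field K] {ι : Type}

/-- The automorphism of the functions on the overlap that exchanges the two charts. -/
noncomputable def coordSwap (K : Type u) [Field K] (ι : Type) :
    MvPolynomial ι (LaurentPolynomial K) →+* MvPolynomial ι (LaurentPolynomial K) :=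
  coordMap (invert (R := K)).toRingEquiv.toRingHom (T (-1))

theorem coordSwap_coordSwap (F : MvPolynomial ι (LaurentPolynomial K)) :
    coordSwap K ι (coordSwap K ι F) = F := by
  suffices h : (coordSwap K ι).comp (coordSwap K ι) = RingHom.id _ from congrArg (fun t => t F) h
  apply MvPolynomial.ringHom_ext
  · intro r
    rw [RingHom.comp_apply, coordSwap, coordMap_C, coordMap_C, RingHom.id_apply]
    congr 1
    exact LaurentPolynomial.ext fun a => by simp
  · intro j
    rw [RingHom.comp_apply, coordSwap, coordMap_X, map_mul, coordMap_C, coordMap_X,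
      RingHom.id_apply, ← mul_assoc, ← map_mul]
    have : (invert (R := K)).toRingEquiv.toRingHom (T (-1)) = T 1 := by simp
    rw [this, ← T_add, add_neg_cancel, T_zero, map_one, one_mul]

theorem coordSwap_coordMap (F : MvPolynomial ι (Polynomial K)) :
    coordSwap K ι (coordMap (iotaZero K) 1 F) = coordMap (iotaOne K) (T (-1)) F := by
  suffices h : (coordSwap K ι).comp (coordMap (iotaZero K) 1) = coordMap (iotaOne K) (T (-1)) from
    congrArg (fun t => t F) h
  apply MvPolynomial.ringHom_ext
  · intro r
    rw [RingHom.comp_apply, coordSwap, coordMap_C, coordMap_C, coordMap_C]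
    rfl
  · intro j
    rw [RingHom.comp_apply, coordSwap, coordMap_X, map_mul, coordMap_C, coordMap_X, coordMap_X,
      map_one, map_one, one_mul]

theorem exists_coordMap_iotaZero (F : MvPolynomial ι (LaurentPolynomial K)) :
    ∃ (k : ℕ) (G : MvPolynomial ι (Polynomial K)),
      MvPolynomial.C (T k) * F = coordMap (iotaZero K) 1 G := by
  let _ : Algebra (MvPolynomial ι (Polynomial K)) (MvPolynomial ι (LaurentPolynomial K)) :=
    (coordMap (iotaZero K) 1).toAlgebra
  have h1 : IsLocalization.Away (MvPolynomial.C Polynomial.X : MvPolynomial ι (Polynomial K))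
    (MvPolynomial ι (LaurentPolynomial K)) := isLocalization_coordMap
  obtain ⟨⟨G, ⟨_, k, rfl⟩⟩, h⟩ := IsLocalization.surj
    (Submonoid.powers (MvPolynomial.C Polynomial.X : MvPolynomial ι (Polynomial K))) F
  refine ⟨k, G, ?_⟩
  rw [mul_comm]
  refine Eq.trans ?_ h
  congr 1
  change _ = coordMap (iotaZero K) 1 (MvPolynomial.C Polynomial.X ^ k)
  rw [← map_pow, coordMap_C, Polynomial.toLaurent_X_pow]

theorem coordMap_iotaZero_injective :
    Function.Injective (coordMap (iotaZero K) 1 : MvPolynomial ι (Polynomial K) →+* _) := by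
  rw [coordMap_iotaZero_one]
  exact MvPolynomial.map_injective _ iotaZero_injective

theorem exists_coordMap_iotaOne (F : MvPolynomial ι (LaurentPolynomial K)) :
    ∃ (k : ℕ) (G : MvPolynomial ι (Polynomial K)),
      MvPolynomial.C (T (-k)) * F = coordMap (iotaOne K) (T (-1)) G := by
  obtain ⟨k, G, h⟩ := exists_coordMap_iotaZero (coordSwap K ι F)
  refine ⟨k, G, ?_⟩
  have := congrArg (coordSwap K ι) h
  rw [map_mul, coordSwap_coordSwap, coordSwap_coordMap, coordSwap, coordMap_C] at this
  rw [← this]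
  congr 2
  simp

theorem coordMap_iotaOne_injective : Function.Injective
    (coordMap (iotaOne K) (T (-1)) : MvPolynomial ι (Polynomial K) →+* _) := by
  intro F G h
  rw [← coordSwap_coordMap, ← coordSwap_coordMap] at h
  apply coordMap_iotaZero_injective
  rw [← coordSwap_coordSwap (coordMap _ _ F), h, coordSwap_coordSwap]

theorem iotaOne_X_pow (k : ℕ) : iotaOne K (Polynomial.X ^ k) = T (-k) := by
  rw [map_pow, iotaOne_X, T_pow, mul_neg, mul_one]

/-- An ideal without torsion is determined by the ideal that it generates on the overlap. -/
theorem mem_of_coordMap_mem_map {I : Ideal (MvPolynomial ι (Polynomial K))}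
    (hI : ∀ F, MvPolynomial.C Polynomial.X * F ∈ I → F ∈ I) {F : MvPolynomial ι (Polynomial K)}
    (hF : coordMap (iotaOne K) (T (-1)) F ∈ I.map (coordMap (iotaOne K) (T (-1)))) : F ∈ I := by
  -- Up to a power of `v = u⁻¹`, every element of the extended ideal comes from `I` itself.
  -- Saturation then removes that power.
  have key : ∀ G ∈ I.map (coordMap (iotaOne K) (T (-1))), ∃ (k : ℕ), ∃ H ∈ I,
      MvPolynomial.C (T (-k)) * G = coordMap (iotaOne K) (T (-1)) H := by
    intro G hG
    induction hG using Submodule.span_induction with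
    | mem x hx =>
      obtain ⟨H, hH, rfl⟩ := hx
      exact ⟨0, H, hH, by simp⟩
    | zero => exact ⟨0, 0, zero_mem _, by simp⟩
    | add x y _ _ hx hy =>
      obtain ⟨k, H, hH, h⟩ := hx
      obtain ⟨l, H', hH', h'⟩ := hy
      refine ⟨k + l, MvPolynomial.C (Polynomial.X ^ l) * H + MvPolynomial.C (Polynomial.X ^ k) * H',
        add_mem (Ideal.mul_mem_left _ _ hH) (Ideal.mul_mem_left _ _ hH'), ?_⟩
      rw [map_add, map_mul, map_mul, ← h, ← h', coordMap_C, coordMap_C, iotaOne_X_pow,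
        iotaOne_X_pow, ← mul_assoc, ← mul_assoc, ← map_mul, ← map_mul, ← T_add, ← T_add, mul_add]
      congr 4 <;> (push_cast; ring)
    | smul a x _ hx =>
      obtain ⟨k, H, hH, h⟩ := hx
      obtain ⟨l, a', ha⟩ := exists_coordMap_iotaOne a
      refine ⟨l + k, a' * H, Ideal.mul_mem_left _ _ hH, ?_⟩
      rw [map_mul, ← h, ← ha, smul_eq_mul]
      have : (T (-((l + k : ℕ) : ℤ)) : LaurentPolynomial K) = T (-l) * T (-k) := by
        rw [← T_add]
        congr 1
        push_cast
        ring
      rw [this, map_mul]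
      ring
  obtain ⟨k, H, hH, h⟩ := key _ hF
  have h1 : MvPolynomial.C (Polynomial.X ^ k) * F = H := by
    apply coordMap_iotaOne_injective
    rw [← h, map_mul, coordMap_C, iotaOne_X_pow]
  have h2 : ∀ k : ℕ, MvPolynomial.C (Polynomial.X ^ k) * F ∈ I → F ∈ I := by
    intro k
    induction k with
    | zero => simp
    | succ k ih =>
      intro h
      apply ih
      apply hI
      rwa [← mul_assoc, ← map_mul, ← pow_succ']
  exact h2 k (h1 ▸ hH)

end Torsion

/-! ### Forms in the two charts -/

section Dehom

open LaurentPolynomial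

variable {n : ℕ} {K : Type u} [Field K] {ι : Type}
  {b b' : Module.Basis (Fin 2 ⊕ ι) K (grading n K 1)}

theorem coordMap_dehom (h : IsSwap b b') {d : ℕ} (F : grading n K d) :
    coordMap (iotaZero K) 1 (dehom b F.1) =
      MvPolynomial.C (T d) * coordMap (iotaOne K) (T (-1)) (dehom b' F.1) := by
  have := map_form_eq b (φ := (coordMap (iotaZero K) 1).comp (dehom b).toRingHom)
    (ψ := (coordMap (iotaOne K) (T (-1))).comp (dehom b').toRingHom)
    (t := (MvPolynomial.C (T 1) : MvPolynomial ι (LaurentPolynomial K))) ?_ ?_ F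
  · refine this.trans ?_
    rw [← map_pow, T_pow, mul_one]
    rfl
  · intro c
    change coordMap (iotaZero K) 1 (dehom b (algebraMap _ _ c)) =
      coordMap (iotaOne K) (T (-1)) (dehom b' (algebraMap _ _ c))
    rw [AlgHom.commutes, AlgHom.commutes]
    change coordMap (iotaZero K) 1 (MvPolynomial.C (Polynomial.C c)) =
      coordMap (iotaOne K) (T (-1)) (MvPolynomial.C (Polynomial.C c))
    rw [coordMap_C, coordMap_C]
    congr 1
    simp
  · rintro (i | j)
    · fin_cases i
      · change coordMap (iotaZero K) 1 (dehom b (b (.inl 0)).1) = MvPolynomial.C (T 1) *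
          coordMap (iotaOne K) (T (-1)) (dehom b' (b (.inl 0)).1)
        rw [dehom_zero, ← h.one, dehom_one, coordMap_C, iotaOne_X, map_one, ← map_mul, ← T_add,
          add_neg_cancel, T_zero, map_one]
      · change coordMap (iotaZero K) 1 (dehom b (b (.inl 1)).1) = MvPolynomial.C (T 1) *
          coordMap (iotaOne K) (T (-1)) (dehom b' (b (.inl 1)).1)
        rw [dehom_one, ← h.zero, dehom_zero, coordMap_C, map_one, mul_one]
        congr 1
        exact Polynomial.toLaurent_X
    · change coordMap (iotaZero K) 1 (dehom b (b (.inr j)).1) = MvPolynomial.C (T 1) *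
        coordMap (iotaOne K) (T (-1)) (dehom b' (b (.inr j)).1)
      rw [dehom_inr, ← h.inr j, dehom_inr, coordMap_X, coordMap_X, ← mul_assoc, ← map_mul,
        ← T_add, add_neg_cancel, T_zero]

/-- The ideals of a curve in the two charts determine each other. -/
theorem map_chartIdeal_eq {C : (ProjSpace n K).IdealSheafData} (h : IsSwap b b') :
    (chartIdeal b C).map (coordMap (iotaZero K) 1) =
      (chartIdeal b' C).map (coordMap (iotaOne K) (T (-1))) :=
  (overlap_ideal_left h).symm.trans (overlap_ideal_right h)

/-- A form that vanishes on `C` in the first chart vanishes on the overlap. In the second chart it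
then vanishes on `C` up to powers of the coordinate of the line, which are not zero divisors. -/
theorem dehom_mem_of_dehom_mem {C : (ProjSpace n K).IdealSheafData} (h : IsSwap b b')
    (hX : ∀ F, MvPolynomial.C Polynomial.X * F ∈ chartIdeal b' C → F ∈ chartIdeal b' C) {d : ℕ}
    (F : grading n K d) (hF : dehom b F.1 ∈ chartIdeal b C) : dehom b' F.1 ∈ chartIdeal b' C := by
  apply mem_of_coordMap_mem_map hX
  rw [← map_chartIdeal_eq h]
  have h1 := Ideal.mul_mem_left _ (MvPolynomial.C (T (-d)))
    (Ideal.mem_map_of_mem (coordMap (iotaZero K) 1) hF)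
  rwa [coordMap_dehom h, ← mul_assoc, ← map_mul, ← T_add, neg_add_cancel, T_zero, map_one,
    one_mul] at h1

end Dehom

end ProjCurve

/-! ### Saturated submodules of `K[u]^ι` and the growth of their quotients -/

namespace ProjCurve

section PolynomialModules

open Polynomial

variable {K : Type*} [Field K] {ι : Type*}

/-- The vectors of polynomials of degree less than `d`. -/
noncomputable def polyLT (K : Type*) [Field K] (ι : Type*) (d : ℕ) : Submodule K (ι → K[X]) :=
  Submodule.pi Set.univ fun _ => degreeLT K d

theorem mem_polyLT {d : ℕ} {g : ι → K[X]} : g ∈ polyLT K ι d ↔ ∀ i, g i ∈ degreeLT K d := by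
  simp [polyLT, Submodule.mem_pi]

/-- Vectors of polynomials of bounded degree are given by their coefficients. -/
noncomputable def polyLTEquiv (K : Type*) [Field K] (ι : Type*) (d : ℕ) :
    polyLT K ι d ≃ₗ[K] (ι → Fin d → K) :=
  LinearEquiv.trans
    { toFun := fun g i => (⟨g.1 i, mem_polyLT.1 g.2 i⟩ : degreeLT K d)
      invFun := fun g => ⟨fun i => (g i).1, mem_polyLT.2 fun i => (g i).2⟩
      map_add' := fun _ _ => rfl
      map_smul' := fun _ _ => rfl
      left_inv := fun _ => rfl
      right_inv := fun _ => rfl }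
    (LinearEquiv.piCongrRight fun _ => degreeLTEquiv K d)

theorem finrank_polyLT [Fintype ι] (d : ℕ) :
    Module.finrank K (polyLT K ι d) = Fintype.card ι * d := by
  rw [(polyLTEquiv K ι d).finrank_eq, Module.finrank_pi_fintype]
  simp

theorem finite_polyLT [Finite ι] (d : ℕ) : Module.Finite K (polyLT K ι d) :=
  Module.Finite.equiv (polyLTEquiv K ι d).symm

theorem mul_mem_degreeLT {d m : ℕ} {p q : K[X]} (hp : p ∈ degreeLT K d) (hq : q ∈ degreeLT K m) :
    p * q ∈ degreeLT K (d + m) := by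
  by_cases hp0 : p = 0
  · rw [hp0, zero_mul]; exact zero_mem _
  by_cases hq0 : q = 0
  · rw [hq0, mul_zero]; exact zero_mem _
  rw [mem_degreeLT, degree_eq_natDegree hp0, Nat.cast_lt] at hp
  rw [mem_degreeLT, degree_eq_natDegree hq0, Nat.cast_lt] at hq
  rw [mem_degreeLT, degree_eq_natDegree (mul_ne_zero hp0 hq0), Nat.cast_lt,
    natDegree_mul hp0 hq0]
  omega

theorem exists_forall_mem_degreeLT {J : Type*} [Finite J] (p : J → K[X]) :
    ∃ m, ∀ j, p j ∈ degreeLT K m := by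
  have := Fintype.ofFinite J
  refine ⟨Finset.univ.sup (fun j => (p j).natDegree) + 1, fun j => ?_⟩
  rw [mem_degreeLT]
  refine lt_of_le_of_lt degree_le_natDegree (Nat.cast_lt.2 (Nat.lt_succ_of_le ?_))
  exact Finset.le_sup (f := fun j => (p j).natDegree) (Finset.mem_univ j)

theorem linearMap_apply_eq_sum [Fintype ι] [DecidableEq ι] {M : Type*} [AddCommGroup M]
    [Module K[X] M] (f : (ι → K[X]) →ₗ[K[X]] M) (g : ι → K[X]) :
    f g = ∑ j, g j • f (Pi.single j 1) := by
  conv_lhs => rw [pi_eq_sum_univ' g, map_sum]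
  refine Finset.sum_congr rfl fun j _ => ?_
  rw [map_smul]

/-- A linear map raises degrees by a bounded amount. Together with the lower bound
`exists_le_finrank_map`, this reads off the rank `r` as the slope of the growth. -/
theorem exists_finrank_map_le [Finite ι] {r : ℕ} (f : (ι → K[X]) →ₗ[K[X]] (Fin r → K[X])) :
    ∃ m, ∀ d, Module.finrank K ((polyLT K ι d).map (f.restrictScalars K)) ≤ r * (d + m) := by
  classical
  have := Fintype.ofFinite ι
  obtain ⟨m, hm⟩ := exists_forall_mem_degreeLT fun p : ι × Fin r => f (Pi.single p.1 1) p.2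
  refine ⟨m, fun d => ?_⟩
  have h : (polyLT K ι d).map (f.restrictScalars K) ≤ polyLT K (Fin r) (d + m) := by
    rintro _ ⟨g, hg, rfl⟩
    refine mem_polyLT.2 fun i => ?_
    rw [LinearMap.restrictScalars_apply, linearMap_apply_eq_sum, Finset.sum_apply]
    refine sum_mem fun j _ => ?_
    rw [Pi.smul_apply, smul_eq_mul]
    exact mul_mem_degreeLT (mem_polyLT.1 hg j) (hm (j, i))
  have := finite_polyLT (K := K) (ι := Fin r) (d + m)
  calc _ ≤ _ := Submodule.finrank_mono h
    _ = r * (d + m) := by rw [finrank_polyLT, Fintype.card_fin]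

theorem exists_polyLT_le_map [Finite ι] {r : ℕ} {f : (ι → K[X]) →ₗ[K[X]] (Fin r → K[X])}
    (hf : Function.Surjective f) :
    ∃ N, ∀ d, polyLT K (Fin r) d ≤ (polyLT K ι (d + N)).map (f.restrictScalars K) := by
  classical
  choose l hl using fun i : Fin r => hf (Pi.single i 1)
  obtain ⟨N, hN⟩ := exists_forall_mem_degreeLT fun p : Fin r × ι => l p.1 p.2
  refine ⟨N, fun d g hg => ⟨∑ i, g i • l i, ?_, ?_⟩⟩
  · refine mem_polyLT.2 fun j => ?_
    rw [Finset.sum_apply]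
    refine sum_mem fun i _ => ?_
    rw [Pi.smul_apply, smul_eq_mul]
    exact mul_mem_degreeLT (mem_polyLT.1 hg i) (hN (i, j))
  · rw [LinearMap.restrictScalars_apply, map_sum]
    conv_rhs => rw [pi_eq_sum_univ' g]
    refine Finset.sum_congr rfl fun i _ => ?_
    rw [map_smul, hl]

theorem exists_le_finrank_map [Finite ι] {r : ℕ} {f : (ι → K[X]) →ₗ[K[X]] (Fin r → K[X])}
    (hf : Function.Surjective f) : ∃ N, ∀ d,
      r * d ≤ Module.finrank K ((polyLT K ι (d + N)).map (f.restrictScalars K)) := by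
  obtain ⟨N, hN⟩ := exists_polyLT_le_map hf
  refine ⟨N, fun d => ?_⟩
  have := finite_polyLT (K := K) (ι := ι) (d + N)
  calc r * d = _ := by rw [finrank_polyLT, Fintype.card_fin]
    _ ≤ _ := Submodule.finrank_mono (hN d)

/-- Saturation means that the quotient is torsion-free; being finitely generated over a principal
ideal domain, it is free. -/
theorem exists_equiv_of_saturated [Finite ι] {M : Submodule K[X] (ι → K[X])}
    (hM : ∀ p : K[X], p ≠ 0 → ∀ g, p • g ∈ M → g ∈ M) :
    ∃ r, Nonempty (((ι → K[X]) ⧸ M) ≃ₗ[K[X]] (Fin r → K[X])) := by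
  have : Module.IsTorsionFree K[X] ((ι → K[X]) ⧸ M) := by
    refine ⟨fun p hp => ?_⟩
    rw [isSMulRegular_iff_right_eq_zero_of_smul]
    intro x hx
    obtain ⟨g, rfl⟩ := M.mkQ_surjective x
    rw [← map_smul, Submodule.mkQ_apply, Submodule.Quotient.mk_eq_zero] at hx
    rw [Submodule.mkQ_apply, Submodule.Quotient.mk_eq_zero]
    exact hM p hp.ne_zero g hx
  have := Module.free_of_finite_type_torsion_free' (R := K[X]) (M := (ι → K[X]) ⧸ M)
  exact ⟨_, ⟨(Module.finBasis K[X] ((ι → K[X]) ⧸ M)).equivFun⟩⟩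

/-- Linear combinations with coefficients of bounded degree of a unimodular family fill up the
polynomials of bounded degree. -/
theorem map_polyLT_eq_degreeLT [Fintype ι] {f h : ι → K[X]} (hf : ∑ j, h j * f j = 1) {m : ℕ}
    (hm : ∀ j, (f j).natDegree ≤ m) {j₀ : ι} (hj₀ : (f j₀).coeff m ≠ 0) : ∃ D, ∀ d ≥ D,
      (polyLT K ι d).map ((Fintype.linearCombination K[X] f).restrictScalars K) =
        degreeLT K (d + m) := by
  classical
  obtain ⟨N, hN⟩ := exists_forall_mem_degreeLT h
  have hf0 : f j₀ ≠ 0 := fun h0 => hj₀ (by rw [h0, coeff_zero])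
  have hdeg : (f j₀).natDegree = m := (hm j₀).antisymm (le_natDegree_of_ne_zero hj₀)
  refine ⟨m + N, fun d hd => le_antisymm ?_ fun p hp => ?_⟩
  · rintro _ ⟨g, hg, rfl⟩
    rw [LinearMap.restrictScalars_apply, Fintype.linearCombination_apply]
    refine sum_mem fun j _ => ?_
    rw [smul_eq_mul]
    by_cases h0 : g j * f j = 0
    · rw [h0]; exact zero_mem _
    have hg' := mem_polyLT.1 hg j
    rw [mem_degreeLT, degree_eq_natDegree (left_ne_zero_of_mul h0), Nat.cast_lt] at hg'
    rw [mem_degreeLT, degree_eq_natDegree h0, Nat.cast_lt, natDegree_mul (left_ne_zero_of_mul h0)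
      (right_ne_zero_of_mul h0)]
    have := hm j
    omega
  -- Divide `p` by the entry of degree exactly `m`. The quotient is a coefficient of `f j₀`, and the
  -- remainder `ρ` is `∑ (ρ h_j) f_j`, whose coefficients have degree less than `m + N ≤ d`.
  · have hr : p % f j₀ ∈ degreeLT K m := by
      rw [mem_degreeLT]
      refine lt_of_lt_of_le (degree_mod_lt p hf0) ?_
      rw [degree_eq_natDegree hf0, hdeg]
    have hq : p / f j₀ ∈ degreeLT K d := by
      by_cases h0 : p / f j₀ = 0
      · rw [h0]; exact zero_mem _
      have h1 : f j₀ * (p / f j₀) ∈ degreeLT K (d + m) := by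
        have : f j₀ * (p / f j₀) = p - p % f j₀ :=
          eq_sub_of_add_eq (EuclideanDomain.div_add_mod p (f j₀))
        rw [this]
        exact sub_mem hp (degreeLT_mono (Nat.le_add_left m d) hr)
      rw [mem_degreeLT, degree_eq_natDegree (mul_ne_zero hf0 h0), Nat.cast_lt,
        natDegree_mul hf0 h0] at h1
      rw [mem_degreeLT, degree_eq_natDegree h0, Nat.cast_lt]
      omega
    refine ⟨Pi.single j₀ (p / f j₀) + (p % f j₀) • h, add_mem ?_ ?_, ?_⟩
    · refine mem_polyLT.2 fun j => ?_
      by_cases hj : j = j₀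
      · subst hj
        rwa [Pi.single_eq_same]
      · rw [Pi.single_eq_of_ne hj]; exact zero_mem _
    · refine mem_polyLT.2 fun j => ?_
      rw [Pi.smul_apply, smul_eq_mul]
      exact degreeLT_mono hd (mul_mem_degreeLT hr (hN j))
    · rw [LinearMap.restrictScalars_apply, map_add, Fintype.linearCombination_apply_single,
        map_smul, Fintype.linearCombination_apply, smul_eq_mul]
      simp only [smul_eq_mul, hf, mul_one]
      rw [mul_comm]
      exact EuclideanDomain.div_add_mod p (f j₀)

/-- A saturated submodule whose quotient grows like polynomials in one variable is the kernel of
a unimodular linear form, whose degree is determined by the growth. -/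
theorem exists_unimodular [Fintype ι] {M : Submodule K[X] (ι → K[X])}
    (hM : ∀ p : K[X], p ≠ 0 → ∀ g, p • g ∈ M → g ∈ M) {g : ℤ}
    (hg : ∀ᶠ d : ℕ in Filter.atTop,
      (Module.finrank K ((polyLT K ι d).map (M.mkQ.restrictScalars K)) : ℤ) = d - g) :
    ∃ (f h : ι → K[X]) (m : ℕ), (m : ℤ) = -g ∧ ∑ j, h j * f j = 1 ∧
      (∀ j, (f j).natDegree ≤ m) ∧ (∃ j, (f j).coeff m ≠ 0) ∧
      ∀ x, x ∈ M ↔ ∑ j, x j * f j = 0 := by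
  classical
  obtain ⟨r, ⟨e⟩⟩ := exists_equiv_of_saturated hM
  obtain ⟨D, hD⟩ := Filter.eventually_atTop.1 hg
  have hrank (d : ℕ) : Module.finrank K ((polyLT K ι d).map
      ((e.toLinearMap ∘ₗ M.mkQ).restrictScalars K)) =
        Module.finrank K ((polyLT K ι d).map (M.mkQ.restrictScalars K)) := by
    have : (e.toLinearMap ∘ₗ M.mkQ).restrictScalars K =
      (e.restrictScalars K).toLinearMap ∘ₗ M.mkQ.restrictScalars K := rfl
    rw [this, Submodule.map_comp]
    exact LinearEquiv.finrank_map_eq (e.restrictScalars K) _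
  have hsurj : Function.Surjective (e.toLinearMap ∘ₗ M.mkQ) :=
    e.surjective.comp M.mkQ_surjective
  obtain ⟨m, hm⟩ := exists_finrank_map_le (e.toLinearMap ∘ₗ M.mkQ)
  obtain ⟨N, hN⟩ := exists_le_finrank_map hsurj
  simp only [hrank] at hm hN
  -- The dimension grows like `d - g`, with slope one. For rank zero it would be bounded by `0`, and
  -- for rank at least two it would grow with slope at least two.
  have hr : r = 1 := by
    rcases r with _ | _ | r
    · have h1 := hm (D + g.natAbs + 1)
      have h2 := hD (D + g.natAbs + 1) (by omega)
      rw [zero_mul] at h1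
      omega
    · rfl
    · exfalso
      have h1 := hN (D + N + g.natAbs + 1)
      have h2 := hD (D + N + g.natAbs + 1 + N) (by omega)
      have h3 : 2 * (D + N + g.natAbs + 1) ≤ (r + 1 + 1) * (D + N + g.natAbs + 1) :=
        Nat.mul_le_mul_right _ (by omega)
      omega
  subst hr
  let e' := e.trans (LinearEquiv.funUnique (Fin 1) K[X] K[X])
  let f : ι → K[X] := fun j => e' (M.mkQ (Pi.single j 1))
  have hef : e'.toLinearMap ∘ₗ M.mkQ = Fintype.linearCombination K[X] f := by
    apply LinearMap.ext
    intro x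
    rw [linearMap_apply_eq_sum (e'.toLinearMap ∘ₗ M.mkQ), Fintype.linearCombination_apply]
    rfl
  have hef' (x : ι → K[X]) : e' (M.mkQ x) = ∑ j, x j * f j := by
    have := congrArg (fun t => t x) hef
    exact this.trans (Fintype.linearCombination_apply _ _ _)
  obtain ⟨h, hh⟩ := (e'.surjective.comp M.mkQ_surjective) 1
  have hh' : ∑ j, h j * f j = 1 := (hef' h).symm.trans hh
  obtain ⟨j₁, -, hj₁⟩ := Finset.exists_ne_zero_of_sum_ne_zero (hh'.symm ▸ one_ne_zero)
  obtain ⟨j₀, hj₀, hmax⟩ := Finset.exists_max_image (Finset.univ.filter fun j => f j ≠ 0)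
    (fun j => (f j).natDegree) ⟨j₁, by simpa using right_ne_zero_of_mul hj₁⟩
  have hdeg : ∀ j, (f j).natDegree ≤ (f j₀).natDegree := by
    intro j
    by_cases h0 : f j = 0
    · rw [h0, natDegree_zero]; exact Nat.zero_le _
    · exact hmax j (by simpa using h0)
  have hlead : (f j₀).coeff (f j₀).natDegree ≠ 0 :=
    leadingCoeff_ne_zero.2 (by simpa using hj₀)
  refine ⟨f, h, (f j₀).natDegree, ?_, hh', hdeg, ⟨j₀, hlead⟩, fun x => ?_⟩
  -- For large `d` the image is the space of all polynomials of degree less than `d + m`, so `d + m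
  -- = d - g`.
  · obtain ⟨D', hD'⟩ := map_polyLT_eq_degreeLT hh' hdeg hlead
    have h1 := hD' (D + D') (by omega)
    have h2 := hD (D + D') (by omega)
    have h3 : Module.finrank K ((polyLT K ι (D + D')).map
      ((e'.toLinearMap ∘ₗ M.mkQ).restrictScalars K)) =
        Module.finrank K ((polyLT K ι (D + D')).map (M.mkQ.restrictScalars K)) := by
      have : (e'.toLinearMap ∘ₗ M.mkQ).restrictScalars K =
        (e'.restrictScalars K).toLinearMap ∘ₗ M.mkQ.restrictScalars K := rfl
      rw [this, Submodule.map_comp]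
      exact LinearEquiv.finrank_map_eq (e'.restrictScalars K) _
    rw [hef, h1, (degreeLTEquiv K _).finrank_eq, Module.finrank_fin_fun] at h3
    omega
  · rw [← hef', LinearEquiv.map_eq_zero_iff, Submodule.mkQ_apply, Submodule.Quotient.mk_eq_zero]

end PolynomialModules

end ProjCurve

/-! ### Constant and linear parts along the line -/

namespace ProjCurve

section LinearPart

variable {ι : Type} {k : Type*} [CommRing k]

theorem fst_theta (f : ι → k) (F : MvPolynomial ι k) :
    (theta f F).fst = MvPolynomial.constantCoeff F := by
  induction F using MvPolynomial.induction_on with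
  | C a => rw [theta_C]; simp
  | add p q hp hq => rw [map_add, map_add, TrivSqZeroExt.fst_add, hp, hq]
  | mul_X p j hp => rw [map_mul, map_mul, theta_X, TrivSqZeroExt.fst_mul]; simp

/-- The linear form with the given coefficients. -/
noncomputable def linForm (ι : Type) [Fintype ι] (k : Type*) [CommRing k] :
    (ι → k) →ₗ[k] MvPolynomial ι k :=
  Fintype.linearCombination k MvPolynomial.X

theorem linForm_apply [Fintype ι] (g : ι → k) :
    linForm ι k g = ∑ j, MvPolynomial.C (g j) * MvPolynomial.X j := by
  simp [linForm, Fintype.linearCombination_apply, MvPolynomial.smul_eq_C_mul]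

variable [DecidableEq ι]

/-- The coefficients of the linear part of a polynomial. -/
noncomputable def linPart (F : MvPolynomial ι k) (j : ι) : k :=
  (theta (Pi.single j 1) F).snd

theorem linPart_add (F G : MvPolynomial ι k) : linPart (F + G) = linPart F + linPart G := by
  funext j
  simp [linPart]

theorem linPart_C (a : k) : linPart (MvPolynomial.C a : MvPolynomial ι k) = 0 := by
  funext j
  rw [linPart, theta_C, TrivSqZeroExt.snd_inl, Pi.zero_apply]

theorem linPart_X (j : ι) : linPart (MvPolynomial.X j : MvPolynomial ι k) = Pi.single j 1 := by
  funext i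
  rw [linPart, theta_X, TrivSqZeroExt.snd_inr, Pi.single_apply, Pi.single_apply]
  simp only [eq_comm]

theorem linPart_mul (F G : MvPolynomial ι k) : linPart (F * G) =
    MvPolynomial.constantCoeff F • linPart G + MvPolynomial.constantCoeff G • linPart F := by
  funext j
  simp [linPart, fst_theta, mul_comm]

theorem linPart_sum {J : Type*} (s : Finset J) (F : J → MvPolynomial ι k) :
    linPart (∑ j ∈ s, F j) = ∑ j ∈ s, linPart (F j) := by
  funext i
  simp [linPart, TrivSqZeroExt.snd_sum]

variable [Fintype ι]

theorem snd_theta (f : ι → k) (F : MvPolynomial ι k) :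
    (theta f F).snd = ∑ j, linPart F j * f j := by
  induction F using MvPolynomial.induction_on with
  | C a => rw [theta_C, linPart_C]; simp
  | add p q hp hq =>
    rw [map_add, linPart_add, TrivSqZeroExt.snd_add, hp, hq, ← Finset.sum_add_distrib]
    exact Finset.sum_congr rfl fun j _ => by rw [Pi.add_apply, add_mul]
  | mul_X p j hp =>
    rw [map_mul, linPart_mul, linPart_X, theta_X, DualNumber.snd_mul, fst_theta]
    simp [Pi.single_apply]

theorem linPart_linForm (g : ι → k) : linPart (linForm ι k g) = g := by
  rw [linForm_apply, linPart_sum]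
  funext i
  simp [linPart_mul, linPart_X, linPart_C, Pi.single_apply]

theorem sub_linForm_mem (F : MvPolynomial ι k) :
    F - (MvPolynomial.C (MvPolynomial.constantCoeff F) + linForm ι k (linPart F)) ∈
      lineIdeal ι k ^ 2 := by
  induction F using MvPolynomial.induction_on with
  | C a => simp [linPart_C]
  | add p q hp hq =>
    rw [linPart_add, map_add, map_add, map_add]
    convert add_mem hp hq using 1
    ring
  | mul_X p j hp =>
    have hX : (MvPolynomial.X j : MvPolynomial ι k) ∈ lineIdeal ι k := by
      simp [lineIdeal, RingHom.mem_ker]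
    have hp' : p - MvPolynomial.C (MvPolynomial.constantCoeff p) ∈ lineIdeal ι k := by
      simp [lineIdeal, RingHom.mem_ker]
    have h : linForm ι k (linPart (p * MvPolynomial.X j)) =
        MvPolynomial.C (MvPolynomial.constantCoeff p) * MvPolynomial.X j := by
      rw [linPart_mul, linPart_X, map_add, map_smul, linForm_apply]
      simp [Pi.single_apply, MvPolynomial.smul_eq_C_mul, apply_ite]
    rw [h, pow_two]
    convert Ideal.mul_mem_mul hp' hX using 1
    simp
    ring

/-- An ideal between an ideal of a line and its square is determined by its linear forms. -/
theorem mem_iff_linPart {I : Ideal (MvPolynomial ι k)} (h1 : I ≤ lineIdeal ι k)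
    (h2 : lineIdeal ι k ^ 2 ≤ I) (F : MvPolynomial ι k) :
    F ∈ I ↔ MvPolynomial.constantCoeff F = 0 ∧ linForm ι k (linPart F) ∈ I := by
  have h := h2 (sub_linForm_mem F)
  constructor
  · intro hF
    have h0 : MvPolynomial.constantCoeff F = 0 := h1 hF
    refine ⟨h0, ?_⟩
    rw [h0, map_zero, zero_add] at h
    exact (Submodule.sub_mem_iff_right I hF).1 h
  · rintro ⟨h0, hF⟩
    rw [h0, map_zero, zero_add] at h
    exact (Submodule.sub_mem_iff_left I hF).1 h

end LinearPart

/-! ### The Hilbert function in terms of linear parts -/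

section HilbertFunction

open LaurentPolynomial

variable {n : ℕ} {K : Type u} [Field K] {ι : Type}
  {b b' : Module.Basis (Fin 2 ⊕ ι) K (grading n K 1)}

theorem exists_dehom_eq_C (b : Module.Basis (Fin 2 ⊕ ι) K (grading n K 1)) {d : ℕ}
    {p : Polynomial K} (hp : p ∈ Polynomial.degreeLT K (d + 1)) :
    ∃ F : grading n K d, dehom b F.1 = MvPolynomial.C p := by
  classical
  rw [Polynomial.degreeLT_eq_span_X_pow] at hp
  induction hp using Submodule.span_induction with
  | mem x hx =>
    simp only [Finset.coe_image, Finset.coe_range, Set.mem_image, Set.mem_Iio] at hx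
    obtain ⟨i, hi, rfl⟩ := hx
    refine ⟨⟨(b (.inl 0)).1 ^ (d - i) * (b (.inl 1)).1 ^ i, ?_⟩, ?_⟩
    · have h := ((MvPolynomial.mem_homogeneousSubmodule _ _).1 (b (.inl 0)).2 |>.pow (d - i)).mul
        ((MvPolynomial.mem_homogeneousSubmodule _ _).1 (b (.inl 1)).2 |>.pow i)
      rw [MvPolynomial.mem_homogeneousSubmodule]
      convert h using 1
      omega
    · rw [map_mul, map_pow, map_pow, dehom_zero, dehom_one, one_pow, one_mul, map_pow]
  | zero => exact ⟨0, by simp⟩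
  | add x y _ _ hx hy =>
    obtain ⟨F, hF⟩ := hx
    obtain ⟨G, hG⟩ := hy
    exact ⟨F + G, by rw [Submodule.coe_add, map_add, map_add, hF, hG]⟩
  | smul a x _ hx =>
    obtain ⟨F, hF⟩ := hx
    refine ⟨a • F, ?_⟩
    rw [Submodule.coe_smul, map_smul, hF, Algebra.smul_def, Algebra.smul_def, map_mul]
    rfl

theorem ofCoeffs_mem_degreeLT (N : ℕ) (c : Fin (N + 1) → K) :
    ofCoeffs N c ∈ Polynomial.degreeLT K (N + 1) := by
  rw [ofCoeffs_apply]
  refine sum_mem fun i _ => ?_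
  rw [Polynomial.mem_degreeLT]
  exact (Polynomial.degree_monomial_le _ _).trans_lt (Nat.cast_lt.2 i.2)

/-- The vector `f` need not come from `C`: the choice `f = 0` isolates the constant part of a form
and a unit vector isolates one linear coefficient. In both cases a transition function bounds the
degree. -/
theorem theta_dehom (h : IsSwap b b') {f : ι → LaurentPolynomial K} {f₀ f₁ : ι → Polynomial K}
    (h₀ : ∀ j, iotaZero K (f₀ j) = f j) {t : LaurentPolynomial K}
    (h₁ : ∀ j, t * iotaOne K (f₁ j) = T (-1) * f j) {d : ℕ} (F : grading n K d) :
    dualMap (iotaZero K) 1 (theta f₀ (dehom b F.1)) =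
      TrivSqZeroExt.inl (T d) * dualMap (iotaOne K) t (theta f₁ (dehom b' F.1)) := by
  rw [← theta_coordMap (s := 1) (f' := f) (fun j => by rw [one_mul, one_mul, h₀]),
    ← theta_coordMap (s := T (-1)) (f' := f) h₁, coordMap_dehom h, map_mul, theta_C]

theorem constantCoeff_dehom_mem (h : IsSwap b b') {d : ℕ} (F : grading n K d) :
    MvPolynomial.constantCoeff (dehom b F.1) ∈ Polynomial.degreeLT K (d + 1) := by
  have := congrArg TrivSqZeroExt.fst (theta_dehom h (f := 0) (f₀ := 0) (f₁ := 0) (t := 1)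
    (by simp) (by simp) F)
  simp only [fst_dualMap, TrivSqZeroExt.fst_mul, TrivSqZeroExt.fst_inl, fst_theta] at this
  obtain ⟨c, hc, -⟩ := exists_ofCoeffs d this
  rw [hc]
  exact ofCoeffs_mem_degreeLT d c

/-- The transverse form `y_j` uses up one degree, so the coefficient of `y_j` in a form of degree `d
+ 1` is a section of `𝒪(d)`. -/
theorem linPart_dehom_mem [DecidableEq ι] (h : IsSwap b b') {d : ℕ} (F : grading n K (d + 1)) :
    linPart (dehom b F.1) ∈ polyLT K ι (d + 1) := by
  refine mem_polyLT.2 fun j => ?_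
  have := congrArg TrivSqZeroExt.snd (theta_dehom h (f := Pi.single j 1) (f₀ := Pi.single j 1)
    (f₁ := Pi.single j 1) (t := T (-1))
    (fun i => by rw [Pi.single_apply, Pi.single_apply]; split_ifs <;> simp)
    (fun i => by rw [Pi.single_apply, Pi.single_apply]; split_ifs <;> simp) F)
  simp only [snd_dualMap, TrivSqZeroExt.snd_mul, TrivSqZeroExt.fst_inl, TrivSqZeroExt.snd_inl,
    one_mul, smul_zero, add_zero, smul_eq_mul, ← mul_assoc, ← T_add] at this
  rw [show ((d + 1 : ℕ) : ℤ) + -1 = d by push_cast; ring] at this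
  obtain ⟨c, hc, -⟩ := exists_ofCoeffs d this
  rw [linPart, hc]
  exact ofCoeffs_mem_degreeLT d c

theorem exists_dehom_eq [Fintype ι] (b : Module.Basis (Fin 2 ⊕ ι) K (grading n K 1)) {d : ℕ}
    {p : Polynomial K} (hp : p ∈ Polynomial.degreeLT K (d + 1 + 1)) {g : ι → Polynomial K}
    (hg : g ∈ polyLT K ι (d + 1)) : ∃ F : grading n K (d + 1),
      dehom b F.1 = MvPolynomial.C p + linForm ι (Polynomial K) g := by
  obtain ⟨F, hF⟩ := exists_dehom_eq_C b hp
  choose G hG using fun j => exists_dehom_eq_C b (mem_polyLT.1 hg j)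
  refine ⟨F + ∑ j, ⟨(G j).1 * (b (.inr j)).1,
    ((MvPolynomial.mem_homogeneousSubmodule _ _).1 (G j).2).mul
      ((MvPolynomial.mem_homogeneousSubmodule _ _).1 (b (.inr j)).2)⟩, ?_⟩
  rw [Submodule.coe_add, map_add, hF, AddSubmonoidClass.coe_finsetSum, map_sum, linForm_apply]
  simp only [map_mul, hG, dehom_inr]

/-- The coefficient vectors of the linear forms in an ideal. -/
noncomputable def linModule [Fintype ι] (I : Ideal (MvPolynomial ι (Polynomial K))) :
    Submodule (Polynomial K) (ι → Polynomial K) :=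
  (I.restrictScalars (Polynomial K)).comap (linForm ι (Polynomial K))

theorem mem_linModule [Fintype ι] {I : Ideal (MvPolynomial ι (Polynomial K))}
    {g : ι → Polynomial K} : g ∈ linModule I ↔ linForm ι (Polynomial K) g ∈ I := Iff.rfl

/-- The constant and linear parts of forms, modulo the linear forms in an ideal. -/
noncomputable def linMap [Fintype ι] [DecidableEq ι]
    (b : Module.Basis (Fin 2 ⊕ ι) K (grading n K 1)) (I : Ideal (MvPolynomial ι (Polynomial K)))
    (d : ℕ) : grading n K d →ₗ[K] Polynomial K × ((ι → Polynomial K) ⧸ linModule I) where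
  toFun F := (MvPolynomial.constantCoeff (dehom b F.1), (linModule I).mkQ (linPart (dehom b F.1)))
  map_add' F G := by
    rw [Submodule.coe_add, map_add, map_add, linPart_add, map_add]
    rfl
  map_smul' c F := by
    rw [Submodule.coe_smul, map_smul]
    have : c • dehom b F.1 = MvPolynomial.C (Polynomial.C c) * dehom b F.1 := by
      rw [Algebra.smul_def]; rfl
    rw [this, linPart_mul, linPart_C, smul_zero, add_zero, map_mul, MvPolynomial.constantCoeff_C]
    refine Prod.ext ?_ ?_
    · simp [Polynomial.smul_eq_C_mul]
    · change (linModule I).mkQ (Polynomial.C c • _) = c • (linModule I).mkQ _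
      rw [map_smul, ← Polynomial.algebraMap_eq, algebraMap_smul]

theorem range_linMap [Fintype ι] [DecidableEq ι] (h : IsSwap b b')
    (I : Ideal (MvPolynomial ι (Polynomial K))) (d : ℕ) :
    LinearMap.range (linMap b I (d + 1)) = (Polynomial.degreeLT K (d + 1 + 1)).prod
      ((polyLT K ι (d + 1)).map ((linModule I).mkQ.restrictScalars K)) := by
  ext ⟨p, x⟩
  rw [Submodule.mem_prod]
  constructor
  · rintro ⟨F, hF⟩
    obtain ⟨rfl, rfl⟩ := Prod.mk.inj hF
    exact ⟨constantCoeff_dehom_mem h F, _, linPart_dehom_mem h F, rfl⟩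
  · rintro ⟨hp, g, hg, rfl⟩
    obtain ⟨F, hF⟩ := exists_dehom_eq b hp hg
    refine ⟨F, ?_⟩
    change (_, _) = (_, _)
    rw [hF]
    refine Prod.ext ?_ ?_
    · simp [linForm_apply]
    · simp [linPart_add, linPart_C, linPart_linForm]

theorem finrank_prod_submodule {V W : Type*} [AddCommGroup V] [Module K V] [AddCommGroup W]
    [Module K W] (p : Submodule K V) (q : Submodule K W) [Module.Finite K p] [Module.Finite K q] :
    Module.finrank K (p.prod q) = Module.finrank K p + Module.finrank K q := by
  let e : p.prod q ≃ₗ[K] p × q :=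
    { toFun := fun x => (⟨x.1.1, x.2.1⟩, ⟨x.1.2, x.2.2⟩)
      invFun := fun x => ⟨(x.1.1, x.2.1), x.1.2, x.2.2⟩
      map_add' := fun _ _ => rfl
      map_smul' := fun _ _ => rfl
      left_inv := fun _ => rfl
      right_inv := fun _ => rfl }
  rw [e.finrank_eq, Module.finrank_prod]

/-- The Hilbert function of a double structure on a line. -/
theorem hilbertFunction_eq [Fintype ι] (h : IsSwap b b') {C : (ProjSpace n K).IdealSheafData}
    (hC : (C.support : Set (ProjSpace n K)) = lineSet b)
    (h1 : chartIdeal b C ≤ lineIdeal ι (Polynomial K))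
    (h2 : lineIdeal ι (Polynomial K) ^ 2 ≤ chartIdeal b C)
    (hX : ∀ F, MvPolynomial.C Polynomial.X * F ∈ chartIdeal b' C → F ∈ chartIdeal b' C) (d : ℕ) :
    hilbertFunction C (d + 1) = d + 1 + 1 + Module.finrank K ((polyLT K ι (d + 1)).map
      ((linModule (chartIdeal b C)).mkQ.restrictScalars K)) := by
  classical
  -- By saturation in the second chart, the condition in the first chart suffices; there, membership
  -- depends only on the constant and linear parts.
  have hker : idealPart C (d + 1) = LinearMap.ker (linMap b (chartIdeal b C) (d + 1)) := by
    ext F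
    have hF : F ∈ idealPart C (d + 1) ↔ dehom b F.1 ∈ chartIdeal b C := by
      rw [mem_idealPart_iff h hC]
      exact ⟨fun h => h.1, fun hF => ⟨hF, dehom_mem_of_dehom_mem h hX F hF⟩⟩
    rw [hF, mem_iff_linPart h1 h2, LinearMap.mem_ker]
    change _ ↔ (_, _) = (0, 0)
    rw [Prod.mk.injEq, Submodule.mkQ_apply, Submodule.Quotient.mk_eq_zero, mem_linModule]
  have := finite_polyLT (K := K) (ι := ι) (d + 1)
  have : Module.Finite K (Polynomial.degreeLT K (d + 1 + 1)) :=
    Module.Finite.equiv (Polynomial.degreeLTEquiv K (d + 1 + 1)).symm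
  rw [hilbertFunction, hker, (LinearMap.quotKerEquivRange _).finrank_eq, range_linMap h,
    finrank_prod_submodule, (Polynomial.degreeLTEquiv K _).finrank_eq, Module.finrank_fin_fun]

end HilbertFunction

end ProjCurve

/-! ### Unimodularity at infinity -/

namespace ProjCurve

section Reflect

open LaurentPolynomial

variable {K : Type u} [Field K] {ι : Type}

theorem iotaZero_eq_reflect {m : ℕ} {p : Polynomial K} (hp : p.natDegree ≤ m) :
    iotaZero K p = T m * iotaOne K (p.reflect m) := by
  refine LaurentPolynomial.ext fun i => ?_
  rw [coeff_T_mul, coeff_iotaZero, coeff_iotaOne, Polynomial.coeff_reflect]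
  by_cases h0 : 0 ≤ i
  · by_cases hm : i ≤ m
    · rw [if_pos h0, if_pos (by omega), Polynomial.revAt_le (by omega)]
      congr 1
      omega
    · rw [if_pos h0, if_neg (by omega)]
      exact Polynomial.coeff_eq_zero_of_natDegree_lt (by omega)
  · rw [if_neg h0, if_pos (by omega), Polynomial.revAt_eq_self_of_lt (by omega)]
    exact (Polynomial.coeff_eq_zero_of_natDegree_lt (by omega)).symm

/-- A unimodular vector of homogeneous polynomials is unimodular in both charts. -/
theorem exists_sum_reflect_eq_one [Fintype ι] {f h : ι → Polynomial K} (hf : ∑ j, h j * f j = 1)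
    {m : ℕ} (hm : ∀ j, (f j).natDegree ≤ m) {j₀ : ι} (hj₀ : (f j₀).coeff m ≠ 0) :
    ∃ h' : ι → Polynomial K, ∑ j, h' j * (f j).reflect m = 1 := by
  classical
  let N := Finset.univ.sup fun j => (h j).natDegree
  have hN (j : ι) : (h j).natDegree ≤ N :=
    Finset.le_sup (f := fun j => (h j).natDegree) (Finset.mem_univ j)
  -- Homogenizing `∑ h_j f_j = 1` shows that in the second chart the only possible common zero of
  -- the entries is the origin.
  have hsum : ∑ j, (h j).reflect N * (f j).reflect m = Polynomial.X ^ (N + m) := by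
    apply iotaOne_injective
    have h1 := congrArg (iotaZero K) hf
    simp only [map_sum, map_mul, map_one, iotaZero_eq_reflect (hN _),
      iotaZero_eq_reflect (hm _)] at h1
    have h2 : T (-(N + m : ℤ)) * ∑ j, (T N * iotaOne K ((h j).reflect N)) *
        (T m * iotaOne K ((f j).reflect m)) =
          ∑ j, iotaOne K ((h j).reflect N) * iotaOne K ((f j).reflect m) := by
      rw [Finset.mul_sum]
      refine Finset.sum_congr rfl fun j _ => ?_
      have : (T (-(N + m : ℤ)) : LaurentPolynomial K) * T N * T m = 1 := by
        rw [← T_add, ← T_add, ← T_zero]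
        congr 1
        ring
      linear_combination (iotaOne K ((h j).reflect N) * iotaOne K ((f j).reflect m)) * this
    simp only [map_sum, map_mul]
    rw [← h2, h1, iotaOne_X_pow, mul_one]
    push_cast
    rfl
  -- The origin is excluded as well: the value of the reversal of `f j₀` there is the coefficient of
  -- degree `m`.
  have hX : IsCoprime (Polynomial.X ^ (N + m)) ((f j₀).reflect m) := by
    refine IsCoprime.pow_left ((Polynomial.irreducible_X.coprime_iff_not_dvd).2 ?_)
    rw [Polynomial.X_dvd_iff, Polynomial.coeff_reflect, Polynomial.revAt_le (Nat.zero_le m),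
      Nat.sub_zero]
    exact hj₀
  obtain ⟨u, v, huv⟩ := hX
  refine ⟨fun j => u * (h j).reflect N + (Pi.single j₀ v : ι → Polynomial K) j, ?_⟩
  simp only [add_mul, Finset.sum_add_distrib, mul_assoc, ← Finset.mul_sum, hsum]
  rw [← huv]
  congr 1
  simp [Pi.single_apply]

end Reflect

/-! ### Equations of a double line in both charts -/

section ChartIdeals

open LaurentPolynomial

theorem coordMap_linGen {ι k k' : Type*} [CommRing k] [CommRing k'] [Fintype ι] (g : k →+* k')
    (f h : ι → k) (j : ι) : coordMap g 1 (linGen f h j) =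
      linGen (fun j => g (f j)) (fun j => g (h j)) j := by
  simp [linGen]

theorem coordMap_sqGen {ι k k' : Type*} [CommRing k] [CommRing k'] [Fintype ι] (g : k →+* k')
    (h : ι → k) : coordMap g 1 (sqGen h) = sqGen (fun j => g (h j)) := by
  simp [sqGen]

theorem map_ker_theta {ι k k' : Type*} [CommRing k] [CommRing k'] [Fintype ι] (g : k →+* k')
    {f h : ι → k} (hf : ∑ j, h j * f j = 1) :
    (RingHom.ker (theta f)).map (coordMap g 1) = RingHom.ker (theta fun j => g (f j)) := by
  have hf' : ∑ j, g (h j) * g (f j) = 1 := by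
    simp only [← map_mul]
    rw [← map_sum, hf, map_one]
  rw [ker_theta f h hf, ker_theta _ _ hf', Ideal.map_span, Set.image_union, Set.image_singleton,
    ← Set.range_comp, coordMap_sqGen]
  congr 2
  exact congrArg Set.range (funext fun j => coordMap_linGen g f h j)

variable {n : ℕ} {K : Type u} [Field K] {ι : Type} [Fintype ι]
  {b b' : Module.Basis (Fin 2 ⊕ ι) K (grading n K 1)}

theorem eq_ker_theta {I : Ideal (MvPolynomial ι (Polynomial K))}
    (h1 : I ≤ lineIdeal ι (Polynomial K)) (h2 : lineIdeal ι (Polynomial K) ^ 2 ≤ I)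
    {f : ι → Polynomial K} (hf : ∀ x, x ∈ linModule I ↔ ∑ j, x j * f j = 0) :
    I = RingHom.ker (theta f) := by
  classical
  ext F
  rw [mem_iff_linPart h1 h2, ← mem_linModule, hf, RingHom.mem_ker, ← fst_theta f, ← snd_theta f]
  exact ⟨fun h => TrivSqZeroExt.ext h.1 h.2, fun h => by rw [h]; exact ⟨rfl, rfl⟩⟩

/-- The equations of a double line in the two charts that contain it. -/
theorem exists_chartIdeal_eq (h : IsSwap b b') {C : (ProjSpace n K).IdealSheafData}
    (hCM : ∀ x : C.subscheme, IsCohenMacaulayLocal (C.subscheme.presheaf.stalk x))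
    {L : Closeds (ProjSpace n K)} (hL : (L : Set (ProjSpace n K)) = lineSet b)
    (hCL : C.support = L) (hsq : Scheme.IdealSheafData.vanishingIdeal L ^ 2 ≤ C) {g : ℤ}
    (hg : HasDegreeAndGenus C 2 g) :
    ∃ (f₀ f₁ h₀ h₁ : ι → Polynomial K) (m : ℕ), (m : ℤ) = -g ∧ ∑ j, h₀ j * f₀ j = 1 ∧
      ∑ j, h₁ j * f₁ j = 1 ∧
      (∀ j, iotaZero K (f₀ j) = T m * iotaOne K (f₁ j)) ∧
      chartIdeal b C = RingHom.ker (theta f₀) ∧ chartIdeal b' C = RingHom.ker (theta f₁) ∧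
      (C.ideal (overlap b b')).comap (overlapEquiv h).toRingHom =
        RingHom.ker (theta fun j => iotaZero K (f₀ j)) := by
  have hC : (C.support : Set (ProjSpace n K)) = lineSet b := by rw [hCL, hL]
  have hb : lineSet b' = lineSet b := by simp only [lineSet, h.inr]
  have h1 := chartIdeal_le b hC
  have h2 := lineIdeal_sq_le b hL hsq
  have h1' := chartIdeal_le b' (hC.trans hb.symm)
  have h2' := lineIdeal_sq_le b' (hL.trans hb.symm) hsq
  have hX : ∀ F, MvPolynomial.C Polynomial.X * F ∈ chartIdeal b' C → F ∈ chartIdeal b' C :=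
    fun F => mem_chartIdeal_of_mul_mem b' hCM h1' h2' Polynomial.X_ne_zero
  obtain ⟨f₀, h₀, m, hmg, hf₀, hm, ⟨j₀, hj₀⟩, hM⟩ :=
    exists_unimodular (M := linModule (chartIdeal b C)) (g := g)
      (fun p hp x hx => by
        rw [mem_linModule, map_smul, MvPolynomial.smul_eq_C_mul] at hx
        exact mem_chartIdeal_of_mul_mem b hCM h1 h2 hp hx)
      (by
        -- In degree `d` the constant parts account for `d + 1` of the `2d + 1 - g` dimensions,
        -- which leaves `d - g` for the linear parts.
        filter_upwards [hg, Filter.eventually_ge_atTop 1] with d hd hd1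
        obtain ⟨e, rfl⟩ := Nat.exists_eq_add_of_le' hd1
        rw [hilbertFunction_eq h hC h1 h2 hX] at hd
        push_cast at hd ⊢
        linarith)
  obtain ⟨h₁, hf₁⟩ := exists_sum_reflect_eq_one hf₀ hm hj₀
  have hI₀ := eq_ker_theta h1 h2 hM
  have hI₀₁ : (chartIdeal b C).map (coordMap (iotaZero K) 1) =
      RingHom.ker (theta fun j => iotaZero K (f₀ j)) := by
    rw [hI₀, map_ker_theta _ hf₀]
  refine ⟨f₀, fun j => (f₀ j).reflect m, h₀, h₁, m, hmg, hf₀, hf₁,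
    fun j => iotaZero_eq_reflect (hm j), hI₀, ?_, (overlap_ideal_left h).trans hI₀₁⟩
  ext F
  -- Saturation recovers the second chart's ideal from the overlap, where it is known from the first
  -- chart. Since `f` changes by `u^m` and `y_j` by `u⁻¹`, the scaling of `ε` is `u^(m-1)`.
  have hF : F ∈ chartIdeal b' C ↔ coordMap (iotaOne K) (T (-1)) F ∈
      (chartIdeal b' C).map (coordMap (iotaOne K) (T (-1))) :=
    ⟨Ideal.mem_map_of_mem _, mem_of_coordMap_mem_map hX⟩
  rw [hF, ← map_chartIdeal_eq h, hI₀₁, RingHom.mem_ker, RingHom.mem_ker,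
    theta_coordMap (f := fun j => (f₀ j).reflect m) (t := T (m - 1))]
  · refine map_eq_zero_iff _ (dualMap_injective iotaOne_injective ?_)
    exact (isUnit_T _)
  · intro j
    rw [iotaZero_eq_reflect (hm j), ← mul_assoc, ← T_add]
    congr 2

end ChartIdeals

end ProjCurve

/-! ### Transfer of ideal homomorphisms to coordinates -/

namespace ProjCurve

section Transfer

variable {ι k R : Type*} [CommRing k] [CommRing R]
  (e : MvPolynomial ι k ≃+* R) {J : Ideal R} {f : ι → k}
  (hJ : J.comap e.toRingHom = RingHom.ker (theta f))

theorem theta_surjective [Fintype ι] {h : ι → k} (hf : ∑ j, h j * f j = 1) :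
    Function.Surjective (theta f) := by
  intro x
  refine ⟨MvPolynomial.C x.fst +
    MvPolynomial.C x.snd * ∑ j, MvPolynomial.C (h j) * MvPolynomial.X j, ?_⟩
  rw [map_add, map_mul, sum_theta_C f h hf, theta_C, theta_C]
  ext <;> simp

theorem theta_symm_eq_zero (hJ : J.comap e.toRingHom = RingHom.ker (theta f)) (r : R) (hr : r ∈ J) :
    (theta f).toRingHom.comp e.symm.toRingHom r = 0 := by
  have : e.symm r ∈ J.comap e.toRingHom := by
    change e (e.symm r) ∈ J
    rwa [e.apply_symm_apply]
  rw [hJ] at this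
  exact this

/-- The structure ring of a double structure, in a coordinate chart. -/
noncomputable def quotMap : R ⧸ J →+* DualNumber k :=
  Ideal.Quotient.lift J ((theta f).toRingHom.comp e.symm.toRingHom) (theta_symm_eq_zero e hJ)

theorem quotMap_mk (F : MvPolynomial ι k) :
    quotMap e hJ (Ideal.Quotient.mk J (e F)) = theta f F :=
  congrArg (theta f) (e.symm_apply_apply F)

theorem quotMap_injective : Function.Injective (quotMap e hJ) := by
  rw [injective_iff_map_eq_zero]
  intro z hz
  obtain ⟨r, rfl⟩ := Ideal.Quotient.mk_surjective z
  obtain ⟨F, rfl⟩ := e.surjective r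
  rw [quotMap_mk, ← RingHom.mem_ker, ← hJ] at hz
  exact Ideal.Quotient.eq_zero_iff_mem.2 hz

theorem quotMap_surjective [Fintype ι] {h : ι → k} (hf : ∑ j, h j * f j = 1) :
    Function.Surjective (quotMap e hJ) := by
  intro x
  obtain ⟨F, rfl⟩ := theta_surjective hf x
  exact ⟨_, quotMap_mk e hJ F⟩

/-- Coordinates of elements of the ideal. -/
noncomputable def toIdeal (s : RingHom.ker (theta f)) : J :=
  ⟨e s.1, (hJ.symm ▸ s.2 : s.1 ∈ J.comap e.toRingHom)⟩

theorem toIdeal_surjective : Function.Surjective (toIdeal e hJ) := by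
  rintro ⟨r, hr⟩
  obtain ⟨F, rfl⟩ := e.surjective r
  have hF : F ∈ J.comap e.toRingHom := hr
  exact ⟨⟨F, hJ ▸ hF⟩, rfl⟩

theorem toIdeal_injective : Function.Injective (toIdeal e hJ) := by
  intro s t h
  exact Subtype.ext (e.injective (congrArg Subtype.val h))

theorem toIdeal_add (s t : RingHom.ker (theta f)) :
    toIdeal e hJ (s + t) = toIdeal e hJ s + toIdeal e hJ t :=
  Subtype.ext (map_add e _ _)

theorem toIdeal_smul (a : MvPolynomial ι k) (s : RingHom.ker (theta f)) :
    toIdeal e hJ (a • s) = e a • toIdeal e hJ s :=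
  Subtype.ext (map_mul e _ _)

theorem quotMap_smul (a : MvPolynomial ι k) (z : R ⧸ J) :
    quotMap e hJ (e a • z) = theta f a * quotMap e hJ z := by
  rw [← quotMap_mk e hJ, ← map_mul, Algebra.smul_def]
  rfl

/-- A homomorphism from the ideal of a double structure to its structure ring, in a coordinate
chart. -/
noncomputable def toNormal (ψ : J →ₗ[R] R ⧸ J) : RingHom.ker (theta f) → DualNumber k :=
  fun s => quotMap e hJ (ψ (toIdeal e hJ s))

theorem isNormalHom_toNormal (ψ : J →ₗ[R] R ⧸ J) : IsNormalHom f (toNormal e hJ ψ) where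
  add s t := by rw [toNormal, toNormal, toNormal, toIdeal_add, map_add, map_add]
  smul a s := by rw [toNormal, toNormal, toIdeal_smul, map_smul, quotMap_smul]

theorem toNormal_eq_zero {ψ : J →ₗ[R] R ⧸ J} (h : toNormal e hJ ψ = 0) : ψ = 0 := by
  refine LinearMap.ext fun r => ?_
  obtain ⟨s, rfl⟩ := toIdeal_surjective e hJ r
  exact quotMap_injective e hJ ((congrFun h s).trans (map_zero _).symm)

theorem IsNormalHom.exists_toNormal_eq [Fintype ι] {h : ι → k} (hf : ∑ j, h j * f j = 1)
    {φ : RingHom.ker (theta f) → DualNumber k} (hφ : IsNormalHom f φ) :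
    ∃ ψ, toNormal e hJ ψ = φ := by
  let E := Equiv.ofBijective _ ⟨toIdeal_injective e hJ, toIdeal_surjective e hJ⟩
  let Q := Equiv.ofBijective _ ⟨quotMap_injective e hJ, quotMap_surjective e hJ hf⟩
  have hE (r : J) : toIdeal e hJ (E.symm r) = r := E.apply_symm_apply r
  have hE' (s) : E.symm (toIdeal e hJ s) = s := E.symm_apply_apply s
  have hQ (x) : quotMap e hJ (Q.symm x) = x := Q.apply_symm_apply x
  refine ⟨{ toFun := fun r => Q.symm (φ (E.symm r)), map_add' := fun r r' => ?_,
            map_smul' := fun a r => ?_ }, funext fun s => ?_⟩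
  · apply quotMap_injective e hJ
    rw [map_add (quotMap e hJ), hQ, hQ, hQ, ← hφ.add]
    congr 1
    apply toIdeal_injective e hJ
    rw [toIdeal_add, hE, hE, hE]
  · obtain ⟨F, rfl⟩ := e.surjective a
    apply quotMap_injective e hJ
    rw [RingHom.id_apply, quotMap_smul, hQ, hQ, ← hφ.smul]
    congr 1
    apply toIdeal_injective e hJ
    rw [toIdeal_smul, hE, hE]
  · change quotMap e hJ (Q.symm (φ (E.symm (toIdeal e hJ s)))) = φ s
    rw [hE', hQ]

end Transfer

/-! ### Global sections of the normal sheaf -/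

section Sections

variable {n : ℕ} {K : Type u} [Field K] {C : (ProjSpace n K).IdealSheafData}

/-- In coordinates, restriction of functions becomes `coordMap` and restriction to `C` becomes
`dualMap`; the equivalence holds because `toIdeal` is surjective and `quotMap` is injective. -/
theorem extends_iff_toNormal {ι k k' : Type*} [CommRing k] [CommRing k']
    {U V : (ProjSpace n K).affineOpens} (hUV : U ≤ V)
    {e : MvPolynomial ι k ≃+* Γ(ProjSpace n K, V)} {e' : MvPolynomial ι k' ≃+* Γ(ProjSpace n K, U)}
    {f : ι → k} {f' : ι → k'} (hJ : (C.ideal V).comap e.toRingHom = RingHom.ker (theta f))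
    (hJ' : (C.ideal U).comap e'.toRingHom = RingHom.ker (theta f')) {g : k →+* k'} {s t : k'}
    (hc : ∀ F, e' (coordMap g s F) = res hUV (e F)) (hff : ∀ j, t * g (f j) = s * f' j)
    (ψ : IdealHom C V) (ψ' : IdealHom C U) :
    Extends C hUV ψ ψ' ↔ ∀ (x : RingHom.ker (theta f)) h,
      toNormal e' hJ' ψ' ⟨coordMap g s x.1, h⟩ = dualMap g t (toNormal e hJ ψ x) := by
  have h1 (x : RingHom.ker (theta f)) (h) : toIdeal e' hJ' ⟨coordMap g s x.1, h⟩ =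
      restrictIdeal C hUV (toIdeal e hJ x) := Subtype.ext (hc x.1)
  have h2 (z) : dualMap g t (quotMap e hJ z) = quotMap e' hJ' (restrictStructure C hUV z) := by
    obtain ⟨r, rfl⟩ := Ideal.Quotient.mk_surjective z
    obtain ⟨F, rfl⟩ := e.surjective r
    rw [restrictStructure_mk, ← hc, quotMap_mk, quotMap_mk, theta_coordMap hff]
  constructor
  · intro H x h
    rw [toNormal, toNormal, h1, h2, H]
  · intro H r
    obtain ⟨x, rfl⟩ := toIdeal_surjective e hJ r
    have := H x (coordMap_mem_ker hff x)
    rw [toNormal, toNormal, h1, h2] at this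
    exact quotMap_injective e' hJ' this

variable {ι : Type} {b b' : Module.Basis (Fin 2 ⊕ ι) K (grading n K 1)} {f : ι → Polynomial K}

theorem toNormal_smul (hJ : (C.ideal (nonvanishing (b (.inl 0)))).comap (chartEquiv b).toRingHom =
    RingHom.ker (theta f)) (c : K)
    (ψ : LocalNormalSections C (nonvanishing (b (.inl 0)))) :
    toNormal (chartEquiv b) hJ (LocalNormalSections.toIdealHom C (c • ψ)) =
      c • toNormal (chartEquiv b) hJ (LocalNormalSections.toIdealHom C ψ) := by
  funext s
  change quotMap (chartEquiv b) hJ (c • ψ _) = c • quotMap (chartEquiv b) hJ (ψ _)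
  generalize ψ _ = z
  have h1 : c • z = chartEquiv b (MvPolynomial.C (Polynomial.C c)) • z := by
    obtain ⟨r, rfl⟩ := Ideal.Quotient.mk_surjective z
    rw [chartEquiv_C, ← Ideal.Quotient.mkₐ_eq_mk K, ← map_smul, Algebra.smul_def]
    rfl
  rw [h1, quotMap_smul, theta_C]
  ext <;> simp [Polynomial.smul_eq_C_mul]

/-- Sections of the normal sheaf of a double structure on a line, in the two charts that contain
the line. -/
noncomputable def toNormalPair {f₀ f₁ : ι → Polynomial K}
    (hI₀ : chartIdeal b C = RingHom.ker (theta f₀))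
    (hI₁ : chartIdeal b' C = RingHom.ker (theta f₁)) : normalSections C →ₗ[K]
      (RingHom.ker (theta f₀) → DualNumber (Polynomial K)) ×
        (RingHom.ker (theta f₁) → DualNumber (Polynomial K)) where
  toFun φ := (toNormal (chartEquiv b) hI₀ (LocalNormalSections.toIdealHom C (φ.1 _)),
    toNormal (chartEquiv b') hI₁ (LocalNormalSections.toIdealHom C (φ.1 _)))
  map_add' _ _ := Prod.ext (funext fun _ => map_add (quotMap _ hI₀) _ _)
    (funext fun _ => map_add (quotMap _ hI₁) _ _)
  map_smul' c _ := Prod.ext (toNormal_smul hI₀ c _) (toNormal_smul hI₁ c _)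

open LaurentPolynomial in
theorem finrank_normalSections [Fintype ι] (h : IsSwap b b')
    (hC : (C.support : Set (ProjSpace n K)) = lineSet b) {f₀ f₁ h₀ h₁ : ι → Polynomial K}
    (hf₀ : ∑ j, h₀ j * f₀ j = 1) (hf₁ : ∑ j, h₁ j * f₁ j = 1) {a : ℕ}
    (hT : ∀ j, T (a : ℤ) * iotaOne K (f₁ j) = T (-1) * iotaZero K (f₀ j))
    (hI₀ : chartIdeal b C = RingHom.ker (theta f₀))
    (hI₁ : chartIdeal b' C = RingHom.ker (theta f₁))
    (hI₀₁ : (C.ideal (overlap b b')).comap (overlapEquiv h).toRingHom =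
      RingHom.ker (theta fun j => iotaZero K (f₀ j))) :
    h0Normal C + (constRank a + 1) = Fintype.card ι * 2 + Fintype.card ι * (a + 2) +
      2 * constRank a + polarRank K a := by
  have hc : ∀ x ∈ C.support, x ∈ (nonvanishing (b (.inl 0))).1 ∨
      x ∈ (nonvanishing (b' (.inl 0))).1 := by
    intro x hx
    have hx' : x ∈ (C.support : Set (ProjSpace n K)) := hx
    rw [hC] at hx'
    exact mem_nonvanishing_or h hx'
  have hff₀ : ∀ j, 1 * iotaZero K (f₀ j) = 1 * iotaZero K (f₀ j) := fun j => rfl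
  have hF : ∑ j, iotaZero K (h₀ j) * iotaZero K (f₀ j) = 1 := by
    simp only [← map_mul]; rw [← map_sum, hf₀, map_one]
  refine finrank_of_range_eq_isGlobalNormal (E := normalSections C) hf₀ hf₁ hT (toNormalPair hI₀ hI₁) ?_ fun φ => ?_
  · rw [injective_iff_map_eq_zero]
    intro φ hφ
    exact Subtype.ext (normalSections_eq_zero hc φ.2
      (toNormal_eq_zero _ hI₀ (congrArg Prod.fst hφ))
      (toNormal_eq_zero _ hI₁ (congrArg Prod.snd hφ)))
  · constructor
    · rintro ⟨φ, rfl⟩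
      have hφ := (mem_normalSections_iff C φ.1).1 φ.2
      refine ⟨isNormalHom_toNormal _ _ _, isNormalHom_toNormal _ _ _,
        toNormal (overlapEquiv h) hI₀₁ (LocalNormalSections.toIdealHom C (φ.1 (overlap b b'))),
        isNormalHom_toNormal _ _ _, ?_, ?_⟩
      · exact (extends_iff_toNormal (overlap_le_left b b') hI₀ hI₀₁ (overlapEquiv_left h) hff₀
          _ _).1 (hφ _ _ _)
      · exact (extends_iff_toNormal (overlap_le_right b b') hI₁ hI₀₁ (overlapEquiv_right h) hT
          _ _).1 (hφ _ _ _)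
    · obtain ⟨φ₀, φ₁⟩ := φ
      rintro ⟨H₀, H₁, φ', H', hφ₀, hφ₁⟩
      obtain ⟨ψ₀, rfl⟩ := H₀.exists_toNormal_eq (chartEquiv b) hI₀ hf₀
      obtain ⟨ψ₁, rfl⟩ := H₁.exists_toNormal_eq (chartEquiv b') hI₁ hf₁
      obtain ⟨ψ', rfl⟩ := H'.exists_toNormal_eq (overlapEquiv h) hI₀₁ hF
      obtain ⟨φ, hφ, e₀, e₁⟩ := exists_normalSections (overlap_eq b b') hc
        ((extends_iff_toNormal (overlap_le_left b b') hI₀ hI₀₁ (overlapEquiv_left h) hff₀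
          ψ₀ ψ').2 hφ₀)
        ((extends_iff_toNormal (overlap_le_right b b') hI₁ hI₀₁ (overlapEquiv_right h) hT
          ψ₁ ψ').2 hφ₁)
      exact ⟨⟨φ, hφ⟩, Prod.ext (congrArg (toNormal _ hI₀) e₀) (congrArg (toNormal _ hI₁) e₁)⟩

open LaurentPolynomial in
/-- The number of sections of the normal sheaf of a double line. -/
theorem IsDoubleLine.h0Normal_add {g : ℤ} (hC : IsDoubleLine C g) {a : ℕ} (ha : (a : ℤ) = -1 - g) :
    h0Normal C + (constRank a + 1) = (n - 1) * 2 + (n - 1) * (a + 2) +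
      2 * constRank a + polarRank K a := by
  obtain ⟨L, hL, hCL, hsq⟩ := hC.isRope.exists_line
  obtain ⟨b, hb⟩ := hL.exists_basis
  obtain ⟨b', h⟩ := exists_isSwap b
  obtain ⟨f₀, f₁, h₀, h₁, m, hm, hf₀, hf₁, hT, hI₀, hI₁, hI₀₁⟩ :=
    exists_chartIdeal_eq h hC.isRope.isCurve.cohenMacaulay hb hCL hsq hC.degree_genus
  -- The degree of `f` is `m = a + 1`, so `ε` changes by `u^a`.
  have := finrank_normalSections (a := a) h (by rw [hCL, hb]) hf₀ hf₁ (fun j => ?_) hI₀ hI₁ hI₀₁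
  · rwa [Fintype.card_fin] at this
  · rw [hT, ← mul_assoc, ← T_add]
    congr 2
    omega

end Sections

end ProjCurve

/-! ### The three cases -/

theorem mainTheorem6 {K : Type u} [Field K] {n : ℕ} (hn : 3 ≤ n)
    (C : (ProjCurve.ProjSpace n K).IdealSheafData) (g : ℤ) (hC : ProjCurve.IsDoubleLine C g) :
    (g = -1 → (ProjCurve.h0Normal C : ℤ) = 4 * ((n : ℤ) - 1)) ∧
    (g ≤ -2 → ringChar K ≠ 2 →
      (ProjCurve.h0Normal C : ℤ) = ((n : ℤ) - 1) * (3 - g) - 1) ∧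
    (g ≤ -2 → ringChar K = 2 →
      (ProjCurve.h0Normal C : ℤ) = (n : ℤ) * (3 - g) - 6) := by
  have hn1 : ((n - 1 : ℕ) : ℤ) = n - 1 := by omega
  have key {a : ℕ} (ha : (a : ℤ) = -1 - g) :
      (ProjCurve.h0Normal C : ℤ) + (ProjCurve.constRank a + 1) = (n - 1) * 2 + (n - 1) * (a + 2) +
        2 * ProjCurve.constRank a + ProjCurve.polarRank K a := by
    rw [← hn1]
    exact_mod_cast hC.h0Normal_add ha
  have h2 : ringChar K = 2 ↔ (2 : K) = 0 := by
    refine ⟨fun h => ?_, fun h => ?_⟩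
    · have := ringChar.Nat.cast_ringChar (R := K)
      rw [h] at this
      exact_mod_cast this
    · have hd : ringChar K ∣ 2 := ringChar.dvd (by exact_mod_cast h)
      exact ((Nat.dvd_prime Nat.prime_two).1 hd).resolve_left CharP.ringChar_ne_one
  refine ⟨fun hg => ?_, fun hg hK => ?_, fun hg hK => ?_⟩
  -- Here `a = 0`: constants are sections of `𝒪(-a)` and `𝒪(-2a)`, so `constRank` is `1`, and there
  -- are no polar parts.
  · have := key (a := 0) (by rw [hg]; rfl)
    simp only [ProjCurve.constRank, ProjCurve.polarRank, if_true, Nat.zero_sub, ite_self,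
      Nat.cast_zero, Nat.cast_one] at this
    linarith
  all_goals
    obtain ⟨a, ha⟩ := Int.eq_ofNat_of_zero_le (show 0 ≤ -1 - g by omega)
    -- Since `g ≤ -2`, `a ≥ 1`, and `𝒪(-a)` and `𝒪(-2a)` have no sections. The same bound makes `a -
    -- 1` an honest subtraction in characteristic 2.
    have hr : ProjCurve.constRank a = 0 := if_neg (by omega)
    have := key ha.symm
    rw [hr] at this
  · rw [ProjCurve.polarRank, if_neg (mt h2.2 hK)] at this
    rw [show (3 : ℤ) - g = a + 4 by linarith]
    push_cast at this
    linarith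
  · rw [ProjCurve.polarRank, if_pos (h2.1 hK), Nat.cast_sub (by omega)] at this
    rw [show (3 : ℤ) - g = a + 4 by linarith]
    push_cast at this
    linarith
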